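/- Let $\gamma\ge 1$, $p(\rho)=\rho^\gamma/\gamma$, and let $\mu>0$, $\mu+\lambda\ge 0$. Put $\lambda_2(\rho,u)=u+\sqrt{p'(\rho)}$ and $z_2(\rho,u)=u-\int_1^{\rho}\frac{\sqrt{p'(s)}}{s}\,ds$ for $\rho>0$. Let $\rho_\pm>0$, $u_{1\pm}\in\mathbb R$ be states connected by a 2-rarefaction wave, that is, $$u_{1+}-\int_{\rho_-}^{\rho_+}\frac{\sqrt{p'(s)}}{s}\,ds=u_{1-},\qquad w_-:=\lambda_2(\rho_-,u_{1-})<w_+:=\lambda_2(\rho_+,u_{1+}).$$ For $\delta>0$ let $w$ be the smooth solution on $[0,\infty)\times\mathbb R$ of the Burgers equation $$w_t+ww_{x_1}=0,\qquad w(0,x_1)=\frac{w_++w_-}{2}+\frac{w_+-w_-}{2}\tanh\frac{x_1}{\delta}.$$ Fix $t_0\ge 0$, and let $(\bar\rho,\bar u_1)$, $\bar\rho>0$, be the smooth approximate 2-rarefaction wave defined for $t\ge0$, $x_1\in\mathbb R$ by $$\lambda_2(\bar\rho,\bar u_1)(t,x_1)=w(t_0+t,x_1),\qquad z_2(\bar\rho,\bar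 u_1)(t,x_1)=z_2(\rho_-,u_{1-}),$$ and put $\bar m_1=\bar\rho\bar u_1$. Let $T>0$. For $\varepsilon>0$ consider on $[0,T]\times\mathbb R$ the linear hyperbolic system $$\begin{cases} d_{1t}+d_{2x_1}=0,\\ d_{2t}+\Big(-\dfrac{\bar m_1^2}{\bar\rho^2}d_1+p'(\bar\rho)d_1+\dfrac{2\bar m_1}{\bar\rho}d_2\Big)_{x_1}=(2\mu+\lambda)\,\varepsilon\,\bar u_{1x_1x_1},\\ (d_1,d_2)(0,x_1)=(0,0).\end{cases}$$ There is a constant $C_T>0$, independent of $\varepsilon$ and $\delta$, such that for all $\varepsilon>0$ and $\delta>0$ the following holds. The system has a smooth solution on $[0,T]\times\mathbb R$ (the hyperbolic wave), and every smooth solution $(d_1,d_2)$ satisfies, for all $t\in[0,T]$, $$\Big\|\frac{\partial^k}{\partial x_1^k}(d_1,d_2)(t,\cdot)\Big\|_{L^2(\mathbb R)}^2\le C_T\Big(\frac{\varepsilon}{\delta^{k+1}}\Big)^2,\qquad k=0,1,2,3,$$ and in particular $$\sup_{t\in[0,T]}\|(d_1,d_2)(t,\cdot)\|_{L^\infty(\mathbb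 R)}\le C_T\,\frac{\varepsilon}{\delta^{3/2}}.$$ -/

import Mathlib

open Set MeasureTheory
open scoped ContDiff ENNReal

noncomputable section

namespace HypWave

/-- The `γ`-law pressure `p(ρ) = ρ ^ γ / γ`. -/
def pressure (γ : ℝ) (ρ : ℝ) : ℝ := ρ ^ γ / γ

/-- The sound speed `√(p'(ρ))`. -/
def soundSpeed (γ : ℝ) (ρ : ℝ) : ℝ := Real.sqrt (deriv (pressure γ) ρ)

/-- The second eigenvalue `u + √(p'(ρ))` of the one-dimensional isentropic Euler system. -/
def eig2 (γ ρ u : ℝ) : ℝ := u + soundSpeed γ ρ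

/-- The 2-Riemann invariant `u - ∫^ρ √(p'(s)) / s ds`, with the primitive normalised at `ρ = 1`. -/
def riemann2 (γ ρ u : ℝ) : ℝ := u - ∫ s in (1 : ℝ)..ρ, soundSpeed γ s / s

/-- The states `(ρm, um)` (left) and `(ρp, up)` (right) are connected by a 2-rarefaction wave. -/
structure IsRarefactionPair (γ ρm um ρp up : ℝ) : Prop where
  left_pos : 0 < ρm
  right_pos : 0 < ρp
  invariant : up - (∫ s in ρm..ρp, soundSpeed γ s / s) = um
  expanding : eig2 γ ρm um < eig2 γ ρp up

/-- `w (t, x)` is a smooth global solution, for `t ≥ 0`, of the Burgers equation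
`w_t + w w_x = 0` with initial datum
`(wp + wm) / 2 + (wp - wm) / 2 * tanh (x / δ)`. -/
structure IsBurgersWave (wm wp δ : ℝ) (w : ℝ → ℝ → ℝ) : Prop where
  smooth : ContDiffOn ℝ ∞ (fun q : ℝ × ℝ => w q.1 q.2) (Ici 0 ×ˢ univ)
  equation : ∀ t, 0 < t → ∀ x, deriv (fun s => w s x) t + w t x * deriv (w t) x = 0
  initial : ∀ x, w 0 x = (wp + wm) / 2 + (wp - wm) / 2 * Real.tanh (x / δ)

/-- `(ρ, u) (t, x)` is the smooth approximate 2-rarefaction wave with smoothing parameter `δ`: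
the second eigenvalue equals the Burgers wave at time `t₀ + t` and the
2-Riemann invariant is constant. -/
structure IsApproxRarefaction (γ ρm um ρp up t₀ δ : ℝ) (ρ u : ℝ → ℝ → ℝ) : Prop where
  pos : ∀ t, 0 ≤ t → ∀ x, 0 < ρ t x
  eigenvalue : ∃ w : ℝ → ℝ → ℝ, IsBurgersWave (eig2 γ ρm um) (eig2 γ ρp up) δ w ∧
    ∀ t, 0 ≤ t → ∀ x, eig2 γ (ρ t x) (u t x) = w (t₀ + t) x
  invariant : ∀ t, 0 ≤ t → ∀ x, riemann2 γ (ρ t x) (u t x) = riemann2 γ ρm um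

/-- `(d₁, d₂) (t, x)` is a smooth solution on `[0, T] × ℝ` of the Euler system linearised, in the
variables density and momentum, at `(ρ, m)` with `m = ρ u`, forced by
`(2 μ + lam) ε u_xx` in the momentum equation, with zero initial data. -/
structure IsHyperbolicWave (γ μ lam ε T : ℝ) (ρ u d₁ d₂ : ℝ → ℝ → ℝ) : Prop where
  smooth₁ : ContDiffOn ℝ ∞ (fun q : ℝ × ℝ => d₁ q.1 q.2) (Icc 0 T ×ˢ univ)
  smooth₂ : ContDiffOn ℝ ∞ (fun q : ℝ × ℝ => d₂ q.1 q.2) (Icc 0 T ×ˢ univ)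
  mass : ∀ t ∈ Ioo 0 T, ∀ x, deriv (fun s => d₁ s x) t + deriv (d₂ t) x = 0
  momentum : ∀ t ∈ Ioo 0 T, ∀ x,
    deriv (fun s => d₂ s x) t +
      deriv (fun y => -((ρ t y * u t y) ^ 2 / ρ t y ^ 2) * d₁ t y
        + deriv (pressure γ) (ρ t y) * d₁ t y
        + 2 * (ρ t y * u t y) / ρ t y * d₂ t y) x
      = (2 * μ + lam) * ε * iteratedDeriv 2 (u t) x
  initial₁ : ∀ x, d₁ 0 x = 0
  initial₂ : ∀ x, d₂ 0 x = 0

/-- The `ℝ²`-valued function `x ↦ (f x, g x)`, with the Euclidean norm on `ℝ²`. -/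
def pairFun (f g : ℝ → ℝ) : ℝ → EuclideanSpace ℝ (Fin 2) := fun x => !₂[f x, g x]

end HypWave

end

/-! The approximate rarefaction is a simple wave. Constancy of the Riemann invariant makes the sound
speed `c = κ W + c₀`, `κ = (γ - 1) / (γ + 1)`, and the velocity `W - c` affine functions of one
Burgers wave `W` (`soundSpeed_affine`). The eigenvalues are then `W - 2 c` and `W`, and the forcing
is a multiple `F` of `W_xx`. In the characteristic variables `V₁ = W d₁ - d₂` and `V₂ = d₂ - (W - 2
c) d₁` the Burgers equation cancels half of the coupling: `V₁` solves a transport equation of speed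
`W - 2 c` on its own, and `V₂` one of speed `W` driven by `V₁` (`IsReducedWave.isTransportPair`).

Uniformity in `δ` rests on two properties of `q = W_x ≥ 0`: pointwise `|∂ₓʲ q| ≤ C δ⁻ʲ q`
(`ProfileRel.exists_bound`), and `∬ q ≤ 2 B T`, the total variation of `W` times the elapsed time
(`IsWave.integral_dX_le`). Hence every source term is `q` times something controlled, and
Cauchy–Schwarz in the measure `q dx dt` bounds it, provided the energy identity supplies a damping
term `∬ q v²` (`SmoothStrip.energy_le`). For `V₂` the damping comes from the expansion of the
2-characteristics. For `V₁` it comes from the weight `exp (M W)`: the 1-characteristics cross the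
wave with relative speed `2 c`, bounded below, so the weight decays along them at a rate `2 M c q`
that can be made as large as needed. Differentiating in `x` preserves this structure, and induction
on the order gives the size `F δ⁻⁽ᵏ⁺¹⁾` (`TransportData.exists_bound`). A cutoff on cones of
dependence removes any need for decay of the solution at infinity.

Since `2 c` is bounded below with derivatives of size `δ⁻ʲ`, the bounds pass to `(d₁, d₂)`
(`ScaledBound.exists_div`, `ScaledBound.mul`); the orders 0 and 1 give the sup bound
(`ScaledBound.sq_le`).

Existence is explicit. In the coordinates `τ = τ₀ + t`, `y = x - τ W` the 2-characteristics are the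
lines of constant `y`, and the 1-characteristics solve a linear ODE for `τ` as a function of `y`, so
both equations are integrated by quadrature (`exists_first_mode`, `exists_second_mode`). -/

noncomputable section

namespace HypWave

/-! ### Smooth functions on a closed strip -/

/-- `f` is smooth on the closed strip `[0, T] × ℝ`. -/
def SmoothStrip (T : ℝ) (f : ℝ → ℝ → ℝ) : Prop :=
  ContDiffOn ℝ ∞ (fun q : ℝ × ℝ => f q.1 q.2) (Icc 0 T ×ˢ univ)

/-- The derivative in the space variable. -/
def dX (f : ℝ → ℝ → ℝ) : ℝ → ℝ → ℝ := fun t x => deriv (f t) x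

/-- The derivative in the time variable. -/
def dT (f : ℝ → ℝ → ℝ) : ℝ → ℝ → ℝ := fun t x => deriv (fun s => f s x) t

theorem dX_iterate (f : ℝ → ℝ → ℝ) (k : ℕ) (t : ℝ) : dX^[k] f t = iteratedDeriv k (f t) := by
  induction k with
  | zero => simp
  | succ k ih =>
    rw [Function.iterate_succ_apply', iteratedDeriv_succ, ← ih]
    rfl

namespace SmoothStrip

variable {T : ℝ} {f g : ℝ → ℝ → ℝ}

theorem add (hf : SmoothStrip T f) (hg : SmoothStrip T g) :
    SmoothStrip T (fun t x => f t x + g t x) := ContDiffOn.add hf hg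

theorem sub (hf : SmoothStrip T f) (hg : SmoothStrip T g) :
    SmoothStrip T (fun t x => f t x - g t x) := ContDiffOn.sub hf hg

theorem mul (hf : SmoothStrip T f) (hg : SmoothStrip T g) :
    SmoothStrip T (fun t x => f t x * g t x) := ContDiffOn.mul hf hg

theorem div (hf : SmoothStrip T f) (hg : SmoothStrip T g)
    (h0 : ∀ t ∈ Icc 0 T, ∀ x, g t x ≠ 0) :
    SmoothStrip T (fun t x => f t x / g t x) :=
  ContDiffOn.div hf hg fun _ hq => h0 _ hq.1 _

theorem const (c : ℝ) : SmoothStrip T (fun _ _ => c) := contDiffOn_const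

theorem time : SmoothStrip T (fun t _ => t) := contDiffOn_fst

theorem space : SmoothStrip T (fun _ x => x) := contDiffOn_snd

theorem comp {φ : ℝ → ℝ} (hφ : ContDiff ℝ ∞ φ) (hf : SmoothStrip T f) :
    SmoothStrip T (fun t x => φ (f t x)) := hφ.comp_contDiffOn hf

theorem comp₂ {φ : ℝ × ℝ → ℝ} (hφ : ContDiff ℝ ∞ φ) (hf : SmoothStrip T f)
    (hg : SmoothStrip T g) : SmoothStrip T (fun t x => φ (f t x, g t x)) :=
  hφ.comp_contDiffOn (ContDiffOn.prodMk hf hg)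

theorem continuousOn (hf : SmoothStrip T f) :
    ContinuousOn (fun q : ℝ × ℝ => f q.1 q.2) (Icc 0 T ×ˢ univ) := ContDiffOn.continuousOn hf

theorem slice (hf : SmoothStrip T f) {t : ℝ} (ht : t ∈ Icc 0 T) : ContDiff ℝ ∞ (f t) := by
  rw [← contDiffOn_univ]
  exact ContDiffOn.comp (f := fun x : ℝ => (t, x)) hf
    (contDiff_const.prodMk contDiff_id).contDiffOn fun x _ => ⟨ht, mem_univ _⟩

theorem hasDerivAt_dX (hf : SmoothStrip T f) {t : ℝ} (ht : t ∈ Icc 0 T) (x : ℝ) :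
    HasDerivAt (f t) (dX f t x) x :=
  ((hf.slice ht).differentiable (by simp) x).hasDerivAt

theorem contDiffAt (hf : SmoothStrip T f) {t : ℝ} (ht : t ∈ Ioo 0 T) (x : ℝ) :
    ContDiffAt ℝ ∞ (fun q : ℝ × ℝ => f q.1 q.2) (t, x) :=
  ContDiffOn.contDiffAt hf (prod_mem_nhds (Icc_mem_nhds ht.1 ht.2) Filter.univ_mem)

theorem hasFDerivAt (hf : SmoothStrip T f) {t : ℝ} (ht : t ∈ Ioo 0 T) (x : ℝ) :
    HasFDerivAt (fun q : ℝ × ℝ => f q.1 q.2)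
      (fderiv ℝ (fun q : ℝ × ℝ => f q.1 q.2) (t, x)) (t, x) :=
  ((hf.contDiffAt ht x).differentiableAt (by simp)).hasFDerivAt

theorem hasDerivAt_time (hf : SmoothStrip T f) {t : ℝ} (ht : t ∈ Ioo 0 T) (x : ℝ) :
    HasDerivAt (fun s => f s x) (fderiv ℝ (fun q : ℝ × ℝ => f q.1 q.2) (t, x) (1, 0)) t :=
  (hf.hasFDerivAt ht x).comp_hasDerivAt (f := fun s : ℝ => (s, x)) t
    ((hasDerivAt_id t).prodMk (hasDerivAt_const t x))

theorem hasDerivAt_space (hf : SmoothStrip T f) {t : ℝ} (ht : t ∈ Ioo 0 T) (x : ℝ) :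
    HasDerivAt (f t) (fderiv ℝ (fun q : ℝ × ℝ => f q.1 q.2) (t, x) (0, 1)) x :=
  (hf.hasFDerivAt ht x).comp_hasDerivAt (f := fun y : ℝ => (t, y)) x
    ((hasDerivAt_const x t).prodMk (hasDerivAt_id x))

theorem hasDerivAt_dT (hf : SmoothStrip T f) {t : ℝ} (ht : t ∈ Ioo 0 T) (x : ℝ) :
    HasDerivAt (fun s => f s x) (dT f t x) t :=
  (hf.hasDerivAt_time ht x).differentiableAt.hasDerivAt

/-- The chain rule along a curve. -/
theorem hasDerivAt_curve (hf : SmoothStrip T f) {t : ℝ} (ht : t ∈ Ioo 0 T) {X : ℝ → ℝ} {X' : ℝ}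
    (hX : HasDerivAt X X' t) :
    HasDerivAt (fun s => f s (X s)) (dT f t (X t) + X' * dX f t (X t)) t := by
  have h := (hf.hasFDerivAt ht (X t)).comp_hasDerivAt (f := fun s : ℝ => (s, X s)) t
    ((hasDerivAt_id t).prodMk hX)
  refine h.congr_deriv ?_
  have e : ((1 : ℝ), X') = (1, 0) + X' • ((0 : ℝ), (1 : ℝ)) := by simp
  rw [e, map_add, map_smul, ← (hf.hasDerivAt_time ht (X t)).deriv,
    ← (hf.hasDerivAt_space ht (X t)).deriv]
  rfl

theorem uniqueDiffOn (hT : 0 < T) : UniqueDiffOn ℝ (Icc (0 : ℝ) T ×ˢ (univ : Set ℝ)) :=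
  (uniqueDiffOn_Icc hT).prod uniqueDiffOn_univ

/-- Each line of constant time lies inside the strip, even at `t = 0` and `t = T`. There the
ordinary space derivative is the value of the derivative within the strip on `(0, 1)`, which is
smooth up to the boundary. -/
theorem dX (hT : 0 < T) (hf : SmoothStrip T f) : SmoothStrip T (dX f) := by
  have h := ContDiffOn.fderivWithin (m := ∞) hf (uniqueDiffOn hT) (by simp)
  have h2 : ContDiffOn ℝ ∞ (fun q : ℝ × ℝ => fderivWithin ℝ (fun q : ℝ × ℝ => f q.1 q.2)
      (Icc 0 T ×ˢ univ) q (0, 1)) (Icc 0 T ×ˢ univ) := h.clm_apply contDiffOn_const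
  refine h2.congr fun q hq => ?_
  have hd := (ContDiffOn.differentiableOn hf (by simp) q hq).hasFDerivWithinAt
  have := hd.comp_hasDerivWithinAt (f := fun y : ℝ => (q.1, y)) (s := univ) q.2
    ((hasDerivAt_const q.2 q.1).prodMk (hasDerivAt_id q.2)).hasDerivWithinAt
    (fun y _ => ⟨hq.1, mem_univ _⟩)
  exact (hasDerivWithinAt_univ.1 this).deriv

theorem dX_iterate (hT : 0 < T) (hf : SmoothStrip T f) (k : ℕ) : SmoothStrip T (HypWave.dX^[k] f) := by
  induction k with
  | zero => exact hf
  | succ k ih =>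
    rw [Function.iterate_succ_apply']
    exact ih.dX hT

/-- Symmetry of the second derivative. Restricted to interior times, since `dT` is a two-sided
derivative. -/
theorem dX_dT_comm (hf : SmoothStrip T f) {t : ℝ} (ht : t ∈ Ioo 0 T) (x : ℝ) :
    HasDerivAt (fun y => HypWave.dT f t y) (HypWave.dT (HypWave.dX f) t x) x := by
  set F : ℝ × ℝ → ℝ := fun q => f q.1 q.2 with hF
  have hc := hf.contDiffAt ht x
  have hd : HasFDerivAt (fderiv ℝ F) (fderiv ℝ (fderiv ℝ F) (t, x)) (t, x) :=
    ((hc.fderiv_right (m := ∞) (by simp)).differentiableAt (by simp)).hasFDerivAt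
  have hsymm := hc.isSymmSndFDerivAt
    (by simpa using WithTop.coe_le_coe.2 (le_top (a := (2 : ℕ∞))))
  have h1 : HasDerivAt (fun y => HypWave.dT f t y) (fderiv ℝ (fderiv ℝ F) (t, x) (0, 1) (1, 0)) x := by
    have e : (fun y => HypWave.dT f t y) = fun y => fderiv ℝ F (t, y) (1, 0) := by
      ext y; exact (hf.hasDerivAt_time ht y).deriv
    rw [e]
    exact (hd.comp_hasDerivAt (f := fun y : ℝ => (t, y)) x
      ((hasDerivAt_const x t).prodMk (hasDerivAt_id x))).clm_apply (hasDerivAt_const x _) |>.congr_deriv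
        (by simp)
  have h2 : HasDerivAt (fun s => HypWave.dX f s x) (fderiv ℝ (fderiv ℝ F) (t, x) (1, 0) (0, 1)) t := by
    have e : (fun s => HypWave.dX f s x) =ᶠ[nhds t] fun s => fderiv ℝ F (s, x) (0, 1) := by
      filter_upwards [Ioo_mem_nhds ht.1 ht.2] with s hs
      exact (hf.hasDerivAt_space hs x).deriv
    refine HasDerivAt.congr_of_eventuallyEq ?_ e
    exact (hd.comp_hasDerivAt (f := fun s : ℝ => (s, x)) t
      ((hasDerivAt_id t).prodMk (hasDerivAt_const t x))).clm_apply (hasDerivAt_const t _) |>.congr_deriv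
        (by simp)
  have h3 : HypWave.dT (HypWave.dX f) t x = fderiv ℝ (fderiv ℝ F) (t, x) (0, 1) (1, 0) := by
    rw [hsymm]; exact h2.deriv
  rw [h3]; exact h1

/-- The divergence theorem on `[0, t] × [-R, R]`. -/
theorem integral_divergence (hT : 0 < T) (hf : SmoothStrip T f) (hg : SmoothStrip T g)
    {t R : ℝ} (ht : t ∈ Icc 0 T) (hR : 0 ≤ R) {h : ℝ × ℝ → ℝ}
    (hcont : ContinuousOn h (Icc 0 t ×ˢ Icc (-R) R))
    (hle : ∀ s ∈ Ioo 0 t, ∀ x, HypWave.dT f s x + HypWave.dX g s x ≤ h (s, x)) :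
    ((∫ s in (0 : ℝ)..t, g s R) - ∫ s in (0 : ℝ)..t, g s (-R)) + (∫ x in -R..R, f t x)
      - (∫ x in -R..R, f 0 x) ≤ ∫ q in Icc 0 t ×ˢ Icc (-R) R, h q := by
  set S : Set (ℝ × ℝ) := Icc 0 T ×ˢ univ
  set F : ℝ × ℝ → ℝ := fun q => f q.1 q.2
  set G : ℝ × ℝ → ℝ := fun q => g q.1 q.2
  have hK : Icc ((0 : ℝ), -R) (t, R) = Icc 0 t ×ˢ Icc (-R) R := (Icc_prod_Icc _ _ _ _).symm
  have hsub : Icc 0 t ×ˢ Icc (-R) R ⊆ S := fun q hq =>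
    ⟨⟨hq.1.1, hq.1.2.trans ht.2⟩, mem_univ _⟩
  have hint : ∀ s ∈ Ioo 0 t, s ∈ Ioo 0 T := fun s hs => ⟨hs.1, hs.2.trans_le ht.2⟩
  have hwithin : ∀ s ∈ Ioo 0 t, ∀ x, S ∈ nhds (s, x) := fun s hs x =>
    prod_mem_nhds (Icc_mem_nhds hs.1 (hint s hs).2) Filter.univ_mem
  have cF := (ContDiffOn.fderivWithin (m := ∞) hf (uniqueDiffOn hT) (by simp)).continuousOn
  have cG := (ContDiffOn.fderivWithin (m := ∞) hg (uniqueDiffOn hT) (by simp)).continuousOn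
  have cD : ContinuousOn (fun q => fderivWithin ℝ F S q (1, 0) + fderivWithin ℝ G S q (0, 1))
      (Icc 0 t ×ˢ Icc (-R) R) :=
    ((cF.mono hsub).clm_apply continuousOn_const).add
      ((cG.mono hsub).clm_apply continuousOn_const)
  have hcomp : IsCompact (Icc 0 t ×ˢ Icc (-R) R) := isCompact_Icc.prod isCompact_Icc
  have key := integral_divergence_prod_Icc_of_hasFDerivAt_of_le F G (fderivWithin ℝ F S)
    (fderivWithin ℝ G S) (0, -R) (t, R) ⟨ht.1, by simp; linarith⟩
    (by rw [hK]; exact hf.continuousOn.mono hsub) (by rw [hK]; exact hg.continuousOn.mono hsub)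
    (fun q hq => by
      rw [fderivWithin_of_mem_nhds (hwithin q.1 hq.1 q.2)]
      exact hf.hasFDerivAt (hint _ hq.1) q.2)
    (fun q hq => by
      rw [fderivWithin_of_mem_nhds (hwithin q.1 hq.1 q.2)]
      exact hg.hasFDerivAt (hint _ hq.1) q.2)
    (by rw [hK]; exact cD.integrableOn_compact hcomp)
  rw [hK] at key
  refine key.symm.le.trans ?_
  -- The differential inequality is known only for interior times; the two end times form a null
  -- set.
  refine setIntegral_mono_ae_restrict (cD.integrableOn_compact hcomp)
    (hcont.integrableOn_compact hcomp) ?_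
  have hae : (Icc 0 t ×ˢ Icc (-R) R : Set (ℝ × ℝ)) =ᵐ[volume] (Ioo 0 t ×ˢ Icc (-R) R : Set (ℝ × ℝ)) :=
    Measure.set_prod_ae_eq Ioo_ae_eq_Icc.symm (Filter.EventuallyEq.refl _ _)
  rw [Measure.restrict_congr_set hae]
  filter_upwards [ae_restrict_mem (measurableSet_Ioo.prod measurableSet_Icc)] with q hq
  rw [fderivWithin_of_mem_nhds (hwithin q.1 hq.1 q.2),
    fderivWithin_of_mem_nhds (hwithin q.1 hq.1 q.2)]
  have h1 := (hf.hasDerivAt_time (hint _ hq.1) q.2).deriv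
  have h2 := (hg.hasDerivAt_space (hint _ hq.1) q.2).deriv
  have := hle q.1 hq.1 q.2
  simp only [HypWave.dT, HypWave.dX] at this
  rw [h1, h2] at this
  exact this

end SmoothStrip

/-! ### The hyperbolic tangent profile -/

theorem hasDerivAt_tanh (y : ℝ) : HasDerivAt Real.tanh (1 - Real.tanh y ^ 2) y := by
  have h := (Real.hasDerivAt_sinh y).div (Real.hasDerivAt_cosh y) (Real.cosh_pos y).ne'
  have e : Real.tanh = fun y => Real.sinh y / Real.cosh y :=
    funext Real.tanh_eq_sinh_div_cosh
  rw [e]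
  refine h.congr_deriv ?_
  have := (Real.cosh_pos y).ne'
  field_simp

theorem contDiff_tanh : ContDiff ℝ ∞ Real.tanh := by
  have e : Real.tanh = fun y => Real.sinh y / Real.cosh y :=
    funext Real.tanh_eq_sinh_div_cosh
  rw [e]
  exact Real.contDiff_sinh.div Real.contDiff_cosh fun y => (Real.cosh_pos y).ne'

/-- The profile `A + B tanh (y / δ)`. -/
def profile (A B δ y : ℝ) : ℝ := A + B * Real.tanh (y / δ)

/-- The derivative of the profile `A + B tanh (y / δ)`. -/
def slope (B δ y : ℝ) : ℝ := B / δ * (1 - Real.tanh (y / δ) ^ 2)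

theorem hasDerivAt_profile (A B δ y : ℝ) :
    HasDerivAt (profile A B δ) (slope B δ y) y := by
  have h := (((hasDerivAt_tanh (y / δ)).comp y ((hasDerivAt_id y).div_const δ)).const_mul B).const_add A
  refine h.congr_deriv ?_
  simp only [slope]; ring

theorem contDiff_tanh_div (δ : ℝ) : ContDiff ℝ ∞ fun y => Real.tanh (y / δ) :=
  contDiff_tanh.comp (contDiff_id.div_const δ)

theorem contDiff_profile (A B δ : ℝ) : ContDiff ℝ ∞ (profile A B δ) :=
  contDiff_const.add (contDiff_const.mul (contDiff_tanh_div δ))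

theorem contDiff_slope (B δ : ℝ) : ContDiff ℝ ∞ (slope B δ) :=
  contDiff_const.mul (contDiff_const.sub ((contDiff_tanh_div δ).pow 2))

theorem slope_nonneg {B δ : ℝ} (hB : 0 ≤ B) (hδ : 0 < δ) (y : ℝ) : 0 ≤ slope B δ y :=
  mul_nonneg (by positivity) (sub_nonneg.2 (Real.tanh_sq_lt_one _).le)

theorem profile_mem_Icc {A B : ℝ} (hB : 0 ≤ B) (δ y : ℝ) :
    profile A B δ y ∈ Icc (A - B) (A + B) := by
  have h1 := Real.tanh_lt_one (y / δ)
  have h2 := Real.neg_one_lt_tanh (y / δ)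
  constructor <;> simp only [profile] <;> nlinarith

/-! ### The Burgers equation -/

/-- `W` solves the Burgers equation on `[0, T] × ℝ` and is obtained by transporting
`A + B tanh (y / δ)` from time `-τ₀` along the characteristics `x = y + (τ₀ + t) W`. -/
structure IsWave (T τ₀ A B δ : ℝ) (W : ℝ → ℝ → ℝ) : Prop where
  smooth : SmoothStrip T W
  equation : ∀ t ∈ Ioo 0 T, ∀ x, dT W t x + W t x * dX W t x = 0
  trace : ∀ t ∈ Icc 0 T, ∀ x, profile A B δ (x - (τ₀ + t) * W t x) = W t x
  slope_eq : ∀ t ∈ Icc 0 T, ∀ x, dX W t x * (1 + (τ₀ + t) * slope B δ (x - (τ₀ + t) * W t x))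
    = slope B δ (x - (τ₀ + t) * W t x)

namespace IsBurgersWave

variable {wm wp δ : ℝ} {w : ℝ → ℝ → ℝ}

theorem smoothStrip (hw : IsBurgersWave wm wp δ w) (T : ℝ) : SmoothStrip T w :=
  hw.smooth.mono (prod_mono Icc_subset_Ici_self subset_rfl)

/-- Solutions of the Burgers equation are constant along characteristics. -/
theorem const_on_char (hw : IsBurgersWave wm wp δ w) {t : ℝ} (ht : 0 ≤ t) (y : ℝ) :
    w t (y + t * w 0 y) = w 0 y := by
  rcases ht.eq_or_lt with rfl | ht
  · simp
  set c := w 0 y with hc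
  have hs := hw.smoothStrip t
  have hline : ContinuousOn (fun s : ℝ => (s, y + s * c)) (Icc 0 t) :=
    Continuous.continuousOn (by fun_prop)
  have hmaps : MapsTo (fun s : ℝ => (s, y + s * c)) (Icc 0 t) (Icc 0 t ×ˢ univ) :=
    fun s hs => ⟨hs, mem_univ _⟩
  obtain ⟨K, hK⟩ := isCompact_Icc.exists_bound_of_continuousOn
    ((hs.dX ht).continuousOn.comp hline hmaps)
  -- A Grönwall argument: along the straight line of speed `c`, `w - c` has derivative `-(w - c)
  -- w_x`. With `K` a bound for `|w_x|` on the segment, the factor `exp (-2 K s)` makes the square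
  -- nonincreasing.
  set g : ℝ → ℝ := fun s => (w s (y + s * c) - c) ^ 2 * Real.exp (-(2 * K) * s) with hg
  have hd : ∀ s ∈ Ioo 0 t, HasDerivAt g (-2 * (w s (y + s * c) - c) ^ 2
      * (dX w s (y + s * c) + K) * Real.exp (-(2 * K) * s)) s := by
    intro s hs'
    have h1 := hs.hasDerivAt_curve hs' (((hasDerivAt_id s).mul_const c).const_add y)
    have h2 := (((h1.sub_const c).fun_pow 2).fun_mul
      ((hasDerivAt_id s).const_mul (-(2 * K))).exp)
    refine h2.congr_deriv ?_
    have := hw.equation s hs'.1 (y + s * c)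
    have e : dT w s (y + s * c) = -(w s (y + s * c) * dX w s (y + s * c)) := by
      simp only [dT, dX]; linarith
    simp only [id, e]
    ring
  have hanti : AntitoneOn g (Icc 0 t) := by
    refine antitoneOn_of_deriv_nonpos (convex_Icc _ _) ?_ ?_ ?_
    · refine ContinuousOn.mul ?_ (Continuous.continuousOn (by fun_prop))
      exact ((hs.continuousOn.comp hline hmaps).sub continuousOn_const).pow 2
    · rw [interior_Icc]
      exact fun s hs => (hd s hs).differentiableAt.differentiableWithinAt
    · rw [interior_Icc]
      intro s hs
      rw [(hd s hs).deriv]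
      have := abs_le.1 (hK s (Ioo_subset_Icc_self hs))
      have h0 : 0 ≤ dX w s (y + s * c) + K := by
        have := this.1
        simp only [Function.comp] at this
        linarith
      have := mul_nonneg (mul_nonneg (sq_nonneg (w s (y + s * c) - c)) h0)
        (Real.exp_pos (-(2 * K) * s)).le
      linarith
  have h := hanti (left_mem_Icc.2 ht.le) (right_mem_Icc.2 ht.le) ht.le
  have h0 : g 0 = 0 := by simp [hg, hc]
  rw [h0] at h
  have h3 : (w t (y + t * c) - c) ^ 2 ≤ 0 := by
    by_contra! hpos
    exact absurd h (not_le.2 (mul_pos hpos (Real.exp_pos _)))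
  have := pow_eq_zero_iff (two_ne_zero) |>.1 (le_antisymm h3 (sq_nonneg _))
  linarith

theorem initial_eq_profile (hw : IsBurgersWave wm wp δ w) :
    w 0 = profile ((wp + wm) / 2) ((wp - wm) / 2) δ := funext hw.initial

/-- The straight characteristics issued from the initial line fill the strip, so `w` is determined
by its datum. Differentiating `w(t, y + t w₀(y)) = w₀(y)` in `y` yields the formula for the slope.
-/
theorem isWave (hw : IsBurgersWave wm wp δ w) (hB : wm < wp) {t₀ : ℝ}
    (ht₀ : 0 ≤ t₀) (T : ℝ) :
    IsWave T t₀ ((wp + wm) / 2) ((wp - wm) / 2) δ (fun t x => w (t₀ + t) x) := by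
  set A := (wp + wm) / 2
  set B := (wp - wm) / 2 with hBdef
  have hB0 : 0 ≤ B := by simp only [hBdef]; linarith
  have key : ∀ t, 0 ≤ t → ∀ x, ∃ y, w t x = profile A B δ y ∧ x - t * w t x = y ∧
      deriv (w t) x * (1 + t * slope B δ y) = slope B δ y := by
    intro t ht x
    -- The profile is bounded, so the characteristic map differs from the identity by a bounded
    -- amount.
    have hsurj : Function.Surjective fun y => y + t * profile A B δ y := by
      refine Continuous.surjective ?_ ?_ ?_
      · exact continuous_id.add (continuous_const.mul (contDiff_profile A B δ).continuous)
      · refine Filter.tendsto_atTop_add_right_of_le _ (t * (A - B)) Filter.tendsto_id fun y => ?_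
        exact mul_le_mul_of_nonneg_left (profile_mem_Icc hB0 δ y).1 ht
      · refine Filter.tendsto_atBot_add_right_of_ge _ (t * (A + B)) Filter.tendsto_id fun y => ?_
        exact mul_le_mul_of_nonneg_left (profile_mem_Icc hB0 δ y).2 ht
    obtain ⟨y, rfl⟩ := hsurj x
    have hchar : ∀ y, w t (y + t * profile A B δ y) = profile A B δ y := by
      intro y
      have := hw.const_on_char ht y
      rwa [hw.initial_eq_profile] at this
    refine ⟨y, hchar y, ?_, ?_⟩
    · simp only [hchar y]; ring
    · have hX : HasDerivAt (fun y => y + t * profile A B δ y) (1 + t * slope B δ y) y :=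
        (hasDerivAt_id y).add ((hasDerivAt_profile A B δ y).const_mul t)
      have h1 := ((hw.smoothStrip t).hasDerivAt_dX ⟨ht, le_rfl⟩ (y + t * profile A B δ y)).comp y hX
      have h2 : HasDerivAt (fun y => w t (y + t * profile A B δ y)) (slope B δ y) y := by
        simp only [hchar]; exact hasDerivAt_profile A B δ y
      exact h1.unique h2
  refine ⟨?_, ?_, ?_, ?_⟩
  · refine ContDiffOn.comp (g := fun q : ℝ × ℝ => w q.1 q.2) (f := fun q : ℝ × ℝ => (t₀ + q.1, q.2))
      hw.smooth (ContDiff.contDiffOn (by fun_prop)) fun q hq => ⟨?_, mem_univ _⟩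
    exact add_nonneg ht₀ hq.1.1
  · intro t ht x
    have := hw.equation (t₀ + t) (by linarith [ht.1]) x
    simp only [dT, dX]
    rw [deriv_comp_const_add (fun s => w s x) t₀ t]
    exact this
  · intro t ht x
    obtain ⟨y, h1, h2, h3⟩ := key (t₀ + t) (add_nonneg ht₀ ht.1) x
    simp only [h2]
    exact h1.symm
  · intro t ht x
    obtain ⟨y, h1, h2, h3⟩ := key (t₀ + t) (add_nonneg ht₀ ht.1) x
    simp only [h2]
    exact h3

end IsBurgersWave

/-- The relations between the profile variables `θ = tanh`, the inverse Jacobian `r` of the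
characteristic map and the slope `q` of a Burgers wave at a fixed time. -/
structure ProfileRel (δ : ℝ) (θ r q : ℝ → ℝ) : Prop where
  theta_mem : ∀ x, θ x ∈ Icc (-1) 1
  r_mem : ∀ x, r x ∈ Icc 0 1
  theta_deriv : ∀ x, HasDerivAt θ (δ⁻¹ * ((1 - θ x ^ 2) * r x)) x
  r_deriv : ∀ x, HasDerivAt r (δ⁻¹ * (2 * θ x * (1 - r x) * r x ^ 2)) x
  q_deriv : ∀ x, HasDerivAt q (δ⁻¹ * (-2 * θ x * r x ^ 2) * q x) x

/-- The relations form an autonomous system whose only parameter is an overall factor `δ⁻¹`. So each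
derivative costs exactly one `δ⁻¹`, and `P` depends on `j` alone, not on `δ` or the time. -/
theorem ProfileRel.exists_iteratedDeriv (j : ℕ) : ∃ P : ℝ × ℝ → ℝ, ContDiff ℝ ∞ P ∧
    ∀ δ θ r q, ProfileRel δ θ r q →
      iteratedDeriv j q = fun x => δ⁻¹ ^ j * P (θ x, r x) * q x := by
  induction j with
  | zero => exact ⟨fun _ => 1, contDiff_const, fun δ θ r q _ => by simp⟩
  | succ j ih =>
    obtain ⟨P, hP, h⟩ := ih
    -- Derivative of `P` along the vector field of `(θ, r)`, plus the factor contributed by `q'`.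
    refine ⟨fun z => fderiv ℝ P z ((1 - z.1 ^ 2) * z.2, 2 * z.1 * (1 - z.2) * z.2 ^ 2)
      - 2 * z.1 * z.2 ^ 2 * P z, ?_, fun δ θ r q hrel => ?_⟩
    · refine ContDiff.sub ?_ ?_
      · exact (hP.fderiv_right (m := ∞) (by simp)).clm_apply (by fun_prop)
      · exact ContDiff.mul (by fun_prop) hP
    · rw [iteratedDeriv_succ, h δ θ r q hrel]
      ext x
      have hz : HasDerivAt (fun x => (θ x, r x)) (δ⁻¹ * ((1 - θ x ^ 2) * r x),
          δ⁻¹ * (2 * θ x * (1 - r x) * r x ^ 2)) x :=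
        (hrel.theta_deriv x).prodMk (hrel.r_deriv x)
      have hPd := (hP.differentiable (by simp) (θ x, r x)).hasFDerivAt.comp_hasDerivAt x hz
      have hd := (hPd.const_mul (δ⁻¹ ^ j)).mul (hrel.q_deriv x)
      refine hd.deriv.trans ?_
      have e : (δ⁻¹ * ((1 - θ x ^ 2) * r x), δ⁻¹ * (2 * θ x * (1 - r x) * r x ^ 2))
          = δ⁻¹ • ((1 - θ x ^ 2) * r x, 2 * θ x * (1 - r x) * r x ^ 2) := by simp
      rw [e, map_smul, smul_eq_mul]
      simp only [Function.comp]
      ring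

/-- `(θ, r)` stays in the compact rectangle `[-1, 1] × [0, 1]`, where each `P` is bounded. The
factor `|q|` is kept on the right because the energy estimate needs every source to be dominated by
`q`. -/
theorem ProfileRel.exists_bound (n : ℕ) : ∃ C : ℝ, 0 < C ∧ ∀ j ≤ n, ∀ δ θ r q, 0 < δ →
    ProfileRel δ θ r q → ∀ x, |iteratedDeriv j q x| ≤ C * δ⁻¹ ^ j * |q x| := by
  have hone : ∀ j : ℕ, ∃ C : ℝ, 0 < C ∧ ∀ δ θ r q, 0 < δ →
      ProfileRel δ θ r q → ∀ x, |iteratedDeriv j q x| ≤ C * δ⁻¹ ^ j * |q x| := by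
    intro j
    obtain ⟨P, hP, h⟩ := ProfileRel.exists_iteratedDeriv j
    obtain ⟨C, hC⟩ := (isCompact_Icc.prod isCompact_Icc :
      IsCompact (Icc (-1 : ℝ) 1 ×ˢ Icc (0 : ℝ) 1)).exists_bound_of_continuousOn
        hP.continuous.continuousOn
    refine ⟨max C 1, by positivity, fun δ θ r q hδ hrel x => ?_⟩
    rw [h δ θ r q hrel]
    have h1 := (hC (θ x, r x) ⟨hrel.theta_mem x, hrel.r_mem x⟩).trans (le_max_left C 1)
    rw [Real.norm_eq_abs] at h1
    rw [abs_mul, abs_mul, abs_of_pos (by positivity : 0 < δ⁻¹ ^ j)]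
    have : δ⁻¹ ^ j * |P (θ x, r x)| ≤ max C 1 * δ⁻¹ ^ j := by
      rw [mul_comm]
      gcongr
    gcongr
  choose C hC0 hC using hone
  refine ⟨∑ j ∈ Finset.range (n + 1), C j, ?_, fun j hj δ θ r q hδ hrel x => ?_⟩
  · exact Finset.sum_pos (fun j _ => hC0 j) ⟨0, by simp⟩
  · refine (hC j δ θ r q hδ hrel x).trans ?_
    have : C j ≤ ∑ j ∈ Finset.range (n + 1), C j :=
      Finset.single_le_sum (f := C) (fun j _ => (hC0 j).le) (Finset.mem_range.2 (by omega))
    gcongr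

namespace IsWave

variable {T τ₀ A B δ : ℝ} {W : ℝ → ℝ → ℝ}

theorem mem_Icc (hW : IsWave T τ₀ A B δ W) (hB : 0 ≤ B) {t : ℝ} (ht : t ∈ Icc 0 T) (x : ℝ) :
    W t x ∈ Icc (A - B) (A + B) := by
  rw [← hW.trace t ht x]
  exact profile_mem_Icc hB δ _

/-- With `s` the initial slope at the foot of the characteristic, `r = 1 - τ W_x = 1 / (1 + τ s)`
lies in `[0, 1]` and `W_x = (B / δ) (1 - θ²) r`. The time `τ` enters only through `τ q = 1 - r`, so
it disappears from the relations. -/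
theorem profileRel (hW : IsWave T τ₀ A B δ W) (hB : 0 < B) (hδ : 0 < δ) (hτ : 0 ≤ τ₀)
    (hT : 0 < T) {t : ℝ} (ht : t ∈ Icc 0 T) :
    ProfileRel δ (fun x => (W t x - A) / B) (fun x => 1 - (τ₀ + t) * dX W t x) (dX W t) ∧
      ∀ x, dX W t x = B / δ * (1 - ((W t x - A) / B) ^ 2) * (1 - (τ₀ + t) * dX W t x) := by
  set τ := τ₀ + t with hτdef
  have hτ0 : 0 ≤ τ := add_nonneg hτ ht.1
  have hθ : ∀ x, (W t x - A) / B = Real.tanh ((x - τ * W t x) / δ) := by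
    intro x
    have := hW.trace t ht x
    rw [← hτdef] at this
    rw [div_eq_iff hB.ne', ← eq_sub_iff_add_eq'.2 this]
    ring
  have hJ : ∀ x, 0 < 1 + τ * slope B δ (x - τ * W t x) := fun x =>
    add_pos_of_pos_of_nonneg one_pos (mul_nonneg hτ0 (slope_nonneg hB.le hδ _))
  have hr : ∀ x, (1 - τ * dX W t x) * (1 + τ * slope B δ (x - τ * W t x)) = 1 := by
    intro x
    have := hW.slope_eq t ht x
    rw [← hτdef] at this
    linear_combination -τ * this
  have hq : ∀ x, dX W t x = B / δ * (1 - ((W t x - A) / B) ^ 2) * (1 - τ * dX W t x) := by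
    intro x
    have h1 := hW.slope_eq t ht x
    rw [← hτdef] at h1
    have h2 := hr x
    have h3 : B / δ * (1 - ((W t x - A) / B) ^ 2) = slope B δ (x - τ * W t x) := by
      rw [hθ]; rfl
    rw [h3]
    linear_combination h1
  have hrmem : ∀ x, 1 - τ * dX W t x ∈ Icc (0 : ℝ) 1 := by
    intro x
    have e : 1 - τ * dX W t x = 1 / (1 + τ * slope B δ (x - τ * W t x)) :=
      eq_div_of_mul_eq (hJ x).ne' (hr x)
    rw [e]
    refine ⟨(one_div_pos.2 (hJ x)).le, (div_le_one (hJ x)).2 ?_⟩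
    linarith [mul_nonneg hτ0 (slope_nonneg hB.le hδ (x - τ * W t x))]
  have hWd := fun x => hW.smooth.hasDerivAt_dX ht x
  have hqd := fun x => (hW.smooth.dX hT).hasDerivAt_dX ht x
  have hθd : ∀ x, HasDerivAt (fun x => (W t x - A) / B)
      (δ⁻¹ * ((1 - ((W t x - A) / B) ^ 2) * (1 - τ * dX W t x))) x := by
    intro x
    refine (((hWd x).sub_const A).div_const B).congr_deriv ?_
    rw [div_eq_iff hB.ne']
    refine (hq x).trans ?_
    ring
  have hqx : ∀ x, dX (dX W) t x = δ⁻¹ * (-2 * ((W t x - A) / B) * (1 - τ * dX W t x) ^ 2)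
      * dX W t x := by
    intro x
    -- Differentiating `q = (B / δ) (1 - θ²) (1 - τ q)` leaves `q'` on both sides; the coefficient
    -- after collecting is `1 + τ s = 1 / r`, which is why multiplying by `r` solves for it.
    have h1 : HasDerivAt (dX W t) (B / δ * (-(2 * ((W t x - A) / B) * (δ⁻¹ * ((1 - ((W t x - A) / B) ^ 2)
        * (1 - τ * dX W t x))))) * (1 - τ * dX W t x)
        + B / δ * (1 - ((W t x - A) / B) ^ 2) * (-(τ * dX (dX W) t x))) x := by
      have h := ((((hθd x).fun_pow 2).const_sub 1).const_mul (B / δ)).fun_mul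
        (((hqd x).const_mul τ).const_sub 1)
      refine (h.congr_of_eventuallyEq (Filter.Eventually.of_forall hq)).congr_deriv ?_
      simp
    have h2 := (hqd x).unique h1
    have h3 := hr x
    have h4 : slope B δ (x - τ * W t x) = B / δ * (1 - ((W t x - A) / B) ^ 2) := by
      rw [hθ]; rfl
    rw [h4] at h3
    have h5 := hq x
    generalize (W t x - A) / B = θ at *
    generalize hrr : 1 - τ * dX W t x = r at *
    generalize dX (dX W) t x = q1 at *
    generalize dX W t x = q at *
    rw [div_eq_mul_inv] at *
    generalize δ⁻¹ = D at *
    linear_combination r * h2 - q1 * h3 + D * 2 * θ * r ^ 2 * h5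
  refine ⟨⟨fun x => ?_, hrmem, hθd, fun x => ?_, fun x => ?_⟩, hq⟩
  · simp only [hθ]
    exact ⟨(Real.neg_one_lt_tanh _).le, (Real.tanh_lt_one _).le⟩
  · refine (((hqd x).const_mul τ).const_sub 1).congr_deriv ?_
    rw [hqx]
    ring
  · exact (hqd x).congr_deriv (hqx x)

theorem dX_nonneg (hW : IsWave T τ₀ A B δ W) (hB : 0 < B) (hδ : 0 < δ) (hτ : 0 ≤ τ₀)
    (hT : 0 < T) {t : ℝ} (ht : t ∈ Icc 0 T) (x : ℝ) : 0 ≤ dX W t x := by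
  obtain ⟨h, hq⟩ := hW.profileRel hB hδ hτ hT ht
  rw [hq x]
  have := abs_le_one_iff_mul_self_le_one.1 (abs_le.2 (h.theta_mem x))
  refine mul_nonneg (mul_nonneg (by positivity) ?_) (h.r_mem x).1
  linarith [sq ((W t x - A) / B)]

theorem dX_le (hW : IsWave T τ₀ A B δ W) (hB : 0 < B) (hδ : 0 < δ) (hτ : 0 ≤ τ₀)
    (hT : 0 < T) {t : ℝ} (ht : t ∈ Icc 0 T) (x : ℝ) : dX W t x ≤ B * δ⁻¹ := by
  obtain ⟨h, hq⟩ := hW.profileRel hB hδ hτ hT ht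
  rw [hq x, div_eq_mul_inv, mul_assoc]
  refine mul_le_of_le_one_right (by positivity) ?_
  have h1 := abs_le_one_iff_mul_self_le_one.1 (abs_le.2 (h.theta_mem x))
  refine mul_le_one₀ ?_ (h.r_mem x).1 (h.r_mem x).2
  linarith [sq_nonneg ((W t x - A) / B)]

theorem abs_dX_iterate_le {C : ℝ} {n : ℕ}
    (hC : ∀ j ≤ n, ∀ δ θ r q, 0 < δ → ProfileRel δ θ r q →
      ∀ x, |iteratedDeriv j q x| ≤ C * δ⁻¹ ^ j * |q x|)
    (hW : IsWave T τ₀ A B δ W) (hB : 0 < B) (hδ : 0 < δ) (hτ : 0 ≤ τ₀)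
    (hT : 0 < T) {t : ℝ} (ht : t ∈ Icc 0 T) {j : ℕ} (hj : j ≤ n) (x : ℝ) :
    |dX^[j] (dX W) t x| ≤ C * δ⁻¹ ^ j * dX W t x := by
  rw [dX_iterate]
  have := hC j hj δ _ _ _ hδ (hW.profileRel hB hδ hτ hT ht).1 x
  rwa [abs_of_nonneg (hW.dX_nonneg hB hδ hτ hT ht x)] at this

end IsWave

/-! ### The `γ`-law gas -/

theorem deriv_pressure {γ ρ : ℝ} (hγ : 1 ≤ γ) (hρ : 0 < ρ) :
    deriv (pressure γ) ρ = ρ ^ (γ - 1) := by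
  have h := (Real.hasDerivAt_rpow_const (x := ρ) (p := γ) (Or.inl hρ.ne')).div_const γ
  refine h.deriv.trans ?_
  field_simp

theorem soundSpeed_eq {γ ρ : ℝ} (hγ : 1 ≤ γ) (hρ : 0 < ρ) :
    soundSpeed γ ρ = ρ ^ ((γ - 1) / 2) := by
  rw [soundSpeed, deriv_pressure hγ hρ, Real.sqrt_eq_rpow, ← Real.rpow_mul hρ.le]
  ring_nf

theorem soundSpeed_pos {γ ρ : ℝ} (hγ : 1 ≤ γ) (hρ : 0 < ρ) : 0 < soundSpeed γ ρ := by
  rw [soundSpeed_eq hγ hρ]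
  positivity

theorem soundSpeed_sq {γ ρ : ℝ} (hγ : 1 ≤ γ) (hρ : 0 < ρ) :
    soundSpeed γ ρ ^ 2 = deriv (pressure γ) ρ := by
  rw [soundSpeed, Real.sq_sqrt]
  rw [deriv_pressure hγ hρ]
  positivity

/-- On a level set of the 2-Riemann invariant the sound speed is an affine function of the second
eigenvalue. -/
theorem soundSpeed_affine {γ ρ u : ℝ} (hγ : 1 ≤ γ) (hρ : 0 < ρ) :
    soundSpeed γ ρ = (γ - 1) / (γ + 1) * eig2 γ ρ u
      + (2 / (γ + 1) - (γ - 1) / (γ + 1) * riemann2 γ ρ u) := by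
  have hpos : γ + 1 ≠ 0 := by linarith
  -- For `γ = 1` the primitive is a logarithm, but the sound speed is `1` and the coefficient `γ -
  -- 1` vanishes.
  rcases hγ.eq_or_lt with rfl | hlt
  · rw [soundSpeed_eq le_rfl hρ]
    norm_num
  · have hint : ∫ s in (1 : ℝ)..ρ, soundSpeed γ s / s = 2 / (γ - 1) * (soundSpeed γ ρ - 1) := by
      have h1 : ∀ s ∈ uIcc 1 ρ, soundSpeed γ s / s = s ^ ((γ - 1) / 2 - 1) := by
        intro s hs
        have hs0 : 0 < s := (lt_min one_pos hρ).trans_le hs.1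
        rw [soundSpeed_eq hγ hs0, Real.rpow_sub_one hs0.ne']
      rw [intervalIntegral.integral_congr h1, integral_rpow (Or.inl (by linarith)),
        soundSpeed_eq hγ hρ]
      have : γ - 1 ≠ 0 := by linarith
      simp only [sub_add_cancel, Real.one_rpow]
      field_simp
    have : γ - 1 ≠ 0 := by linarith
    rw [riemann2, eig2, hint]
    field_simp
    ring

/-! ### Reduction to transport equations -/

/-- The smaller eigenvalue `W - 2 c` with `c = κ W + c₀`. -/
def eig1 (κ c₀ : ℝ) (W : ℝ → ℝ → ℝ) : ℝ → ℝ → ℝ := fun t x => W t x - 2 * (κ * W t x + c₀)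

/-- The linearised Euler system written in terms of its eigenvalues. -/
structure IsReducedWave (κ c₀ F T : ℝ) (W d₁ d₂ : ℝ → ℝ → ℝ) : Prop where
  smooth₁ : SmoothStrip T d₁
  smooth₂ : SmoothStrip T d₂
  mass : ∀ t ∈ Ioo 0 T, ∀ x, dT d₁ t x + dX d₂ t x = 0
  momentum : ∀ t ∈ Ioo 0 T, ∀ x, dT d₂ t x
    + dX (fun t x => -(eig1 κ c₀ W t x * W t x) * d₁ t x
      + (eig1 κ c₀ W t x + W t x) * d₂ t x) t x = F * dX (dX W) t x
  initial₁ : ∀ x, d₁ 0 x = 0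
  initial₂ : ∀ x, d₂ 0 x = 0

/-- The diagonal form of the linearised Euler system. -/
structure IsTransportPair (κ c₀ F T : ℝ) (W V₁ V₂ : ℝ → ℝ → ℝ) : Prop where
  smooth₁ : SmoothStrip T V₁
  smooth₂ : SmoothStrip T V₂
  first : ∀ t ∈ Ioo 0 T, ∀ x, dT V₁ t x + eig1 κ c₀ W t x * dX V₁ t x
    + 2 * (1 - κ) * dX W t x * V₁ t x = -F * dX (dX W) t x
  second : ∀ t ∈ Ioo 0 T, ∀ x, dT V₂ t x + W t x * dX V₂ t x
    + dX W t x * V₂ t x = F * dX (dX W) t x + (1 - 2 * κ) * dX W t x * V₁ t x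
  initial₁ : ∀ x, V₁ 0 x = 0
  initial₂ : ∀ x, V₂ 0 x = 0

theorem SmoothStrip.eig1 {T κ c₀ : ℝ} {W : ℝ → ℝ → ℝ} (hW : SmoothStrip T W) :
    SmoothStrip T (eig1 κ c₀ W) :=
  hW.sub ((const 2).mul (((const κ).mul hW).add (const c₀)))

section Diagonalisation

variable {κ c₀ F T τ₀ A B δ : ℝ} {W d₁ d₂ V₁ V₂ : ℝ → ℝ → ℝ}

theorem hasDerivAt_eig1_space (hW : SmoothStrip T W) {t : ℝ} (ht : t ∈ Icc 0 T) (x : ℝ) :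
    HasDerivAt (eig1 κ c₀ W t) ((1 - 2 * κ) * dX W t x) x := by
  have h := hW.hasDerivAt_dX ht x
  refine (h.sub (((h.const_mul κ).add_const c₀).const_mul 2)).congr_deriv ?_
  ring

theorem hasDerivAt_eig1_time (hW : SmoothStrip T W) {t : ℝ} (ht : t ∈ Ioo 0 T) (x : ℝ) :
    HasDerivAt (fun s => eig1 κ c₀ W s x) ((1 - 2 * κ) * dT W t x) t := by
  have h := hW.hasDerivAt_dT ht x
  refine (h.sub (((h.const_mul κ).add_const c₀).const_mul 2)).congr_deriv ?_
  ring

/-- Projection on the left eigenvectors. In the first equation the `d₁` and `d₂` terms of order zero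
combine into a multiple of `V₁` because `W_t = -W W_x`. In the second, the smaller eigenvalue is a
function of `W`, hence is also transported with speed `W`; only a `V₁` term remains. -/
theorem IsReducedWave.isTransportPair (hW : IsWave T τ₀ A B δ W)
    (hd : IsReducedWave κ c₀ F T W d₁ d₂) :
    IsTransportPair κ c₀ F T W (fun t x => W t x * d₁ t x - d₂ t x)
      (fun t x => d₂ t x - eig1 κ c₀ W t x * d₁ t x) := by
  have key : ∀ t ∈ Ioo 0 T, ∀ x, dT d₁ t x = -dX d₂ t x ∧
      dT d₂ t x = F * dX (dX W) t x
        + ((1 - 2 * κ) * dX W t x * W t x + eig1 κ c₀ W t x * dX W t x) * d₁ t x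
        + (eig1 κ c₀ W t x * W t x) * dX d₁ t x
        - ((1 - 2 * κ) * dX W t x + dX W t x) * d₂ t x
        - (eig1 κ c₀ W t x + W t x) * dX d₂ t x := by
    intro t ht x
    have ht' := Ioo_subset_Icc_self ht
    have hm := hd.mass t ht x
    have hp := hd.momentum t ht x
    have hl := hasDerivAt_eig1_space (κ := κ) (c₀ := c₀) hW.smooth ht' x
    have hw := hW.smooth.hasDerivAt_dX ht' x
    have e := (((hl.fun_mul hw).fun_neg.fun_mul (hd.smooth₁.hasDerivAt_dX ht' x)).fun_add
      ((hl.fun_add hw).fun_mul (hd.smooth₂.hasDerivAt_dX ht' x))).deriv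
    refine ⟨by linarith, ?_⟩
    rw [dX, e] at hp
    linarith
  refine ⟨(hW.smooth.mul hd.smooth₁).sub hd.smooth₂,
    hd.smooth₂.sub (hW.smooth.eig1.mul hd.smooth₁), fun t ht x => ?_, fun t ht x => ?_,
    fun x => by simp [hd.initial₁, hd.initial₂], fun x => by simp [hd.initial₁, hd.initial₂]⟩
  all_goals
    have ht' := Ioo_subset_Icc_self ht
    obtain ⟨k1, k2⟩ := key t ht x
    have kw := hW.equation t ht x
    have hlx := hasDerivAt_eig1_space (κ := κ) (c₀ := c₀) hW.smooth ht' x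
    have hlt := hasDerivAt_eig1_time (κ := κ) (c₀ := c₀) hW.smooth ht x
    have hwx := hW.smooth.hasDerivAt_dX ht' x
    have hwt := hW.smooth.hasDerivAt_dT ht x
    have h1x := hd.smooth₁.hasDerivAt_dX ht' x
    have h1t := hd.smooth₁.hasDerivAt_dT ht x
    have h2x := hd.smooth₂.hasDerivAt_dX ht' x
    have h2t := hd.smooth₂.hasDerivAt_dT ht x
  · have ex : dX (fun t x => W t x * d₁ t x - d₂ t x) t x = _ := ((hwx.fun_mul h1x).fun_sub h2x).deriv
    have et : dT (fun t x => W t x * d₁ t x - d₂ t x) t x = _ := ((hwt.fun_mul h1t).fun_sub h2t).deriv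
    rw [ex, et, k1, k2]
    simp only [eig1]
    linear_combination d₁ t x * kw
  · have ex : dX (fun t x => d₂ t x - eig1 κ c₀ W t x * d₁ t x) t x = _ :=
      (h2x.fun_sub (hlx.fun_mul h1x)).deriv
    have et : dT (fun t x => d₂ t x - eig1 κ c₀ W t x * d₁ t x) t x = _ :=
      (h2t.fun_sub (hlt.fun_mul h1t)).deriv
    rw [ex, et, k1, k2]
    simp only [eig1]
    linear_combination -(1 - 2 * κ) * d₁ t x * kw

/-- The inverse change of variables, for existence: `(d₁, d₂)` is the combination of the right
eigenvectors `(1, λᵢ)` with coefficients `Vᵢ / (2 c)`, where `2 c` is the gap of the eigenvalues. -/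
theorem IsTransportPair.isReducedWave (hW : IsWave T τ₀ A B δ W)
    (hc : ∀ t ∈ Icc 0 T, ∀ x, 0 < κ * W t x + c₀)
    (hV : IsTransportPair κ c₀ F T W V₁ V₂) :
    IsReducedWave κ c₀ F T W (fun t x => (V₁ t x + V₂ t x) / (2 * (κ * W t x + c₀)))
      (fun t x => (eig1 κ c₀ W t x * V₁ t x + W t x * V₂ t x) / (2 * (κ * W t x + c₀))) := by
  have hsc : SmoothStrip T (fun t x => 2 * (κ * W t x + c₀)) :=
    (SmoothStrip.const 2).mul (((SmoothStrip.const κ).mul hW.smooth).add (SmoothStrip.const c₀))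
  have hne : ∀ t ∈ Icc 0 T, ∀ x, 2 * (κ * W t x + c₀) ≠ 0 := fun t ht x =>
    (mul_pos two_pos (hc t ht x)).ne'
  refine ⟨(hV.smooth₁.add hV.smooth₂).div hsc hne,
    ((hW.smooth.eig1.mul hV.smooth₁).add (hW.smooth.mul hV.smooth₂)).div hsc hne,
    fun t ht x => ?_, fun t ht x => ?_,
    fun x => by simp [hV.initial₁, hV.initial₂], fun x => by simp [hV.initial₁, hV.initial₂]⟩
  all_goals
    have ht' := Ioo_subset_Icc_self ht
    have k1 := hV.first t ht x
    have k2 := hV.second t ht x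
    have kw := hW.equation t ht x
    have hlx := hasDerivAt_eig1_space (κ := κ) (c₀ := c₀) hW.smooth ht' x
    have hlt := hasDerivAt_eig1_time (κ := κ) (c₀ := c₀) hW.smooth ht x
    have hwx := hW.smooth.hasDerivAt_dX ht' x
    have hwt := hW.smooth.hasDerivAt_dT ht x
    have h1x := hV.smooth₁.hasDerivAt_dX ht' x
    have h1t := hV.smooth₁.hasDerivAt_dT ht x
    have h2x := hV.smooth₂.hasDerivAt_dX ht' x
    have h2t := hV.smooth₂.hasDerivAt_dT ht x
    have hcx := ((hwx.const_mul κ).add_const c₀).const_mul 2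
    have hct := ((hwt.const_mul κ).add_const c₀).const_mul 2
    have hn := hne t ht' x
    have kw' : dT W t x = -(W t x * dX W t x) := by linarith
    have k1' : dT V₁ t x = -F * dX (dX W) t x - eig1 κ c₀ W t x * dX V₁ t x
      - 2 * (1 - κ) * dX W t x * V₁ t x := by linarith
    have k2' : dT V₂ t x = F * dX (dX W) t x + (1 - 2 * κ) * dX W t x * V₁ t x
      - W t x * dX V₂ t x - dX W t x * V₂ t x := by linarith
  · have ex := (((hlx.fun_mul h1x).fun_add (hwx.fun_mul h2x)).fun_div hcx hn).deriv
    have et := ((h1t.fun_add h2t).fun_div hct hn).deriv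
    rw [dX, dT, ex, et, k1', k2', kw', ← add_div, div_eq_zero_iff]
    left
    simp only [eig1]
    ring
  · have hflux : (fun y => -(eig1 κ c₀ W t y * W t y) * ((V₁ t y + V₂ t y) / (2 * (κ * W t y + c₀)))
        + (eig1 κ c₀ W t y + W t y)
          * ((eig1 κ c₀ W t y * V₁ t y + W t y * V₂ t y) / (2 * (κ * W t y + c₀))))
        = fun y => (eig1 κ c₀ W t y ^ 2 * V₁ t y + W t y ^ 2 * V₂ t y)
          / (2 * (κ * W t y + c₀)) := by
      ext y
      ring
    have ex := ((((hlx.fun_pow 2).fun_mul h1x).fun_add ((hwx.fun_pow 2).fun_mul h2x)).fun_div hcx hn).deriv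
    have et := (((hlt.fun_mul h1t).fun_add (hwt.fun_mul h2t)).fun_div hct hn).deriv
    rw [dX, dT, hflux, ex, et, k1', k2', kw', ← add_div, div_eq_iff (pow_ne_zero 2 hn)]
    simp only [eig1]
    ring

end Diagonalisation

/-- The data of an approximate rarefaction wave in terms of a Burgers wave. -/
theorem IsApproxRarefaction.exists_wave {γ ρm um ρp up t₀ δ : ℝ} {ρ u : ℝ → ℝ → ℝ} (hγ : 1 ≤ γ)
    (hpair : IsRarefactionPair γ ρm um ρp up) (ht₀ : 0 ≤ t₀)
    (h : IsApproxRarefaction γ ρm um ρp up t₀ δ ρ u) (T : ℝ) :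
    ∃ W, IsWave T t₀ ((eig2 γ ρp up + eig2 γ ρm um) / 2) ((eig2 γ ρp up - eig2 γ ρm um) / 2) δ W ∧
      ∀ t, 0 ≤ t → ∀ x,
        soundSpeed γ (ρ t x) = (γ - 1) / (γ + 1) * W t x
          + (2 / (γ + 1) - (γ - 1) / (γ + 1) * riemann2 γ ρm um) ∧
        u t x = W t x - soundSpeed γ (ρ t x) := by
  obtain ⟨w, hw, hew⟩ := h.eigenvalue
  refine ⟨_, hw.isWave hpair.expanding ht₀ T, fun t ht x => ⟨?_, ?_⟩⟩
  · rw [← hew t ht x, ← h.invariant t ht x]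
    exact soundSpeed_affine hγ (h.pos t ht x)
  · rw [← hew t ht x, eig2]
    ring

/-- The trace and determinant of the flux matrix are `2 u` and `u² - c²`, the sum and product of the
eigenvalues; and `u = (1 - κ) W - c₀` turns `u_xx` into `(1 - κ) W_xx`. -/
theorem isHyperbolicWave_iff {γ μ lam ε T κ c₀ : ℝ} {ρ u W : ℝ → ℝ → ℝ} (hγ : 1 ≤ γ)
    (hW : SmoothStrip T W) (hT : 0 < T)
    (hpos : ∀ t, 0 ≤ t → ∀ x, 0 < ρ t x)
    (hs : ∀ t, 0 ≤ t → ∀ x, soundSpeed γ (ρ t x) = κ * W t x + c₀)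
    (hu : ∀ t, 0 ≤ t → ∀ x, u t x = W t x - soundSpeed γ (ρ t x)) (d₁ d₂ : ℝ → ℝ → ℝ) :
    IsHyperbolicWave γ μ lam ε T ρ u d₁ d₂ ↔
      IsReducedWave κ c₀ ((2 * μ + lam) * (1 - κ) * ε) T W d₁ d₂ := by
  have hmom : ∀ t ∈ Ioo 0 T, ∀ x, (deriv (fun s => d₂ s x) t +
      deriv (fun y => -((ρ t y * u t y) ^ 2 / ρ t y ^ 2) * d₁ t y
        + deriv (pressure γ) (ρ t y) * d₁ t y
        + 2 * (ρ t y * u t y) / ρ t y * d₂ t y) x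
      = (2 * μ + lam) * ε * iteratedDeriv 2 (u t) x) ↔
      (dT d₂ t x
    + dX (fun t x => -(eig1 κ c₀ W t x * W t x) * d₁ t x
      + (eig1 κ c₀ W t x + W t x) * d₂ t x) t x
        = (2 * μ + lam) * (1 - κ) * ε * dX (dX W) t x) := by
    intro t ht x
    have e1 : (fun y => -((ρ t y * u t y) ^ 2 / ρ t y ^ 2) * d₁ t y
        + deriv (pressure γ) (ρ t y) * d₁ t y
        + 2 * (ρ t y * u t y) / ρ t y * d₂ t y)
        = fun y => -(eig1 κ c₀ W t y * W t y) * d₁ t y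
          + (eig1 κ c₀ W t y + W t y) * d₂ t y := by
      ext y
      have hr := (hpos t ht.1.le y).ne'
      rw [← soundSpeed_sq hγ (hpos t ht.1.le y), hu t ht.1.le, hs t ht.1.le, eig1]
      field_simp
      ring
    have e2 : iteratedDeriv 2 (u t) x = (1 - κ) * dX (dX W) t x := by
      have h1 : u t = fun y => (1 - κ) * W t y - c₀ := by
        ext y
        rw [hu t ht.1.le, hs t ht.1.le]
        ring
      have ht' := Ioo_subset_Icc_self ht
      have h2 : deriv (u t) = fun y => (1 - κ) * dX W t y := by
        ext y
        rw [h1]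
        exact (((hW.hasDerivAt_dX ht' y).const_mul (1 - κ)).sub_const c₀).deriv
      rw [iteratedDeriv_succ, iteratedDeriv_one, h2]
      exact (((hW.dX hT).hasDerivAt_dX ht' x).const_mul (1 - κ)).deriv
    rw [e1, e2]
    simp only [dT, dX]
    constructor <;> intro h <;> linear_combination h
  exact ⟨fun h => ⟨h.smooth₁, h.smooth₂, h.mass, fun t ht x => (hmom t ht x).1 (h.momentum t ht x),
      h.initial₁, h.initial₂⟩,
    fun h => ⟨h.smooth₁, h.smooth₂, h.mass, fun t ht x => (hmom t ht x).2 (h.momentum t ht x),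
      h.initial₁, h.initial₂⟩⟩

/-! ### Weighted energy estimates for transport equations -/

/-- The space-time rectangle `[0, t] × [-R, R]`. -/
def rect (t R : ℝ) : Set (ℝ × ℝ) := Icc 0 t ×ˢ Icc (-R) R

theorem rect_subset {t T R : ℝ} (ht : t ∈ Icc 0 T) : rect t R ⊆ Icc 0 T ×ˢ univ :=
  fun _ hq => ⟨⟨hq.1.1, hq.1.2.trans ht.2⟩, mem_univ _⟩

theorem measurableSet_rect (t R : ℝ) : MeasurableSet (rect t R) :=
  measurableSet_Icc.prod measurableSet_Icc

theorem integrableOn_rect {t T R : ℝ} (ht : t ∈ Icc 0 T) {h : ℝ × ℝ → ℝ}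
    (hh : ContinuousOn h (Icc 0 T ×ˢ univ)) : IntegrableOn h (rect t R) :=
  (hh.mono (rect_subset ht)).integrableOn_compact (isCompact_Icc.prod isCompact_Icc)

/-- Integrate the identity for `(Φ v²)_t + (l Φ v²)_x`. The weight hypothesis leaves the damping `-q
Φ v²`. The residual is at most `q h`, so half of the damping absorbs it at the price of `2 q Φ h²`.
The lateral terms vanish with `Φ`. -/
theorem SmoothStrip.energy_le {T t R b : ℝ} {Φ v l q h : ℝ → ℝ → ℝ} {G : ℝ × ℝ → ℝ} (hT : 0 < T)
    (ht : t ∈ Icc 0 T) (hR : 0 ≤ R) (hΦ : SmoothStrip T Φ) (hv : SmoothStrip T v)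
    (hl : SmoothStrip T l) (hq : SmoothStrip T q) (hG : ContinuousOn G (Icc 0 T ×ˢ univ))
    (hΦ0 : ∀ s ∈ Icc 0 T, ∀ x, 0 ≤ Φ s x) (hΦR : ∀ s ∈ Icc 0 T, Φ s R = 0 ∧ Φ s (-R) = 0)
    (hq0 : ∀ s ∈ Icc 0 T, ∀ x, 0 ≤ q s x)
    (hweight : ∀ s ∈ Ioo 0 T, ∀ x, dT Φ s x + HypWave.dX (fun t x => l t x * Φ t x) s x
      ≤ (2 * b - 1) * q s x * Φ s x)
    (heq : ∀ s ∈ Ioo 0 T, ∀ x, |dT v s x + l s x * HypWave.dX v s x + b * q s x * v s x|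
      ≤ q s x * h s x)
    (hh : ∀ s ∈ Ioo 0 T, ∀ x, h s x ^ 2 ≤ G (s, x)) (hv0 : ∀ x, v 0 x = 0) :
    (∫ x in -R..R, Φ t x * v t x ^ 2) + 1 / 2 * ∫ z in rect t R, Φ z.1 z.2 * q z.1 z.2 * v z.1 z.2 ^ 2
      ≤ 2 * ∫ z in rect t R, Φ z.1 z.2 * q z.1 z.2 * G z := by
  have hf : SmoothStrip T (fun t x => Φ t x * (v t x * v t x)) := hΦ.mul (hv.mul hv)
  have hg : SmoothStrip T (fun t x => (l t x * Φ t x) * (v t x * v t x)) :=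
    (hl.mul hΦ).mul (hv.mul hv)
  have c1 : ContinuousOn (fun z : ℝ × ℝ => Φ z.1 z.2 * q z.1 z.2 * v z.1 z.2 ^ 2)
      (Icc 0 T ×ˢ univ) := ((hΦ.mul hq).continuousOn).mul (hv.continuousOn.pow 2)
  have c2 : ContinuousOn (fun z : ℝ × ℝ => Φ z.1 z.2 * q z.1 z.2 * G z)
      (Icc 0 T ×ˢ univ) := ((hΦ.mul hq).continuousOn).mul hG
  have i1 : IntegrableOn _ (rect t R) := integrableOn_rect ht c1
  have i2 : IntegrableOn _ (rect t R) := integrableOn_rect ht c2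
  have key := integral_divergence hT hf hg ht hR
    (h := fun z => 2 * (Φ z.1 z.2 * q z.1 z.2 * G z)
      - 1 / 2 * (Φ z.1 z.2 * q z.1 z.2 * v z.1 z.2 ^ 2))
    (((continuousOn_const.mul c2).sub (continuousOn_const.mul c1)).mono (rect_subset ht))
    (fun s hs x => by
      have hs' : s ∈ Ioo 0 T := ⟨hs.1, hs.2.trans_le ht.2⟩
      have hs'' := Ioo_subset_Icc_self hs'
      have et : dT (fun t x => Φ t x * (v t x * v t x)) s x = _ :=
        ((hΦ.hasDerivAt_dT hs' x).fun_mul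
          ((hv.hasDerivAt_dT hs' x).fun_mul (hv.hasDerivAt_dT hs' x))).deriv
      have ex : HypWave.dX (fun t x => (l t x * Φ t x) * (v t x * v t x)) s x = _ :=
        (((hl.mul hΦ).hasDerivAt_dX hs'' x).fun_mul
          ((hv.hasDerivAt_dX hs'' x).fun_mul (hv.hasDerivAt_dX hs'' x))).deriv
      rw [et, ex]
      have hw := hweight s hs' x
      have he := heq s hs' x
      have hG' := hh s hs' x
      have hq' := hq0 s hs'' x
      have hΦ' := hΦ0 s hs'' x
      set Rm := dT v s x + l s x * HypWave.dX v s x + b * q s x * v s x with hRm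
      -- Young's inequality `2 |v| h ≤ v² / 2 + 2 h²`, multiplied by `q`.
      have h1 : 2 * v s x * Rm ≤ 1 / 2 * q s x * v s x ^ 2 + 2 * q s x * G (s, x) := by
        have h2 : 2 * v s x * Rm ≤ 2 * |v s x| * (q s x * h s x) := by
          calc 2 * v s x * Rm ≤ |2 * v s x * Rm| := le_abs_self _
            _ = 2 * |v s x| * |Rm| := by rw [abs_mul, abs_mul, abs_two]
            _ ≤ _ := by gcongr
        have h3 : 0 ≤ q s x * (|v s x| - 2 * h s x) ^ 2 := mul_nonneg hq' (sq_nonneg _)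
        have h4 : q s x * h s x ^ 2 ≤ q s x * G (s, x) := mul_le_mul_of_nonneg_left hG' hq'
        have h5 : |v s x| ^ 2 = v s x ^ 2 := sq_abs _
        nlinarith
      have h6 := mul_le_mul_of_nonneg_left h1 hΦ'
      have h7 := mul_le_mul_of_nonneg_right hw (sq_nonneg (v s x))
      have h8 : Φ s x * (2 * v s x * Rm) = 2 * Φ s x * v s x * dT v s x
          + 2 * (l s x * Φ s x) * v s x * HypWave.dX v s x + 2 * b * q s x * Φ s x * v s x ^ 2 := by
        rw [hRm]; ring
      linarith)
  have z1 : ∫ s in (0 : ℝ)..t, l s R * Φ s R * (v s R * v s R) = 0 := by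
    refine (intervalIntegral.integral_congr (g := fun _ => (0 : ℝ)) fun s hs => ?_).trans (by simp)
    rw [uIcc_of_le ht.1] at hs
    simp [(hΦR s ⟨hs.1, hs.2.trans ht.2⟩).1]
  have z2 : ∫ s in (0 : ℝ)..t, l s (-R) * Φ s (-R) * (v s (-R) * v s (-R)) = 0 := by
    refine (intervalIntegral.integral_congr (g := fun _ => (0 : ℝ)) fun s hs => ?_).trans (by simp)
    rw [uIcc_of_le ht.1] at hs
    simp [(hΦR s ⟨hs.1, hs.2.trans ht.2⟩).2]
  have z3 : ∫ x in -R..R, Φ 0 x * (v 0 x * v 0 x) = 0 := by simp [hv0]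
  rw [z1, z2, z3] at key
  have hint : ∫ z in rect t R, (2 * (Φ z.1 z.2 * q z.1 z.2 * G z)
      - 1 / 2 * (Φ z.1 z.2 * q z.1 z.2 * v z.1 z.2 ^ 2))
      = 2 * (∫ z in rect t R, Φ z.1 z.2 * q z.1 z.2 * G z)
        - 1 / 2 * ∫ z in rect t R, Φ z.1 z.2 * q z.1 z.2 * v z.1 z.2 ^ 2 := by
    rw [integral_sub (i2.const_mul 2) (i1.const_mul (1 / 2)), integral_const_mul,
      integral_const_mul]
  have hk : (∫ x in -R..R, Φ t x * (v t x * v t x)) ≤ ∫ z in rect t R,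
      (2 * (Φ z.1 z.2 * q z.1 z.2 * G z)
      - 1 / 2 * (Φ z.1 z.2 * q z.1 z.2 * v z.1 z.2 ^ 2)) := by
    simpa [rect] using key
  rw [hint] at hk
  have e : (∫ x in -R..R, Φ t x * v t x ^ 2) = ∫ x in -R..R, Φ t x * (v t x * v t x) := by
    simp only [sq]
  rw [e]
  linarith

/-- Differentiating a transport equation in space. -/
theorem SmoothStrip.differentiate_transport {T t a b c : ℝ} {W v : ℝ → ℝ → ℝ} {r : ℝ → ℝ} (hT : 0 < T)
    (hW : SmoothStrip T W) (hv : SmoothStrip T v) (ht : t ∈ Ioo 0 T)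
    (heq : ∀ x, dT v t x + (a * W t x + b) * HypWave.dX v t x + c * HypWave.dX W t x * v t x = r x)
    {x r' : ℝ} (hr : HasDerivAt r r' x) :
    dT (HypWave.dX v) t x + (a * W t x + b) * HypWave.dX (HypWave.dX v) t x
      + (c + a) * HypWave.dX W t x * HypWave.dX v t x
        = r' - c * HypWave.dX (HypWave.dX W) t x * v t x := by
  have ht' := Ioo_subset_Icc_self ht
  have h1 := hv.dX_dT_comm ht x
  have h2 := (((hW.hasDerivAt_dX ht' x).const_mul a).add_const b).fun_mul
    ((hv.dX hT).hasDerivAt_dX ht' x)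
  have h3 := (((hW.dX hT).hasDerivAt_dX ht' x).const_mul c).fun_mul (hv.hasDerivAt_dX ht' x)
  have h := ((h1.fun_add h2).fun_add h3).congr_of_eventuallyEq
    (Filter.Eventually.of_forall fun x => (heq x).symm)
  have := h.unique hr
  linarith

/-- A transport equation `V_t + (a W + b) V_x + β W_x V = F₁ W_xx + e W_x G` on the strip, with a
weight `Φ` on the rectangle `[0, t] × [-R, R]` adapted to it. -/
structure TransportData (a b β e Cq P m C₁ T t R δ η F₁ : ℝ) (W V G Φ : ℝ → ℝ → ℝ) : Prop where
  T_pos : 0 < T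
  t_mem : t ∈ Icc 0 T
  R_nonneg : 0 ≤ R
  δ_pos : 0 < δ
  source_le : |F₁| ≤ η
  smooth_W : SmoothStrip T W
  smooth_V : SmoothStrip T V
  smooth_G : SmoothStrip T G
  smooth_Φ : SmoothStrip T Φ
  q_nonneg : ∀ s ∈ Icc 0 T, ∀ x, 0 ≤ dX W s x
  q_bound : ∀ s ∈ Icc 0 T, ∀ j ≤ 4, ∀ x, |dX^[j] (dX W) s x| ≤ Cq * δ⁻¹ ^ j * dX W s x
  equation : ∀ s ∈ Ioo 0 T, ∀ x, dT V s x + (a * W s x + b) * dX V s x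
    + β * dX W s x * V s x = F₁ * dX (dX W) s x + e * dX W s x * G s x
  initial : ∀ x, V 0 x = 0
  Φ_nonneg : ∀ s ∈ Icc 0 T, ∀ x, 0 ≤ Φ s x
  Φ_le : ∀ s ∈ Icc 0 T, ∀ x, Φ s x ≤ P
  Φ_boundary : ∀ s ∈ Icc 0 T, Φ s R = 0 ∧ Φ s (-R) = 0
  Φ_weight : ∀ k : ℕ, k ≤ 3 → ∀ s ∈ Ioo 0 T, ∀ x, dT Φ s x
    + dX (fun t x => (a * W t x + b) * Φ t x) s x ≤ (2 * (β + k * a) - 1) * dX W s x * Φ s x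
  integral_q : ∫ z in rect t R, dX W z.1 z.2 ≤ m
  integral_G : ∀ k ≤ 3, ∫ z in rect t R, Φ z.1 z.2 * dX W z.1 z.2 * dX^[k] G z.1 z.2 ^ 2
    ≤ C₁ * (η * δ⁻¹ ^ (k + 1)) ^ 2

namespace TransportData

variable {a b β e Cq P m C₁ T t R δ η F₁ : ℝ} {W V G Φ : ℝ → ℝ → ℝ}

/-- Each space derivative adds `a W_x` to the damping coefficient, because the speed has slope `a
W_x`; this is the `β + k a` in `Φ_weight`. All commutator and source terms contain some `∂ₓʲ W_x`,
so `q_bound` extracts the factor `W_x` and one `δ⁻¹` for each derivative falling on it. -/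
theorem level_le (h : TransportData a b β e Cq P m C₁ T t R δ η F₁ W V G Φ) (hCq : 0 ≤ Cq)
    {k : ℕ} (hk : k ≤ 3) {s : ℝ} (hs : s ∈ Ioo 0 T) (x : ℝ) :
    |dT (dX^[k] V) s x + (a * W s x + b) * dX (dX^[k] V) s x + (β + k * a) * dX W s x * dX^[k] V s x|
      ≤ dX W s x * (Cq * (1 + 3 * |e| + 3 * |β| + 3 * |a|) * (η * δ⁻¹ ^ (k + 1)
        + ∑ i ∈ Finset.range (k + 1), δ⁻¹ ^ (k - i) * |dX^[i] G s x|
        + ∑ i ∈ Finset.range k, δ⁻¹ ^ (k - i) * |dX^[i] V s x|)) := by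
  have hT := h.T_pos
  have hs' := Ioo_subset_Icc_self hs
  have hW := h.smooth_W
  have hV := h.smooth_V
  have dq : ∀ j x, HasDerivAt (dX^[j] (dX W) s) (dX^[j + 1] (dX W) s x) x := fun j x => by
    rw [Function.iterate_succ_apply']
    exact ((hW.dX hT).dX_iterate hT j).hasDerivAt_dX hs' x
  have dG : ∀ j x, HasDerivAt (dX^[j] G s) (dX^[j + 1] G s x) x := fun j x => by
    rw [Function.iterate_succ_apply']
    exact (h.smooth_G.dX_iterate hT j).hasDerivAt_dX hs' x
  have dV : ∀ j x, HasDerivAt (dX^[j] V s) (dX^[j + 1] V s x) x := fun j x => by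
    rw [Function.iterate_succ_apply']
    exact (hV.dX_iterate hT j).hasDerivAt_dX hs' x
  have qG : ∀ i j x, HasDerivAt (fun x => dX^[i] (dX W) s x * dX^[j] G s x)
      (dX^[i + 1] (dX W) s x * dX^[j] G s x + dX^[i] (dX W) s x * dX^[j + 1] G s x) x :=
    fun i j x => (dq i x).fun_mul (dG j x)
  have qV : ∀ i j x, HasDerivAt (fun x => dX^[i] (dX W) s x * dX^[j] V s x)
      (dX^[i + 1] (dX W) s x * dX^[j] V s x + dX^[i] (dX W) s x * dX^[j + 1] V s x) x :=
    fun i j x => (dq i x).fun_mul (dV j x)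
  have step : ∀ (j : ℕ) (c : ℝ) (r : ℝ → ℝ), (∀ x, dT (dX^[j] V) s x
      + (a * W s x + b) * dX^[j + 1] V s x + c * dX W s x * dX^[j] V s x = r x) →
      ∀ x r', HasDerivAt r r' x → dT (dX^[j + 1] V) s x + (a * W s x + b) * dX^[j + 2] V s x
        + (c + a) * dX W s x * dX^[j + 1] V s x
          = r' - c * dX^[1] (dX W) s x * dX^[j] V s x := by
    intro j c r hr x r' hr'
    simp only [Function.iterate_succ_apply' dX] at hr ⊢
    exact SmoothStrip.differentiate_transport hT hW (hV.dX_iterate hT j) hs hr hr'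
  have l0 : ∀ x, dT (dX^[0] V) s x + (a * W s x + b) * dX^[1] V s x + β * dX W s x * dX^[0] V s x
      = F₁ * dX^[1] (dX W) s x + e * (dX^[0] (dX W) s x * dX^[0] G s x) := fun x => by
    refine (h.equation s hs x).trans ?_
    simp only [Function.iterate_zero, Function.iterate_one, id]
    ring
  have l1 : ∀ x, dT (dX^[1] V) s x + (a * W s x + b) * dX^[2] V s x
      + (β + a) * dX W s x * dX^[1] V s x
      = F₁ * dX^[2] (dX W) s x + e * (dX^[1] (dX W) s x * dX^[0] G s x
        + dX^[0] (dX W) s x * dX^[1] G s x) - β * (dX^[1] (dX W) s x * dX^[0] V s x) := fun x => by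
    refine (step 0 β _ l0 x _ (((dq 1 x).const_mul F₁).fun_add ((qG 0 0 x).const_mul e))).trans ?_
    ring
  have l2 : ∀ x, dT (dX^[2] V) s x + (a * W s x + b) * dX^[3] V s x
      + (β + a + a) * dX W s x * dX^[2] V s x
      = F₁ * dX^[3] (dX W) s x + e * (dX^[2] (dX W) s x * dX^[0] G s x
        + 2 * (dX^[1] (dX W) s x * dX^[1] G s x) + dX^[0] (dX W) s x * dX^[2] G s x)
        - β * (dX^[2] (dX W) s x * dX^[0] V s x)
        - (2 * β + a) * (dX^[1] (dX W) s x * dX^[1] V s x) := fun x => by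
    refine (step 1 (β + a) _ l1 x _ ((((dq 2 x).const_mul F₁).fun_add
      (((qG 1 0 x).fun_add (qG 0 1 x)).const_mul e)).fun_sub ((qV 1 0 x).const_mul β))).trans ?_
    ring
  have l3 : ∀ x, dT (dX^[3] V) s x + (a * W s x + b) * dX^[4] V s x
      + (β + a + a + a) * dX W s x * dX^[3] V s x
      = F₁ * dX^[4] (dX W) s x + e * (dX^[3] (dX W) s x * dX^[0] G s x
        + 3 * (dX^[2] (dX W) s x * dX^[1] G s x) + 3 * (dX^[1] (dX W) s x * dX^[2] G s x)
        + dX^[0] (dX W) s x * dX^[3] G s x)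
        - β * (dX^[3] (dX W) s x * dX^[0] V s x)
        - (3 * β + a) * (dX^[2] (dX W) s x * dX^[1] V s x)
        - (3 * β + 3 * a) * (dX^[1] (dX W) s x * dX^[2] V s x) := fun x => by
    refine (step 2 (β + a + a) _ l2 x _ (((((dq 3 x).const_mul F₁).fun_add
      ((((qG 2 0 x).fun_add ((qG 1 1 x).const_mul 2)).fun_add (qG 0 2 x)).const_mul e)).fun_sub
        ((qV 2 0 x).const_mul β)).fun_sub ((qV 1 1 x).const_mul (2 * β + a)))).trans ?_
    ring
  have hq := h.q_bound s hs'
  have hq0 := h.q_nonneg s hs' x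
  have hη : 0 ≤ η := (abs_nonneg _).trans h.source_le
  have hD : 0 < δ⁻¹ := inv_pos.2 h.δ_pos
  -- Dominates every numerical coefficient occurring in the equations up to order three.
  set K := 1 + 3 * |e| + 3 * |β| + 3 * |a| with hK
  have ae := abs_nonneg e
  have ab := abs_nonneg β
  have aa := abs_nonneg a
  have tF : ∀ j ≤ 4, |F₁ * dX^[j] (dX W) s x| ≤ dX W s x * (Cq * K * (η * δ⁻¹ ^ j)) := by
    intro j hj
    rw [abs_mul]
    calc |F₁| * |dX^[j] (dX W) s x| ≤ η * (Cq * δ⁻¹ ^ j * dX W s x) := by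
          gcongr
          · exact h.source_le
          · exact hq j hj x
      _ = 1 * (dX W s x * (Cq * (η * δ⁻¹ ^ j))) := by ring
      _ ≤ K * (dX W s x * (Cq * (η * δ⁻¹ ^ j))) := by
          gcongr
          rw [hK]; linarith
      _ = _ := by ring
  have tQ : ∀ (c y : ℝ), ∀ j ≤ 4, |c| ≤ K →
      |c * (dX^[j] (dX W) s x * y)| ≤ dX W s x * (Cq * K * (δ⁻¹ ^ j * |y|)) := by
    intro c y j hj hc
    rw [abs_mul, abs_mul]
    calc |c| * (|dX^[j] (dX W) s x| * |y|) ≤ K * ((Cq * δ⁻¹ ^ j * dX W s x) * |y|) := by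
          gcongr
          exact hq j hj x
      _ = _ := by ring
  have b1 : |e| ≤ K := by rw [hK]; linarith
  have b2 : |2 * e| ≤ K := by rw [hK, abs_mul, abs_two]; linarith
  have b3 : |3 * e| ≤ K := by
    rw [hK, abs_mul, abs_of_pos (by norm_num : (0 : ℝ) < 3)]; linarith
  have c1 : |-β| ≤ K := by rw [hK, abs_neg]; linarith
  have c2 : |-(2 * β + a)| ≤ K := by
    rw [hK, abs_neg]
    have := abs_add_le (2 * β) a
    rw [abs_mul, abs_two] at this
    linarith
  have c3 : |-(3 * β + a)| ≤ K := by
    rw [hK, abs_neg]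
    have := abs_add_le (3 * β) a
    rw [abs_mul, abs_of_pos (by norm_num : (0 : ℝ) < 3)] at this
    linarith
  have c4 : |-(3 * β + 3 * a)| ≤ K := by
    rw [hK, abs_neg]
    have := abs_add_le (3 * β) (3 * a)
    rw [abs_mul, abs_mul, abs_of_pos (by norm_num : (0 : ℝ) < 3)] at this
    linarith
  rw [← Function.iterate_succ_apply' dX]
  interval_cases k
  · have hl := l0 x
    have e1 := abs_le.1 (tF 1 (by norm_num))
    have e2 := abs_le.1 (tQ e (dX^[0] G s x) 0 (by norm_num) b1)
    simp only [Finset.sum_range_succ, Finset.sum_range_zero, Nat.cast_zero, zero_mul, add_zero,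
      zero_add, Nat.sub_zero, Nat.succ_eq_add_one] at hl e1 e2 ⊢
    rw [hl]
    rw [abs_le]
    constructor <;> linarith
  · have hl := l1 x
    have e1 := abs_le.1 (tF 2 (by norm_num))
    have e2 := abs_le.1 (tQ e (dX^[0] G s x) 1 (by norm_num) b1)
    have e3 := abs_le.1 (tQ e (dX^[1] G s x) 0 (by norm_num) b1)
    have e4 := abs_le.1 (tQ (-β) (dX^[0] V s x) 1 (by norm_num) c1)
    simp only [Finset.sum_range_succ, Finset.sum_range_zero, Nat.cast_one, one_mul,
      Nat.reduceAdd, zero_add, Nat.sub_zero, Nat.succ_eq_add_one, Nat.sub_self]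
      at hl e1 e2 e3 e4 ⊢
    rw [hl]
    rw [abs_le]
    constructor <;> linarith
  · have hl := l2 x
    have e1 := abs_le.1 (tF 3 (by norm_num))
    have e2 := abs_le.1 (tQ e (dX^[0] G s x) 2 (by norm_num) b1)
    have e3 := abs_le.1 (tQ (2 * e) (dX^[1] G s x) 1 (by norm_num) b2)
    have e4 := abs_le.1 (tQ e (dX^[2] G s x) 0 (by norm_num) b1)
    have e5 := abs_le.1 (tQ (-β) (dX^[0] V s x) 2 (by norm_num) c1)
    have e6 := abs_le.1 (tQ (-(2 * β + a)) (dX^[1] V s x) 1 (by norm_num) c2)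
    have hc : β + ((2 : ℕ) : ℝ) * a = β + a + a := by push_cast; ring
    rw [hc]
    simp only [Finset.sum_range_succ, Finset.sum_range_zero,
      Nat.reduceAdd, Nat.reduceSub, zero_add, Nat.sub_zero, Nat.succ_eq_add_one, Nat.sub_self]
      at hl e1 e2 e3 e4 e5 e6 ⊢
    rw [hl]
    rw [abs_le]
    constructor <;> linarith
  · have hl := l3 x
    have e1 := abs_le.1 (tF 4 (by norm_num))
    have e2 := abs_le.1 (tQ e (dX^[0] G s x) 3 (by norm_num) b1)
    have e3 := abs_le.1 (tQ (3 * e) (dX^[1] G s x) 2 (by norm_num) b3)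
    have e4 := abs_le.1 (tQ (3 * e) (dX^[2] G s x) 1 (by norm_num) b3)
    have e5 := abs_le.1 (tQ e (dX^[3] G s x) 0 (by norm_num) b1)
    have e6 := abs_le.1 (tQ (-β) (dX^[0] V s x) 3 (by norm_num) c1)
    have e7 := abs_le.1 (tQ (-(3 * β + a)) (dX^[1] V s x) 2 (by norm_num) c3)
    have e8 := abs_le.1 (tQ (-(3 * β + 3 * a)) (dX^[2] V s x) 1 (by norm_num) c4)
    have hc : β + ((3 : ℕ) : ℝ) * a = β + a + a + a := by push_cast; ring
    rw [hc]
    simp only [Finset.sum_range_succ, Finset.sum_range_zero,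
      Nat.reduceAdd, Nat.reduceSub, zero_add, Nat.sub_zero, Nat.succ_eq_add_one, Nat.sub_self]
      at hl e1 e2 e3 e4 e5 e6 e7 e8 ⊢
    rw [hl]
    rw [abs_le]
    constructor <;> linarith

end TransportData

/-! ### Induction on the order of differentiation -/

namespace TransportData

theorem sq_add_three_le (x y z : ℝ) : (x + y + z) ^ 2 ≤ 3 * (x ^ 2 + y ^ 2 + z ^ 2) := by
  nlinarith [sq_nonneg (x - y), sq_nonneg (y - z), sq_nonneg (x - z)]

theorem sum_mul_abs_sq_le (n : ℕ) (c y : ℕ → ℝ) :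
    (∑ i ∈ Finset.range n, c i * |y i|) ^ 2 ≤ n * ∑ i ∈ Finset.range n, c i ^ 2 * y i ^ 2 := by
  have := sq_sum_le_card_mul_sum_sq (s := Finset.range n) (f := fun i => c i * |y i|)
  simpa [mul_pow, sq_abs] using this

variable {a b β e Cq P m C₁ : ℝ}

/-- The space-time bounds of the lower orders control the commutators at order `k`; the direct
source costs only the mass of `W_x` times `P`. Here `6 = 2 · 3` comes from the energy estimate and
the square of three terms, and `16` and `9` bound `(k + 1)²` and `k²`. -/
theorem step_le {T t R δ η F₁ : ℝ} {W V G Φ : ℝ → ℝ → ℝ}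
    (h : TransportData a b β e Cq P m C₁ T t R δ η F₁ W V G Φ) (hCq : 0 ≤ Cq) (hP : 0 ≤ P)
    (hC₁ : 0 ≤ C₁) {C : ℝ} (hC : 0 ≤ C) {k : ℕ} (hk : k ≤ 3)
    (hlow : ∀ i < k, ∫ z in rect t R, Φ z.1 z.2 * dX W z.1 z.2 * dX^[i] V z.1 z.2 ^ 2
      ≤ C * (η * δ⁻¹ ^ (i + 1)) ^ 2) :
    (∫ x in -R..R, Φ t x * dX^[k] V t x ^ 2)
      + 1 / 2 * ∫ z in rect t R, Φ z.1 z.2 * dX W z.1 z.2 * dX^[k] V z.1 z.2 ^ 2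
      ≤ 6 * (Cq * (1 + 3 * |e| + 3 * |β| + 3 * |a|)) ^ 2 * (P * m + 16 * C₁ + 9 * C)
        * (η * δ⁻¹ ^ (k + 1)) ^ 2 := by
  have hT := h.T_pos
  set K := Cq * (1 + 3 * |e| + 3 * |β| + 3 * |a|) with hK
  set D := δ⁻¹ with hD
  have hD0 : 0 < D := inv_pos.2 h.δ_pos
  have hc : (k : ℝ) ≤ 3 := by exact_mod_cast hk
  have hk0 : (0 : ℝ) ≤ k := k.cast_nonneg
  set S₁ : ℝ × ℝ → ℝ := fun z =>
    ∑ i ∈ Finset.range (k + 1), (D ^ (k - i)) ^ 2 * dX^[i] G z.1 z.2 ^ 2 with hS₁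
  set S₂ : ℝ × ℝ → ℝ := fun z =>
    ∑ i ∈ Finset.range k, (D ^ (k - i)) ^ 2 * dX^[i] V z.1 z.2 ^ 2 with hS₂
  have hcG : ∀ i, ContinuousOn (fun z : ℝ × ℝ => dX^[i] G z.1 z.2) (Icc 0 T ×ˢ univ) := fun i =>
    (h.smooth_G.dX_iterate hT i).continuousOn
  have hcV : ∀ i, ContinuousOn (fun z : ℝ × ℝ => dX^[i] V z.1 z.2) (Icc 0 T ×ˢ univ) := fun i =>
    (h.smooth_V.dX_iterate hT i).continuousOn
  have hcS₁ : ContinuousOn S₁ (Icc 0 T ×ˢ univ) :=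
    continuousOn_finsetSum _ fun i _ => continuousOn_const.mul ((hcG i).pow 2)
  have hcS₂ : ContinuousOn S₂ (Icc 0 T ×ˢ univ) :=
    continuousOn_finsetSum _ fun i _ => continuousOn_const.mul ((hcV i).pow 2)
  have hcΦq : ContinuousOn (fun z : ℝ × ℝ => Φ z.1 z.2 * dX W z.1 z.2) (Icc 0 T ×ˢ univ) :=
    (h.smooth_Φ.mul (h.smooth_W.dX hT)).continuousOn
  have hb0 : ∀ x, dX^[k] V 0 x = 0 := by
    intro x
    have : V 0 = fun _ => 0 := funext h.initial
    rw [dX_iterate, this]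
    simp
  have key := SmoothStrip.energy_le (b := β + k * a) hT h.t_mem h.R_nonneg h.smooth_Φ
    (h.smooth_V.dX_iterate hT k)
    (l := fun t x => a * W t x + b)
    (((SmoothStrip.const a).mul h.smooth_W).add (SmoothStrip.const b)) (h.smooth_W.dX hT)
    (G := fun z => 3 * K ^ 2 * ((η * D ^ (k + 1)) ^ 2 + (k + 1 : ℕ) * S₁ z + k * S₂ z))
    (continuousOn_const.mul ((continuousOn_const.add (continuousOn_const.mul hcS₁)).add
      (continuousOn_const.mul hcS₂)))
    h.Φ_nonneg h.Φ_boundary h.q_nonneg (h.Φ_weight k hk)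
    (fun s hs x => h.level_le hCq hk hs x)
    (fun s _ x => by
      rw [← hK, mul_pow]
      have h1 := sum_mul_abs_sq_le (k + 1) (fun i => D ^ (k - i)) (fun i => dX^[i] G s x)
      have h2 := sum_mul_abs_sq_le k (fun i => D ^ (k - i)) (fun i => dX^[i] V s x)
      have h3 := sq_add_three_le (η * D ^ (k + 1))
        (∑ i ∈ Finset.range (k + 1), D ^ (k - i) * |dX^[i] G s x|)
        (∑ i ∈ Finset.range k, D ^ (k - i) * |dX^[i] V s x|)
      calc _ ≤ K ^ 2 * (3 * ((η * D ^ (k + 1)) ^ 2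
            + ((k + 1 : ℕ) : ℝ) * (∑ i ∈ Finset.range (k + 1), (D ^ (k - i)) ^ 2 * dX^[i] G s x ^ 2)
            + k * ∑ i ∈ Finset.range k, (D ^ (k - i)) ^ 2 * dX^[i] V s x ^ 2)) := by
              refine mul_le_mul_of_nonneg_left (h3.trans ?_) (sq_nonneg K)
              linarith
        _ = _ := by simp only [hS₁, hS₂]; ring)
    hb0
  have iq : IntegrableOn _ (rect t R) := integrableOn_rect h.t_mem hcΦq
  have iG : ∀ i, IntegrableOn (fun z : ℝ × ℝ => Φ z.1 z.2 * dX W z.1 z.2 * dX^[i] G z.1 z.2 ^ 2)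
      (rect t R) := fun i => integrableOn_rect h.t_mem (hcΦq.mul ((hcG i).pow 2))
  have iV : ∀ i, IntegrableOn (fun z : ℝ × ℝ => Φ z.1 z.2 * dX W z.1 z.2 * dX^[i] V z.1 z.2 ^ 2)
      (rect t R) := fun i => integrableOn_rect h.t_mem (hcΦq.mul ((hcV i).pow 2))
  have hpow : ∀ i ≤ k, (D ^ (k - i)) ^ 2 * (η * D ^ (i + 1)) ^ 2 = (η * D ^ (k + 1)) ^ 2 := by
    intro i hi
    have : D ^ (k + 1) = D ^ (k - i) * D ^ (i + 1) := by rw [← pow_add]; congr 1; omega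
    rw [this]; ring
  have b0 : ∫ z in rect t R, Φ z.1 z.2 * dX W z.1 z.2 ≤ P * m := by
    calc _ ≤ ∫ z in rect t R, P * dX W z.1 z.2 := by
          refine setIntegral_mono_on iq
            (integrableOn_rect h.t_mem (continuousOn_const.mul (h.smooth_W.dX hT).continuousOn))
            (measurableSet_rect t R) fun z hz => ?_
          have hz' := (rect_subset h.t_mem hz).1
          exact mul_le_mul_of_nonneg_right (h.Φ_le _ hz' _) (h.q_nonneg _ hz' _)
      _ ≤ _ := by
          rw [integral_const_mul]
          exact mul_le_mul_of_nonneg_left h.integral_q hP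
  have e1 : ∫ z in rect t R, Φ z.1 z.2 * dX W z.1 z.2 * S₁ z
      = ∑ i ∈ Finset.range (k + 1), (D ^ (k - i)) ^ 2
        * ∫ z in rect t R, Φ z.1 z.2 * dX W z.1 z.2 * dX^[i] G z.1 z.2 ^ 2 := by
    rw [← Finset.sum_congr rfl fun i _ => integral_const_mul ((D ^ (k - i)) ^ 2) _,
      ← integral_finsetSum _ fun i _ => (iG i).const_mul _]
    congr 1
    ext z
    rw [hS₁, Finset.mul_sum]
    exact Finset.sum_congr rfl fun i _ => by ring
  have e2 : ∫ z in rect t R, Φ z.1 z.2 * dX W z.1 z.2 * S₂ z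
      = ∑ i ∈ Finset.range k, (D ^ (k - i)) ^ 2
        * ∫ z in rect t R, Φ z.1 z.2 * dX W z.1 z.2 * dX^[i] V z.1 z.2 ^ 2 := by
    rw [← Finset.sum_congr rfl fun i _ => integral_const_mul ((D ^ (k - i)) ^ 2) _,
      ← integral_finsetSum _ fun i _ => (iV i).const_mul _]
    congr 1
    ext z
    rw [hS₂, Finset.mul_sum]
    exact Finset.sum_congr rfl fun i _ => by ring
  have b1 : ∫ z in rect t R, Φ z.1 z.2 * dX W z.1 z.2 * S₁ z
      ≤ (k + 1 : ℕ) * (C₁ * (η * D ^ (k + 1)) ^ 2) := by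
    rw [e1]
    refine (Finset.sum_le_sum (g := fun _ => C₁ * (η * D ^ (k + 1)) ^ 2) fun i hi => ?_).trans ?_
    · have hi' : i ≤ k := Nat.lt_succ_iff.1 (Finset.mem_range.1 hi)
      rw [← hpow i hi', mul_left_comm]
      exact mul_le_mul_of_nonneg_left (h.integral_G i (hi'.trans hk)) (sq_nonneg _)
    · simp
  have b2 : ∫ z in rect t R, Φ z.1 z.2 * dX W z.1 z.2 * S₂ z
      ≤ k * (C * (η * D ^ (k + 1)) ^ 2) := by
    rw [e2]
    refine (Finset.sum_le_sum (g := fun _ => C * (η * D ^ (k + 1)) ^ 2) fun i hi => ?_).trans ?_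
    · have hi' : i < k := Finset.mem_range.1 hi
      rw [← hpow i hi'.le, mul_left_comm]
      exact mul_le_mul_of_nonneg_left (hlow i hi') (sq_nonneg _)
    · simp
  have e3 : ∫ z in rect t R, Φ z.1 z.2 * dX W z.1 z.2
      * (3 * K ^ 2 * ((η * D ^ (k + 1)) ^ 2 + (k + 1 : ℕ) * S₁ z + k * S₂ z))
      = 3 * K ^ 2 * ((η * D ^ (k + 1)) ^ 2 * (∫ z in rect t R, Φ z.1 z.2 * dX W z.1 z.2)
        + (k + 1 : ℕ) * (∫ z in rect t R, Φ z.1 z.2 * dX W z.1 z.2 * S₁ z)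
        + k * ∫ z in rect t R, Φ z.1 z.2 * dX W z.1 z.2 * S₂ z) := by
    have j0 := iq.const_mul ((η * D ^ (k + 1)) ^ 2)
    have i1 : IntegrableOn (fun z : ℝ × ℝ => Φ z.1 z.2 * dX W z.1 z.2 * S₁ z) (rect t R) :=
      integrableOn_rect h.t_mem (hcΦq.mul hcS₁)
    have i2 : IntegrableOn (fun z : ℝ × ℝ => Φ z.1 z.2 * dX W z.1 z.2 * S₂ z) (rect t R) :=
      integrableOn_rect h.t_mem (hcΦq.mul hcS₂)
    have j1 := i1.const_mul ((k + 1 : ℕ) : ℝ)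
    have j2 := i2.const_mul (k : ℝ)
    rw [← integral_const_mul ((η * D ^ (k + 1)) ^ 2), ← integral_const_mul ((k + 1 : ℕ) : ℝ),
      ← integral_const_mul (k : ℝ), ← integral_add j0 j1, ← integral_add (j0.fun_add j1) j2,
      ← integral_const_mul]
    congr 1
    ext z
    ring
  rw [e3] at key
  refine key.trans ?_
  have hX : 0 ≤ (η * D ^ (k + 1)) ^ 2 := sq_nonneg _
  have f1 : ((k + 1 : ℕ) : ℝ) * (∫ z in rect t R, Φ z.1 z.2 * dX W z.1 z.2 * S₁ z)
      ≤ 16 * (C₁ * (η * D ^ (k + 1)) ^ 2) := by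
    push_cast at b1 ⊢
    calc _ ≤ ((k : ℝ) + 1) * ((k + 1) * (C₁ * (η * D ^ (k + 1)) ^ 2)) :=
          mul_le_mul_of_nonneg_left b1 (by linarith)
      _ = ((k : ℝ) + 1) ^ 2 * (C₁ * (η * D ^ (k + 1)) ^ 2) := by ring
      _ ≤ _ := by
          refine mul_le_mul_of_nonneg_right ?_ (mul_nonneg hC₁ hX)
          nlinarith
  have f2 : (k : ℝ) * (∫ z in rect t R, Φ z.1 z.2 * dX W z.1 z.2 * S₂ z)
      ≤ 9 * (C * (η * D ^ (k + 1)) ^ 2) := by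
    calc _ ≤ (k : ℝ) * (k * (C * (η * D ^ (k + 1)) ^ 2)) :=
          mul_le_mul_of_nonneg_left b2 hk0
      _ = (k : ℝ) ^ 2 * (C * (η * D ^ (k + 1)) ^ 2) := by ring
      _ ≤ _ := by
          refine mul_le_mul_of_nonneg_right ?_ (mul_nonneg hC hX)
          nlinarith
  have f0 := mul_le_mul_of_nonneg_left b0 hX
  have f3 : (η * D ^ (k + 1)) ^ 2 * (∫ z in rect t R, Φ z.1 z.2 * dX W z.1 z.2)
        + (k + 1 : ℕ) * (∫ z in rect t R, Φ z.1 z.2 * dX W z.1 z.2 * S₁ z)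
        + k * (∫ z in rect t R, Φ z.1 z.2 * dX W z.1 z.2 * S₂ z)
      ≤ (P * m + 16 * C₁ + 9 * C) * (η * D ^ (k + 1)) ^ 2 := by linarith
  have := mul_le_mul_of_nonneg_left f3 (by positivity : 0 ≤ 6 * K ^ 2)
  linarith

theorem exists_bound (a b β e : ℝ) (hCq : 0 ≤ Cq) (hP : 0 ≤ P) (hm : 0 ≤ m) (hC₁ : 0 ≤ C₁) :
    ∃ C, 0 ≤ C ∧ ∀ {T t R δ η F₁ : ℝ} {W V G Φ : ℝ → ℝ → ℝ},
      TransportData a b β e Cq P m C₁ T t R δ η F₁ W V G Φ → ∀ k ≤ 3,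
        (∫ x in -R..R, Φ t x * dX^[k] V t x ^ 2) ≤ C * (η * δ⁻¹ ^ (k + 1)) ^ 2 ∧
        ∫ z in rect t R, Φ z.1 z.2 * dX W z.1 z.2 * dX^[k] V z.1 z.2 ^ 2
          ≤ C * (η * δ⁻¹ ^ (k + 1)) ^ 2 := by
  suffices H : ∀ n ≤ 4, ∃ C, 0 ≤ C ∧ ∀ {T t R δ η F₁ : ℝ} {W V G Φ : ℝ → ℝ → ℝ},
      TransportData a b β e Cq P m C₁ T t R δ η F₁ W V G Φ → ∀ k < n,
        (∫ x in -R..R, Φ t x * dX^[k] V t x ^ 2) ≤ C * (η * δ⁻¹ ^ (k + 1)) ^ 2 ∧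
        ∫ z in rect t R, Φ z.1 z.2 * dX W z.1 z.2 * dX^[k] V z.1 z.2 ^ 2
          ≤ C * (η * δ⁻¹ ^ (k + 1)) ^ 2 by
    obtain ⟨C, hC, h⟩ := H 4 le_rfl
    exact ⟨C, hC, fun hd k hk => h hd k (by omega)⟩
  intro n
  induction n with
  | zero => exact fun _ => ⟨0, le_rfl, fun _ k hk => absurd hk (Nat.not_lt_zero k)⟩
  | succ n ih =>
    intro hn
    obtain ⟨C, hC, h⟩ := ih (by omega)
    set A := 6 * (Cq * (1 + 3 * |e| + 3 * |β| + 3 * |a|)) ^ 2 * (P * m + 16 * C₁ + 9 * C) with hA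
    have hA0 : 0 ≤ A := by positivity
    -- The factor 2 undoes the `1 / 2` in front of the space-time integral.
    refine ⟨C + 2 * A, by positivity, fun {T t R δ η F₁ W V G Φ} hd k hk => ?_⟩
    have hX : 0 ≤ (η * δ⁻¹ ^ (k + 1)) ^ 2 := sq_nonneg _
    rcases Nat.lt_succ_iff_lt_or_eq.1 hk with hlt | rfl
    · obtain ⟨h1, h2⟩ := h hd k hlt
      have : C * (η * δ⁻¹ ^ (k + 1)) ^ 2 ≤ (C + 2 * A) * (η * δ⁻¹ ^ (k + 1)) ^ 2 :=
        mul_le_mul_of_nonneg_right (by linarith) hX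
      exact ⟨h1.trans this, h2.trans this⟩
    · have hs := hd.step_le hCq hP hC₁ hC (k := k) (by omega) (fun i hi => (h hd i hi).2)
      rw [← hA] at hs
      have n1 : 0 ≤ ∫ x in -R..R, Φ t x * dX^[k] V t x ^ 2 :=
        intervalIntegral.integral_nonneg (by linarith [hd.R_nonneg]) fun x _ =>
          mul_nonneg (hd.Φ_nonneg t hd.t_mem x) (sq_nonneg _)
      have n2 : 0 ≤ ∫ z in rect t R, Φ z.1 z.2 * dX W z.1 z.2 * dX^[k] V z.1 z.2 ^ 2 :=
        setIntegral_nonneg (measurableSet_rect t R) fun z hz => by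
          have hz' := (rect_subset hd.t_mem hz).1
          exact mul_nonneg (mul_nonneg (hd.Φ_nonneg _ hz' _) (hd.q_nonneg _ hz' _)) (sq_nonneg _)
      have n3 := mul_nonneg hC hX
      have n4 := mul_nonneg hA0 hX
      constructor <;> linarith

end TransportData

/-! ### Estimates for the diagonal system -/

/-- A smooth cutoff of the domain of dependence `|x| ≤ R - Λ t` for speeds at most `Λ`. -/
def cutoff (R Λ t x : ℝ) : ℝ :=
  Real.smoothTransition (R - x - Λ * t) * Real.smoothTransition (R + x - Λ * t)

theorem contDiff_smoothTransition : ContDiff ℝ ∞ Real.smoothTransition :=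
  Real.smoothTransition.contDiff

theorem smoothStrip_cutoff (R Λ T : ℝ) : SmoothStrip T (cutoff R Λ) :=
  (SmoothStrip.comp contDiff_smoothTransition
      (((SmoothStrip.const R).sub SmoothStrip.space).sub
        ((SmoothStrip.const Λ).mul SmoothStrip.time))).mul
    (SmoothStrip.comp contDiff_smoothTransition
      (((SmoothStrip.const R).add SmoothStrip.space).sub
        ((SmoothStrip.const Λ).mul SmoothStrip.time)))

theorem cutoff_nonneg (R Λ t x : ℝ) : 0 ≤ cutoff R Λ t x :=
  mul_nonneg (Real.smoothTransition.nonneg _) (Real.smoothTransition.nonneg _)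

theorem cutoff_le_one (R Λ t x : ℝ) : cutoff R Λ t x ≤ 1 :=
  mul_le_one₀ (Real.smoothTransition.le_one _) (Real.smoothTransition.nonneg _)
    (Real.smoothTransition.le_one _)

theorem cutoff_boundary {Λ t : ℝ} (R : ℝ) (hΛ : 0 ≤ Λ) (ht : 0 ≤ t) :
    cutoff R Λ t R = 0 ∧ cutoff R Λ t (-R) = 0 := by
  have := mul_nonneg hΛ ht
  constructor
  · rw [cutoff, Real.smoothTransition.zero_of_nonpos (by linarith), zero_mul]
  · rw [cutoff, Real.smoothTransition.zero_of_nonpos (x := R + -R - Λ * t) (by linarith), mul_zero]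

theorem cutoff_eq_one {R Λ t x : ℝ} (h : |x| ≤ R - Λ * t - 1) : cutoff R Λ t x = 1 := by
  obtain ⟨h1, h2⟩ := abs_le.1 h
  rw [cutoff, Real.smoothTransition.one_of_one_le (by linarith),
    Real.smoothTransition.one_of_one_le (by linarith), one_mul]

/-- The cutoff decreases along characteristics of speed at most `Λ`. -/
theorem cutoff_transport_le {Λ l : ℝ} (hl : |l| ≤ Λ) (R t x : ℝ) :
    dT (cutoff R Λ) t x + l * dX (cutoff R Λ) t x ≤ 0 := by
  obtain ⟨h1, h2⟩ := abs_le.1 hl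
  have hS : ∀ y, HasDerivAt Real.smoothTransition (deriv Real.smoothTransition y) y := fun y =>
    (contDiff_smoothTransition.differentiable (by simp) y).hasDerivAt
  have hS0 : ∀ y, 0 ≤ deriv Real.smoothTransition y := fun y =>
    Real.smoothTransition.monotone.deriv_nonneg
  have t1 : HasDerivAt (fun s => R - x - Λ * s) (-Λ) t := by
    simpa using ((hasDerivAt_id t).const_mul Λ).const_sub (R - x)
  have t2 : HasDerivAt (fun s => R + x - Λ * s) (-Λ) t := by
    simpa using ((hasDerivAt_id t).const_mul Λ).const_sub (R + x)
  have x1 : HasDerivAt (fun y => R - y - Λ * t) (-1) x :=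
    ((hasDerivAt_id x).const_sub R).sub_const (Λ * t)
  have x2 : HasDerivAt (fun y => R + y - Λ * t) 1 x :=
    ((hasDerivAt_id x).const_add R).sub_const (Λ * t)
  have y1 := (hS (R - x - Λ * t)).comp t t1
  have y2 := (hS (R + x - Λ * t)).comp t t2
  have z1 := (hS (R - x - Λ * t)).comp x x1
  have z2 := (hS (R + x - Λ * t)).comp x x2
  have et : dT (cutoff R Λ) t x
      = deriv Real.smoothTransition (R - x - Λ * t) * (-Λ)
          * Real.smoothTransition (R + x - Λ * t)
        + Real.smoothTransition (R - x - Λ * t)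
          * (deriv Real.smoothTransition (R + x - Λ * t) * (-Λ)) :=
    (y1.fun_mul y2).deriv
  have ex : dX (cutoff R Λ) t x
      = deriv Real.smoothTransition (R - x - Λ * t) * (-1)
          * Real.smoothTransition (R + x - Λ * t)
        + Real.smoothTransition (R - x - Λ * t)
          * (deriv Real.smoothTransition (R + x - Λ * t) * 1) :=
    (z1.fun_mul z2).deriv
  rw [et, ex]
  have p1 := mul_nonneg (mul_nonneg (hS0 (R - x - Λ * t))
    (Real.smoothTransition.nonneg (R + x - Λ * t))) (by linarith : 0 ≤ Λ + l)
  have p2 := mul_nonneg (mul_nonneg (hS0 (R + x - Λ * t))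
    (Real.smoothTransition.nonneg (R - x - Λ * t))) (by linarith : 0 ≤ Λ - l)
  linarith

section Weights

variable {T τ₀ A B δ κ c₀ : ℝ} {W : ℝ → ℝ → ℝ}

/-- At each time the space integral of `W_x` is a difference of two values of `W`, hence at most `2
B` whatever `δ` is. -/
theorem IsWave.integral_dX_le (hW : IsWave T τ₀ A B δ W) (hB : 0 ≤ B) (hT : 0 < T) {t R : ℝ}
    (ht : t ∈ Icc 0 T) (hR : 0 ≤ R) : ∫ z in rect t R, dX W z.1 z.2 ≤ 2 * B * T := by
  have hneg : SmoothStrip T (fun t x => 0 - W t x) := (SmoothStrip.const 0).sub hW.smooth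
  have key := SmoothStrip.integral_divergence hT (SmoothStrip.const 0) hneg ht hR
    (h := fun z => -dX W z.1 z.2)
    (((hW.smooth.dX hT).continuousOn.neg).mono (rect_subset ht))
    (fun s hs x => by
      have hs' : s ∈ Icc 0 T := ⟨hs.1.le, hs.2.le.trans ht.2⟩
      have ex : dX (fun t x => 0 - W t x) s x = -dX W s x :=
        ((hW.smooth.hasDerivAt_dX hs' x).const_sub 0).deriv
      have et : dT (fun _ _ => (0 : ℝ)) s x = 0 := deriv_const _ _
      rw [ex, et, zero_add])
  have hc : ∀ y, ContinuousOn (fun s => W s y) (uIcc 0 t) := fun y => by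
    rw [uIcc_of_le ht.1]
    exact hW.smooth.continuousOn.comp (f := fun s : ℝ => (s, y))
      (Continuous.continuousOn (by fun_prop)) fun s hs => ⟨⟨hs.1, hs.2.trans ht.2⟩, mem_univ _⟩
  have u1 : ∫ s in (0 : ℝ)..t, W s R ≤ ∫ s in (0 : ℝ)..t, (A + B) :=
    intervalIntegral.integral_mono_on ht.1 (hc R).intervalIntegrable (by simp)
      fun s hs => (hW.mem_Icc hB ⟨hs.1, hs.2.trans ht.2⟩ R).2
  have u2 : ∫ s in (0 : ℝ)..t, (A - B) ≤ ∫ s in (0 : ℝ)..t, W s (-R) :=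
    intervalIntegral.integral_mono_on ht.1 (by simp) (hc (-R)).intervalIntegrable
      fun s hs => (hW.mem_Icc hB ⟨hs.1, hs.2.trans ht.2⟩ (-R)).1
  simp only [intervalIntegral.integral_const, smul_eq_mul, sub_zero] at u1 u2
  simp only [zero_sub, intervalIntegral.integral_neg, intervalIntegral.integral_zero, add_zero,
    sub_zero, integral_neg] at key
  change _ ≤ -∫ z in rect t R, dX W z.1 z.2 at key
  have := mul_le_mul_of_nonneg_left ht.2 (by linarith : 0 ≤ 2 * B)
  linarith

/-- Along speed `W - 2 c` the Burgers equation gives `W_t + (W - 2 c) W_x = -2 c W_x`, so `exp (M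
W)` decays at rate `2 M c W_x`, while `1 - 2 κ` is the divergence of the speed. With `κ = c₀ = M =
0` the same statement covers the speed `W`. -/
theorem IsWave.weight_le (hW : IsWave T τ₀ A B δ W) {M Λ R s : ℝ} (hs : s ∈ Ioo 0 T) (x : ℝ)
    (hΛ : |eig1 κ c₀ W s x| ≤ Λ) :
    dT (fun t x => cutoff R Λ t x * Real.exp (M * W t x)) s x
      + dX (fun t x => ((1 - 2 * κ) * W t x + -2 * c₀)
        * (cutoff R Λ t x * Real.exp (M * W t x))) s x
      ≤ (1 - 2 * κ - 2 * M * (κ * W s x + c₀)) * dX W s x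
        * (cutoff R Λ s x * Real.exp (M * W s x)) := by
  have hs' := Ioo_subset_Icc_self hs
  have hcut := smoothStrip_cutoff R Λ T
  have wx := hW.smooth.hasDerivAt_dX hs' x
  have wt := hW.smooth.hasDerivAt_dT hs x
  have et : dT (fun t x => cutoff R Λ t x * Real.exp (M * W t x)) s x = _ :=
    ((hcut.hasDerivAt_dT hs x).fun_mul (wt.const_mul M).exp).deriv
  have ex : dX (fun t x => ((1 - 2 * κ) * W t x + -2 * c₀)
        * (cutoff R Λ t x * Real.exp (M * W t x))) s x = _ :=
    (((wx.const_mul (1 - 2 * κ)).add_const (-2 * c₀)).fun_mul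
      ((hcut.hasDerivAt_dX hs' x).fun_mul (wx.const_mul M).exp)).deriv
  rw [et, ex]
  have hl : eig1 κ c₀ W s x = (1 - 2 * κ) * W s x + -2 * c₀ := by rw [eig1]; ring
  have h1 := cutoff_transport_le hΛ R s x
  rw [hl] at h1
  have h2 := mul_le_mul_of_nonneg_right h1 (Real.exp_pos (M * W s x)).le
  have h3 := hW.equation s hs x
  have h4 : dT W s x = -(W s x * dX W s x) := by linarith
  rw [h4]
  linarith

end Weights

/-- Passing from a weighted integral to an unweighted one on a smaller interval. -/
theorem integral_sq_le_of_weight {φ v : ℝ → ℝ} {n R p X : ℝ} (hn : 0 ≤ n) (hnR : n ≤ R)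
    (hφ : Continuous φ) (hv : Continuous v) (hφ0 : ∀ x, 0 ≤ φ x) (hp : 0 < p)
    (hφp : ∀ x ∈ Icc (-n) n, p ≤ φ x) (hX : ∫ x in -R..R, φ x * v x ^ 2 ≤ X) :
    ∫ x in -n..n, v x ^ 2 ≤ p⁻¹ * X := by
  rw [le_inv_mul_iff₀ hp]
  refine le_trans ?_ hX
  rw [← intervalIntegral.integral_const_mul]
  have c1 : Continuous fun x => φ x * v x ^ 2 := by fun_prop
  calc ∫ x in -n..n, p * v x ^ 2 ≤ ∫ x in -n..n, φ x * v x ^ 2 := by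
        refine intervalIntegral.integral_mono_on (by linarith)
          (Continuous.intervalIntegrable (by fun_prop) _ _) (c1.intervalIntegrable _ _)
          fun x hx => ?_
        exact mul_le_mul_of_nonneg_right (hφp x hx) (sq_nonneg _)
    _ ≤ _ := by
        refine intervalIntegral.integral_mono_interval (by linarith) (by linarith) hnR
          (Filter.Eventually.of_forall fun x => mul_nonneg (hφ0 x) (sq_nonneg _))
          (c1.intervalIntegrable _ _)

theorem dX_iterate_zero (k : ℕ) (t x : ℝ) : dX^[k] (fun _ _ => 0) t x = 0 := by
  rw [dX_iterate]
  simp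

/-- The two equations are estimated in order: `V₁` first with no coupling source, then `V₂` with the
weighted space-time bound of `V₁` as the bound on its source. The constant is fixed before `δ`, `F`,
the solution and the interval `[-n, n]`. -/
theorem IsTransportPair.exists_bound {κ c₀ T τ₀ A B cm : ℝ} (hT : 0 < T) (hτ : 0 ≤ τ₀)
    (hB : 0 < B) (hcm : 0 < cm) (hc : ∀ w ∈ Icc (A - B) (A + B), cm ≤ κ * w + c₀) :
    ∃ C, 0 ≤ C ∧ ∀ {δ F : ℝ} {W V₁ V₂ : ℝ → ℝ → ℝ}, 0 < δ → IsWave T τ₀ A B δ W →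
      IsTransportPair κ c₀ F T W V₁ V₂ → ∀ k ≤ 3, ∀ t ∈ Icc 0 T, ∀ n, 0 ≤ n →
        (∫ x in -n..n, dX^[k] V₁ t x ^ 2) ≤ C * (|F| * δ⁻¹ ^ (k + 1)) ^ 2 ∧
        (∫ x in -n..n, dX^[k] V₂ t x ^ 2) ≤ C * (|F| * δ⁻¹ ^ (k + 1)) ^ 2 := by
  obtain ⟨Cq, hCq, hq⟩ := ProfileRel.exists_bound 4
  set a := 1 - 2 * κ with ha
  set M := (8 * |a| + 2 * |2 * (1 - κ)| + 1) / (2 * cm) with hM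
  have hM0 : 0 ≤ M := by positivity
  set P := Real.exp (M * (A + B)) with hP
  set p := Real.exp (M * (A - B)) with hp
  have hp0 : 0 < p := Real.exp_pos _
  obtain ⟨C₁, hC₁, H₁⟩ := TransportData.exists_bound (C₁ := 0) (m := 2 * B * T) a (-2 * c₀)
    (2 * (1 - κ)) 0 hCq.le (Real.exp_pos (M * (A + B))).le (by positivity) le_rfl
  obtain ⟨C₂, hC₂, H₂⟩ := TransportData.exists_bound (Cq := Cq) (P := 1) (C₁ := p⁻¹ * C₁)
    (m := 2 * B * T) 1 0 1 a hCq.le zero_le_one (by positivity) (by positivity)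
  refine ⟨p⁻¹ * C₁ + C₂, by positivity, fun {δ F W V₁ V₂} hδ hW hV k hk t ht n hn => ?_⟩
  obtain ⟨Λ, hΛ⟩ : ∃ Λ : ℝ, ∀ w ∈ Icc (A - B) (A + B), |w| ≤ Λ ∧ |w - 2 * (κ * w + c₀)| ≤ Λ := by
    obtain ⟨L₁, h₁⟩ := (isCompact_Icc (a := A - B) (b := A + B)).exists_bound_of_continuousOn
      (f := fun w : ℝ => w) continuousOn_id
    obtain ⟨L₂, h₂⟩ := (isCompact_Icc (a := A - B) (b := A + B)).exists_bound_of_continuousOn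
      (f := fun w : ℝ => w - 2 * (κ * w + c₀)) (Continuous.continuousOn (by fun_prop))
    exact ⟨max L₁ L₂, fun w hw => ⟨(h₁ w hw).trans (le_max_left _ _),
      (h₂ w hw).trans (le_max_right _ _)⟩⟩
  have hΛ0 : 0 ≤ Λ := (abs_nonneg _).trans (hΛ A ⟨by linarith, by linarith⟩).1
  -- The cutoff is then still equal to `1` on `[-n, n]` at every time up to `T`; the `1` is the
  -- width of its transition layer.
  set R := n + Λ * T + 1 with hR
  have hΛT := mul_nonneg hΛ0 hT.le
  have hR0 : 0 ≤ R := by linarith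
  have hq0 := fun s (hs : s ∈ Icc 0 T) x => hW.dX_nonneg hB hδ hτ hT hs x
  have hmem := fun s (hs : s ∈ Icc 0 T) x => hW.mem_Icc hB.le hs x
  have hqb : ∀ s ∈ Icc 0 T, ∀ j ≤ 4, ∀ x, |dX^[j] (dX W) s x| ≤ Cq * δ⁻¹ ^ j * dX W s x :=
    fun s hs j hj x => hW.abs_dX_iterate_le hq hB hδ hτ hT hs hj x
  have hcut := smoothStrip_cutoff R Λ T
  have hexp : SmoothStrip T (fun t x => Real.exp (M * W t x)) :=
    SmoothStrip.comp Real.contDiff_exp ((SmoothStrip.const M).mul hW.smooth)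
  have D₁ : TransportData a (-2 * c₀) (2 * (1 - κ)) 0 Cq P (2 * B * T) 0 T t R δ |F| (-F) W V₁
      (fun _ _ => 0) (fun t x => cutoff R Λ t x * Real.exp (M * W t x)) := by
    refine ⟨hT, ht, hR0, hδ, (abs_neg F).le, hW.smooth, hV.smooth₁, SmoothStrip.const 0,
      hcut.mul hexp, hq0, hqb, ?_, hV.initial₁, ?_, ?_, ?_, ?_, hW.integral_dX_le hB.le hT ht hR0, ?_⟩
    · intro s hs x
      have := hV.first s hs x
      rw [eig1] at this
      rw [ha]
      linarith
    · exact fun s _ x => mul_nonneg (cutoff_nonneg _ _ _ _) (Real.exp_pos _).le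
    · intro s hs x
      have h1 : Real.exp (M * W s x) ≤ P :=
        Real.exp_le_exp.2 (mul_le_mul_of_nonneg_left (hmem s hs x).2 hM0)
      have h2 := cutoff_le_one R Λ s x
      calc _ ≤ 1 * P := mul_le_mul h2 h1 (Real.exp_pos _).le zero_le_one
        _ = P := one_mul P
    · intro s hs
      simp [cutoff_boundary R hΛ0 hs.1]
    · intro j hj s hs x
      have hs' := Ioo_subset_Icc_self hs
      refine (hW.weight_le hs x (hΛ _ (hmem s hs' x)).2).trans ?_
      refine mul_le_mul_of_nonneg_right (mul_le_mul_of_nonneg_right ?_ (hq0 s hs' x))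
        (mul_nonneg (cutoff_nonneg _ _ _ _) (Real.exp_pos _).le)
      have h1 : 8 * |a| + 2 * |2 * (1 - κ)| + 1 ≤ 2 * M * (κ * W s x + c₀) := by
        have h2 := mul_le_mul_of_nonneg_left (hc _ (hmem s hs' x)) hM0
        have h3 : M * (2 * cm) = 8 * |a| + 2 * |2 * (1 - κ)| + 1 := by
          rw [hM]; field_simp
        linarith
      have h4 := neg_abs_le (2 * (1 - κ))
      have h5 := neg_abs_le a
      have h6 := le_abs_self a
      have hj0 : (0 : ℝ) ≤ j := j.cast_nonneg
      have hj3 : (j : ℝ) ≤ 3 := by exact_mod_cast hj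
      have h7 : -(3 * |a|) ≤ j * a := by
        have := mul_le_mul_of_nonneg_left h5 hj0
        have := mul_le_mul_of_nonneg_right hj3 (abs_nonneg a)
        linarith
      linarith
    · intro j _
      simp [dX_iterate_zero]
  have hlow : ∀ s ∈ Icc 0 T, ∀ x, p ≤ Real.exp (M * W s x) := fun s hs x =>
    Real.exp_le_exp.2 (mul_le_mul_of_nonneg_left (hmem s hs x).1 hM0)
  have D₂ : TransportData 1 0 1 a Cq 1 (2 * B * T) (p⁻¹ * C₁) T t R δ |F| F W V₂
      V₁ (cutoff R Λ) := by
    refine ⟨hT, ht, hR0, hδ, le_rfl, hW.smooth, hV.smooth₂, hV.smooth₁,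
      hcut, hq0, hqb, ?_, hV.initial₂, ?_, ?_, ?_, ?_, hW.integral_dX_le hB.le hT ht hR0, ?_⟩
    · intro s hs x
      have := hV.second s hs x
      rw [ha]
      linarith
    · exact fun s _ x => cutoff_nonneg _ _ _ _
    · exact fun s _ x => cutoff_le_one _ _ _ _
    · exact fun s hs => cutoff_boundary R hΛ0 hs.1
    · intro j _ s hs x
      have hs' := Ioo_subset_Icc_self hs
      -- For the speed `W` no exponential is needed: the divergence `W_x` is at most the required
      -- `(1 + 2 j) W_x`.
      have h1 := hW.weight_le (κ := 0) (c₀ := 0) (M := 0) (R := R) hs x (Λ := Λ)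
        (by simpa [eig1] using (hΛ _ (hmem s hs' x)).1)
      simp only [mul_zero, zero_mul, sub_zero, add_zero, Real.exp_zero, mul_one, one_mul] at h1 ⊢
      refine h1.trans ?_
      have h2 := mul_nonneg (hq0 s hs' x) (cutoff_nonneg R Λ s x)
      have hj0 : (0 : ℝ) ≤ j := j.cast_nonneg
      have := mul_nonneg hj0 h2
      linarith
    · intro j hj
      have h1 := (H₁ D₁ j hj).2
      have c1 : ContinuousOn (fun z : ℝ × ℝ => cutoff R Λ z.1 z.2 * dX W z.1 z.2
          * dX^[j] V₁ z.1 z.2 ^ 2) (Icc 0 T ×ˢ univ) :=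
        ((hcut.mul (hW.smooth.dX hT)).continuousOn).mul
          ((hV.smooth₁.dX_iterate hT j).continuousOn.pow 2)
      have c2 : ContinuousOn (fun z : ℝ × ℝ => cutoff R Λ z.1 z.2 * Real.exp (M * W z.1 z.2)
          * dX W z.1 z.2 * dX^[j] V₁ z.1 z.2 ^ 2) (Icc 0 T ×ˢ univ) :=
        (((hcut.mul hexp).mul (hW.smooth.dX hT)).continuousOn).mul
          ((hV.smooth₁.dX_iterate hT j).continuousOn.pow 2)
      rw [mul_assoc, le_inv_mul_iff₀ hp0]
      refine le_trans ?_ h1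
      rw [← integral_const_mul]
      refine setIntegral_mono_on ((integrableOn_rect ht c1).const_mul p)
        (integrableOn_rect ht c2) (measurableSet_rect t R) fun z hz => ?_
      have hz' := (rect_subset ht hz).1
      have h3 := mul_le_mul_of_nonneg_right (hlow _ hz' z.2)
        (mul_nonneg (mul_nonneg (cutoff_nonneg R Λ z.1 z.2) (hq0 _ hz' z.2))
          (sq_nonneg (dX^[j] V₁ z.1 z.2)))
      linarith
  have hone : ∀ x ∈ Icc (-n) n, cutoff R Λ t x = 1 := fun x hx => by
    refine cutoff_eq_one ((abs_le.2 hx).trans ?_)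
    have := mul_le_mul_of_nonneg_left ht.2 hΛ0
    linarith
  have hX : 0 ≤ (|F| * δ⁻¹ ^ (k + 1)) ^ 2 := sq_nonneg _
  have r₁ := integral_sq_le_of_weight hn (by linarith : n ≤ R)
    ((hcut.mul hexp).slice ht).continuous ((hV.smooth₁.dX_iterate hT k).slice ht).continuous
    (fun x => D₁.Φ_nonneg t ht x) hp0 (fun x hx => by
      simp only [hone x hx, one_mul]
      exact hlow t ht x) (H₁ D₁ k hk).1
  have r₂ := integral_sq_le_of_weight hn (by linarith : n ≤ R)
    (hcut.slice ht).continuous ((hV.smooth₂.dX_iterate hT k).slice ht).continuous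
    (fun x => D₂.Φ_nonneg t ht x) one_pos (fun x hx => (hone x hx).ge) (H₂ D₂ k hk).1
  have n1 := mul_nonneg hC₂ hX
  have n2 := mul_nonneg (mul_nonneg (inv_pos.2 hp0).le hC₁) hX
  constructor
  · linarith
  · rw [inv_one, one_mul] at r₂
    linarith

/-! ### Scaled Sobolev bounds on the line -/

/-- `f` is smooth and its derivatives up to order three satisfy
`‖f⁽ᵏ⁾‖² ≤ C (η D ^ (k + 1))²` in `L²`. -/
structure ScaledBound (C η D : ℝ) (f : ℝ → ℝ) : Prop where
  smooth : ContDiff ℝ ∞ f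
  bound : ∀ k ≤ 3, ∀ n, 0 ≤ n → ∫ x in -n..n, iteratedDeriv k f x ^ 2 ≤ C * (η * D ^ (k + 1)) ^ 2

theorem continuous_iteratedDeriv' {f : ℝ → ℝ} (hf : ContDiff ℝ ∞ f) (k : ℕ) :
    Continuous (iteratedDeriv k f) :=
  hf.continuous_iteratedDeriv k (by exact_mod_cast le_top)

/-- The square of a sum of terms `b i * y i` with `|b i| ≤ G D ^ (k - m i)` and scaled bounds
for `y i`. -/
theorem integral_sum_sq_le {ι : Type*} (s : Finset ι) {b y : ι → ℝ → ℝ} {m : ι → ℕ} {k : ℕ}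
    {G C η D n : ℝ} (hn : 0 ≤ n) (hb : ∀ i ∈ s, ∀ x, |b i x| ≤ G * D ^ (k - m i))
    (hbc : ∀ i ∈ s, Continuous (b i)) (hyc : ∀ i ∈ s, Continuous (y i)) (hm : ∀ i ∈ s, m i ≤ k)
    (hy : ∀ i ∈ s, ∫ x in -n..n, y i x ^ 2 ≤ C * (η * D ^ (m i + 1)) ^ 2) :
    ∫ x in -n..n, (∑ i ∈ s, b i x * y i x) ^ 2
      ≤ (s.card : ℝ) ^ 2 * G ^ 2 * C * (η * D ^ (k + 1)) ^ 2 := by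
  have hc : Continuous fun x => (∑ i ∈ s, b i x * y i x) ^ 2 :=
    (continuous_finsetSum s fun i hi => (hbc i hi).mul (hyc i hi)).pow 2
  have hci : ∀ i ∈ s, Continuous fun x => (G * D ^ (k - m i)) ^ 2 * y i x ^ 2 := fun i hi =>
    continuous_const.mul ((hyc i hi).pow 2)
  calc ∫ x in -n..n, (∑ i ∈ s, b i x * y i x) ^ 2
      ≤ ∫ x in -n..n, s.card * ∑ i ∈ s, (G * D ^ (k - m i)) ^ 2 * y i x ^ 2 := by
        refine intervalIntegral.integral_mono_on (by linarith) (hc.intervalIntegrable _ _)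
          ((continuous_const.mul (continuous_finsetSum s hci)).intervalIntegrable _ _)
          fun x _ => ?_
        refine (sq_sum_le_card_mul_sum_sq (s := s) (f := fun i => b i x * y i x)).trans ?_
        refine mul_le_mul_of_nonneg_left (Finset.sum_le_sum fun i hi => ?_) (Nat.cast_nonneg _)
        rw [mul_pow, ← sq_abs (b i x)]
        exact mul_le_mul_of_nonneg_right (pow_le_pow_left₀ (abs_nonneg _) (hb i hi x) 2)
          (sq_nonneg _)
    _ = s.card * ∑ i ∈ s, (G * D ^ (k - m i)) ^ 2 * ∫ x in -n..n, y i x ^ 2 := by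
        rw [intervalIntegral.integral_const_mul, intervalIntegral.integral_finsetSum
          fun i hi => (hci i hi).intervalIntegrable _ _]
        congr 1
        exact Finset.sum_congr rfl fun i _ => intervalIntegral.integral_const_mul _ _
    _ ≤ s.card * ∑ i ∈ s, G ^ 2 * C * (η * D ^ (k + 1)) ^ 2 := by
        refine mul_le_mul_of_nonneg_left (Finset.sum_le_sum fun i hi => ?_) (Nat.cast_nonneg _)
        refine (mul_le_mul_of_nonneg_left (hy i hi) (sq_nonneg _)).trans (le_of_eq ?_)
        have : D ^ (k + 1) = D ^ (k - m i) * D ^ (m i + 1) := by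
          rw [← pow_add]; congr 1; have := hm i hi; omega
        rw [this]; ring
    _ = _ := by rw [Finset.sum_const, nsmul_eq_mul]; ring

namespace ScaledBound

variable {C C' η D G : ℝ} {f g h : ℝ → ℝ}

theorem add (hf : ScaledBound C η D f) (hh : ScaledBound C η D h) :
    ScaledBound (4 * C) η D (fun x => f x + h x) := by
  refine ⟨hf.smooth.add hh.smooth, fun k hk n hn => ?_⟩
  have cf := continuous_iteratedDeriv' hf.smooth k
  have ch := continuous_iteratedDeriv' hh.smooth k
  have e : ∀ x, iteratedDeriv k (fun x => f x + h x) x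
      = iteratedDeriv k f x + iteratedDeriv k h x := fun x =>
    iteratedDeriv_fun_add ((hf.smooth.of_le (by exact_mod_cast le_top)).contDiffAt)
      ((hh.smooth.of_le (by exact_mod_cast le_top)).contDiffAt)
  simp only [e]
  calc ∫ x in -n..n, (iteratedDeriv k f x + iteratedDeriv k h x) ^ 2
      ≤ ∫ x in -n..n, (2 * iteratedDeriv k f x ^ 2 + 2 * iteratedDeriv k h x ^ 2) := by
        refine intervalIntegral.integral_mono_on (by linarith)
          (Continuous.intervalIntegrable (by fun_prop) _ _)
          (Continuous.intervalIntegrable (by fun_prop) _ _) fun x _ => ?_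
        linarith [sq_nonneg (iteratedDeriv k f x - iteratedDeriv k h x)]
    _ = 2 * (∫ x in -n..n, iteratedDeriv k f x ^ 2) + 2 * ∫ x in -n..n, iteratedDeriv k h x ^ 2 := by
        rw [intervalIntegral.integral_add (Continuous.intervalIntegrable (by fun_prop) _ _)
          (Continuous.intervalIntegrable (by fun_prop) _ _), intervalIntegral.integral_const_mul,
          intervalIntegral.integral_const_mul]
    _ ≤ _ := by linarith [hf.bound k hk n hn, hh.bound k hk n hn]

theorem leibniz (hg : ContDiff ℝ ∞ g) (hf : ContDiff ℝ ∞ f) (k : ℕ) (x : ℝ) :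
    iteratedDeriv k (fun x => g x * f x) x = ∑ i ∈ Finset.range (k + 1),
      (k.choose i * iteratedDeriv i g x) * iteratedDeriv (k - i) f x :=
  iteratedDeriv_fun_mul ((hg.of_le (by exact_mod_cast le_top)).contDiffAt)
    ((hf.of_le (by exact_mod_cast le_top)).contDiffAt)

theorem choose_mul_le
    (hgb : ∀ j ≤ 3, ∀ x, |iteratedDeriv j g x| ≤ G * D ^ j) {k i : ℕ} (hk : k ≤ 3) (hi : i ≤ k)
    (x : ℝ) : |k.choose i * iteratedDeriv i g x| ≤ 8 * G * D ^ i := by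
  have h1 : ((k.choose i : ℕ) : ℝ) ≤ 8 := by
    have h2 : k.choose i ≤ 2 ^ k := Nat.choose_le_two_pow k i
    have h3 : 2 ^ k ≤ 2 ^ 3 := Nat.pow_le_pow_right (by norm_num) hk
    exact_mod_cast h2.trans h3
  rw [abs_mul, abs_of_nonneg (Nat.cast_nonneg _), mul_assoc]
  exact mul_le_mul h1 (hgb i (hi.trans hk) x) (abs_nonneg _) (by norm_num)

theorem mul (hC : 0 ≤ C) (hg : ContDiff ℝ ∞ g)
    (hgb : ∀ j ≤ 3, ∀ x, |iteratedDeriv j g x| ≤ G * D ^ j) (hf : ScaledBound C η D f) :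
    ScaledBound (16 * (8 * G) ^ 2 * C) η D (fun x => g x * f x) := by
  refine ⟨hg.mul hf.smooth, fun k hk n hn => ?_⟩
  simp only [leibniz hg hf.smooth]
  refine (integral_sum_sq_le (Finset.range (k + 1)) (m := fun i => k - i) (k := k) (G := 8 * G)
    (C := C) (η := η) (D := D) hn (fun i hi x => ?_) (fun i _ => ?_) (fun i _ => ?_)
    (fun i _ => Nat.sub_le k i) (fun i _ => ?_)).trans ?_
  · have hi' := Nat.lt_succ_iff.1 (Finset.mem_range.1 hi)
    rw [Nat.sub_sub_self hi']
    exact choose_mul_le hgb hk hi' x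
  · exact continuous_const.mul (continuous_iteratedDeriv' hg i)
  · exact continuous_iteratedDeriv' hf.smooth _
  · exact hf.bound _ ((Nat.sub_le k i).trans hk) n hn
  · rw [Finset.card_range]
    have hc : ((k + 1 : ℕ) : ℝ) ≤ 4 := by exact_mod_cast (by omega : k + 1 ≤ 4)
    have h16 : ((k + 1 : ℕ) : ℝ) ^ 2 ≤ 16 := by
      nlinarith [Nat.cast_nonneg (α := ℝ) (k + 1)]
    gcongr

/-- Instead of differentiating a quotient, the Leibniz formula for `g f` is solved for its term `g
f⁽ᵏ⁾`; the others involve lower derivatives of `f`, bounded by induction. The bound `g ≥ c` is used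
only at this last term. -/
theorem exists_div {c : ℝ} (hc : 0 < c) (G : ℝ) (hC : 0 ≤ C) :
    ∃ C', 0 ≤ C' ∧ ∀ {η D : ℝ} {f g : ℝ → ℝ}, ContDiff ℝ ∞ g →
      (∀ j ≤ 3, ∀ x, |iteratedDeriv j g x| ≤ G * D ^ j) → (∀ x, c ≤ g x) → ContDiff ℝ ∞ f →
      ScaledBound C η D (fun x => g x * f x) → ScaledBound C' η D f := by
  suffices H : ∀ N ≤ 4, ∃ C', 0 ≤ C' ∧ ∀ {η D : ℝ} {f g : ℝ → ℝ}, ContDiff ℝ ∞ g →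
      (∀ j ≤ 3, ∀ x, |iteratedDeriv j g x| ≤ G * D ^ j) → (∀ x, c ≤ g x) → ContDiff ℝ ∞ f →
      ScaledBound C η D (fun x => g x * f x) → ∀ k < N, ∀ n, 0 ≤ n →
        ∫ x in -n..n, iteratedDeriv k f x ^ 2 ≤ C' * (η * D ^ (k + 1)) ^ 2 by
    obtain ⟨C', hC', h⟩ := H 4 le_rfl
    exact ⟨C', hC', fun hg hgb hgc hf hgf =>
      ⟨hf, fun k hk n hn => h hg hgb hgc hf hgf k (by omega) n hn⟩⟩
  intro N
  induction N with
  | zero => exact fun _ => ⟨0, le_rfl, fun _ _ _ _ _ k hk => absurd hk (Nat.not_lt_zero k)⟩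
  | succ N ih =>
    intro hN
    obtain ⟨C', hC', h⟩ := ih (by omega)
    set A := (c ^ 2)⁻¹ * (2 * C + 2 * (9 * (8 * G) ^ 2 * C')) with hA
    have hA0 : 0 ≤ A := by positivity
    refine ⟨C' + A, by positivity, fun {η D f g} hg hgb hgc hf hgf k hk n hn => ?_⟩
    have hX : 0 ≤ (η * D ^ (k + 1)) ^ 2 := sq_nonneg _
    have n1 := mul_nonneg hC' hX
    have n2 := mul_nonneg hA0 hX
    rcases Nat.lt_succ_iff_lt_or_eq.1 hk with hlt | rfl
    · have := h hg hgb hgc hf hgf k hlt n hn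
      linarith
    · have hk3 : k ≤ 3 := by omega
      set S : ℝ → ℝ := fun x => ∑ i ∈ Finset.range k,
        (k.choose (i + 1) * iteratedDeriv (i + 1) g x) * iteratedDeriv (k - (i + 1)) f x with hS
      have hSc : Continuous S := continuous_finsetSum _ fun i _ =>
        (continuous_const.mul (continuous_iteratedDeriv' hg _)).mul (continuous_iteratedDeriv' hf _)
      have eS : ∀ x, g x * iteratedDeriv k f x = iteratedDeriv k (fun x => g x * f x) x - S x := by
        intro x
        rw [leibniz hg hf, Finset.sum_range_succ']
        simp [hS]
      have bS : ∫ x in -n..n, S x ^ 2 ≤ 9 * (8 * G) ^ 2 * C' * (η * D ^ (k + 1)) ^ 2 := by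
        refine (integral_sum_sq_le (Finset.range k) (m := fun i => k - (i + 1)) (k := k)
          (G := 8 * G) (C := C') (η := η) (D := D) hn (fun i hi x => ?_) (fun i _ => ?_)
          (fun i _ => ?_) (fun i _ => Nat.sub_le _ _) (fun i hi => ?_)).trans ?_
        · have hi' := Finset.mem_range.1 hi
          rw [Nat.sub_sub_self (Nat.succ_le_of_lt hi')]
          exact choose_mul_le hgb hk3 (Nat.succ_le_of_lt hi') x
        · exact continuous_const.mul (continuous_iteratedDeriv' hg _)
        · exact continuous_iteratedDeriv' hf _
        · have hi' := Finset.mem_range.1 hi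
          exact h hg hgb hgc hf hgf _ (by omega) n hn
        · rw [Finset.card_range]
          have hc : (k : ℝ) ≤ 3 := by exact_mod_cast hk3
          have h9 : (k : ℝ) ^ 2 ≤ 9 := by nlinarith [Nat.cast_nonneg (α := ℝ) k]
          gcongr
      have ch := continuous_iteratedDeriv' hgf.smooth k
      have cf := continuous_iteratedDeriv' hf k
      have key : ∫ x in -n..n, c ^ 2 * iteratedDeriv k f x ^ 2
          ≤ ∫ x in -n..n, (2 * iteratedDeriv k (fun x => g x * f x) x ^ 2 + 2 * S x ^ 2) := by
        refine intervalIntegral.integral_mono_on (by linarith)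
          (Continuous.intervalIntegrable (by fun_prop) _ _)
          (Continuous.intervalIntegrable (by fun_prop) _ _) fun x _ => ?_
        have h1 : c ^ 2 ≤ g x ^ 2 := pow_le_pow_left₀ hc.le (hgc x) 2
        have h2 := mul_le_mul_of_nonneg_right h1 (sq_nonneg (iteratedDeriv k f x))
        have h3 : g x ^ 2 * iteratedDeriv k f x ^ 2
            = (iteratedDeriv k (fun x => g x * f x) x - S x) ^ 2 := by
          rw [← mul_pow, eS]
        linarith [sq_nonneg (iteratedDeriv k (fun x => g x * f x) x + S x)]
      rw [intervalIntegral.integral_const_mul,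
        intervalIntegral.integral_add (Continuous.intervalIntegrable (by fun_prop) _ _)
          (Continuous.intervalIntegrable (by fun_prop) _ _), intervalIntegral.integral_const_mul,
          intervalIntegral.integral_const_mul] at key
      have hb := hgf.bound k hk3 n hn
      have h4 : ∫ x in -n..n, iteratedDeriv k f x ^ 2 ≤ A * (η * D ^ (k + 1)) ^ 2 := by
        rw [hA, mul_assoc, le_inv_mul_iff₀ (by positivity)]
        linarith
      linarith

/-- The one-dimensional Sobolev inequality. -/
theorem sq_le (hD : 0 < D) (hf : ScaledBound C η D f) (x : ℝ) :
    f x ^ 2 ≤ 2 * C * η ^ 2 * D ^ 3 := by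
  set E := 2 * C * η ^ 2 * D ^ 3 with hE
  have cf := hf.smooth.continuous
  have cf' : Continuous (deriv f) := by
    have := continuous_iteratedDeriv' hf.smooth 1
    rwa [iteratedDeriv_one] at this
  have b0 : ∀ n, 0 ≤ n → ∫ x in -n..n, f x ^ 2 ≤ C * (η * D) ^ 2 := fun n hn => by
    simpa using hf.bound 0 (by norm_num) n hn
  have b1 : ∀ n, 0 ≤ n → ∫ x in -n..n, deriv f x ^ 2 ≤ C * (η * D ^ 2) ^ 2 := fun n hn => by
    simpa [iteratedDeriv_one] using hf.bound 1 (by norm_num) n hn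
  -- The loss of `f²` from `x` to `y` is at most `∫ 2 |f f'| ≤ D ∫ f² + D⁻¹ ∫ f'²`; this choice of
  -- weights makes both terms `C η² D³`.
  have hle : ∀ y, x ≤ y → f x ^ 2 - E ≤ f y ^ 2 := by
    intro y hxy
    have hd : ∀ z ∈ uIcc x y, HasDerivAt (fun z => f z ^ 2) (2 * f z * deriv f z) z := fun z _ => by
      have := ((hf.smooth.differentiable (by simp) z).hasDerivAt).fun_pow 2
      simpa using this
    have hftc := intervalIntegral.integral_eq_sub_of_hasDerivAt hd
      (Continuous.intervalIntegrable (by fun_prop) _ _)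
    set n := |x| + |y| with hn
    have hn0 : 0 ≤ n := by positivity
    have hx : -n ≤ x := by linarith [neg_abs_le x, abs_nonneg y]
    have hy : y ≤ n := by linarith [le_abs_self y, abs_nonneg x]
    have h1 : ∫ z in x..y, -(2 * f z * deriv f z)
        ≤ ∫ z in x..y, (D * f z ^ 2 + D⁻¹ * deriv f z ^ 2) := by
      refine intervalIntegral.integral_mono_on hxy (Continuous.intervalIntegrable (by fun_prop) _ _)
        (Continuous.intervalIntegrable (by fun_prop) _ _) fun z _ => ?_
      have h2 : 0 ≤ D⁻¹ * (D * f z + deriv f z) ^ 2 := by positivity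
      have h3 : D⁻¹ * (D * f z + deriv f z) ^ 2
          = D * f z ^ 2 + 2 * f z * deriv f z + D⁻¹ * deriv f z ^ 2 := by
        field_simp
        ring
      linarith
    have h4 : ∫ z in x..y, (D * f z ^ 2 + D⁻¹ * deriv f z ^ 2)
        ≤ ∫ z in -n..n, (D * f z ^ 2 + D⁻¹ * deriv f z ^ 2) :=
      intervalIntegral.integral_mono_interval hx hxy hy
        (Filter.Eventually.of_forall fun z => by positivity)
        (Continuous.intervalIntegrable (by fun_prop) _ _)
    rw [intervalIntegral.integral_neg, hftc] at h1
    replace h4 := h1.trans h4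
    rw [intervalIntegral.integral_add (Continuous.intervalIntegrable (by fun_prop) _ _)
          (Continuous.intervalIntegrable (by fun_prop) _ _), intervalIntegral.integral_const_mul,
          intervalIntegral.integral_const_mul] at h4
    have h5 := mul_le_mul_of_nonneg_left (b0 n hn0) hD.le
    have h6 := mul_le_mul_of_nonneg_left (b1 n hn0) (inv_pos.2 hD).le
    have h7 : D * (C * (η * D) ^ 2) + D⁻¹ * (C * (η * D ^ 2) ^ 2) = E := by
      rw [hE]
      field_simp
      ring
    linarith
  -- Otherwise `f²` stays above a positive constant to the right of `x`, and a long enough interval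
  -- violates the `L²` bound.
  by_contra! hlt
  set r := f x ^ 2 - E with hr
  have hr0 : 0 < r := by linarith
  set P := C * (η * D) ^ 2 with hP
  set L := (|P| + 1) / r with hL
  have hL0 : 0 < L := by positivity
  have h1 : ∫ z in x..(x + L), r ≤ ∫ z in x..(x + L), f z ^ 2 :=
    intervalIntegral.integral_mono_on (by linarith) (by simp)
      (Continuous.intervalIntegrable (by fun_prop) _ _) fun z hz => hle z hz.1
  set n := |x| + |x + L| with hn
  have hx : -n ≤ x := by linarith [neg_abs_le x, abs_nonneg (x + L)]
  have hy : x + L ≤ n := by linarith [le_abs_self (x + L), abs_nonneg x]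
  have h2 : ∫ z in x..(x + L), f z ^ 2 ≤ ∫ z in -n..n, f z ^ 2 :=
    intervalIntegral.integral_mono_interval hx (by linarith) hy
      (Filter.Eventually.of_forall fun z => sq_nonneg _)
      (Continuous.intervalIntegrable (by fun_prop) _ _)
  have h3 := b0 n (by positivity)
  rw [intervalIntegral.integral_const, smul_eq_mul] at h1
  have h4 : (x + L - x) * r = |P| + 1 := by
    rw [hL]; field_simp; ring
  linarith [le_abs_self P]

end ScaledBound

/-! ### From bounded intervals to norms on the line -/

theorem lintegral_le_of_forall_interval {φ : ℝ → ℝ} (hφ : Continuous φ) (h0 : ∀ x, 0 ≤ φ x) {X : ℝ}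
    (h : ∀ n, 0 ≤ n → ∫ x in -n..n, φ x ≤ X) : ∫⁻ x, ENNReal.ofReal (φ x) ≤ ENNReal.ofReal X := by
  have hcov : AECover volume Filter.atTop fun n : ℕ => Icc (-(n : ℝ)) n :=
    aecover_Icc (Filter.tendsto_neg_atTop_atBot.comp tendsto_natCast_atTop_atTop)
      tendsto_natCast_atTop_atTop
  refine le_of_tendsto' (hcov.lintegral_tendsto_of_countably_generated
    (hφ.measurable.ennreal_ofReal.aemeasurable)) fun n => ?_
  rw [← ofReal_integral_eq_lintegral_ofReal (hφ.integrableOn_Icc) (Filter.Eventually.of_forall h0)]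
  refine ENNReal.ofReal_le_ofReal ?_
  have hn : (0 : ℝ) ≤ n := n.cast_nonneg
  rw [integral_Icc_eq_integral_Ioc, ← intervalIntegral.integral_of_le (by linarith)]
  exact h n hn

theorem norm_pairFun_sq (f g : ℝ → ℝ) (x : ℝ) : ‖pairFun f g x‖ ^ 2 = f x ^ 2 + g x ^ 2 := by
  rw [EuclideanSpace.norm_sq_eq]
  simp [pairFun, Fin.sum_univ_two]

theorem eLpNorm_pairFun_sq_le {f g : ℝ → ℝ} (hf : Continuous f) (hg : Continuous g) {X Y : ℝ}
    (hX : ∀ n, 0 ≤ n → ∫ x in -n..n, f x ^ 2 ≤ X) (hY : ∀ n, 0 ≤ n → ∫ x in -n..n, g x ^ 2 ≤ Y) :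
    eLpNorm (pairFun f g) 2 volume ^ 2 ≤ ENNReal.ofReal (X + Y) := by
  have e : eLpNorm (pairFun f g) 2 volume ^ 2 = ∫⁻ x, ENNReal.ofReal (f x ^ 2 + g x ^ 2) := by
    rw [eLpNorm_eq_lintegral_rpow_enorm_toReal (by norm_num) (by norm_num), ← ENNReal.rpow_natCast,
      ← ENNReal.rpow_mul]
    norm_num
    refine lintegral_congr fun x => ?_
    rw [← norm_pairFun_sq, ENNReal.ofReal_pow (norm_nonneg _), ofReal_norm]
  rw [e]
  refine lintegral_le_of_forall_interval (by fun_prop) (fun x => by positivity) fun n hn => ?_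
  rw [intervalIntegral.integral_add (Continuous.intervalIntegrable (by fun_prop) _ _)
    (Continuous.intervalIntegrable (by fun_prop) _ _)]
  exact add_le_add (hX n hn) (hY n hn)

theorem eLpNorm_top_pairFun_le {f g : ℝ → ℝ} {X : ℝ} (hX : 0 ≤ X)
    (h : ∀ x, f x ^ 2 + g x ^ 2 ≤ X ^ 2) :
    eLpNorm (pairFun f g) ⊤ volume ≤ ENNReal.ofReal X := by
  rw [eLpNorm_exponent_top]
  refine eLpNormEssSup_le_of_ae_bound (Filter.Eventually.of_forall fun x => ?_)
  refine le_of_sq_le_sq ?_ hX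
  rw [norm_pairFun_sq]
  exact h x

/-- Here `d₁ = (V₁ + V₂) / (2 c)` and `d₂ = V₂ + (W - 2 c) d₁`. Both coefficients are affine in `W`,
so their `j`-th derivatives have size `δ⁻ʲ` and the scaling is preserved. -/
theorem IsReducedWave.exists_bound {κ c₀ T τ₀ A B cm : ℝ} (hT : 0 < T) (hτ : 0 ≤ τ₀)
    (hB : 0 < B) (hcm : 0 < cm) (hc : ∀ w ∈ Icc (A - B) (A + B), cm ≤ κ * w + c₀) :
    ∃ C, 0 ≤ C ∧ ∀ {δ F : ℝ} {W d₁ d₂ : ℝ → ℝ → ℝ}, 0 < δ → IsWave T τ₀ A B δ W →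
      IsReducedWave κ c₀ F T W d₁ d₂ → ∀ t ∈ Icc 0 T,
        ScaledBound C |F| δ⁻¹ (d₁ t) ∧ ScaledBound C |F| δ⁻¹ (d₂ t) := by
  obtain ⟨C₀, hC₀, H⟩ := IsTransportPair.exists_bound hT hτ hB hcm hc
  obtain ⟨Cq, hCq, hq⟩ := ProfileRel.exists_bound 4
  have affine : ∀ p r : ℝ, ∃ G, ∀ {δ : ℝ} {W : ℝ → ℝ → ℝ}, 0 < δ → IsWave T τ₀ A B δ W →
      ∀ t ∈ Icc 0 T, ∀ j ≤ 3, ∀ x, |iteratedDeriv j (fun x => p * W t x + r) x| ≤ G * δ⁻¹ ^ j := by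
    intro p r
    refine ⟨|p| * (|A| + B) + |r| + |p| * (Cq * B),
      fun {δ W} hδ hW t ht j hj x => ?_⟩
    have hD : 0 < δ⁻¹ := inv_pos.2 hδ
    have n1 : 0 ≤ |p| * (|A| + B) + |r| := by positivity
    have n2 : 0 ≤ |p| * (Cq * B) := by positivity
    rcases j with _ | j
    · simp only [iteratedDeriv_zero, pow_zero, mul_one]
      have hw := hW.mem_Icc hB.le ht x
      have h1 : |W t x| ≤ |A| + B := by
        rw [abs_le]
        constructor <;> linarith [hw.1, hw.2, neg_abs_le A, le_abs_self A]
      calc |p * W t x + r| ≤ |p * W t x| + |r| := abs_add_le _ _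
        _ = |p| * |W t x| + |r| := by rw [abs_mul]
        _ ≤ |p| * (|A| + B) + |r| := by gcongr
        _ ≤ _ := by linarith
    · have hd : deriv (fun x => p * W t x + r) = fun x => p * dX W t x := by
        ext y
        exact (((hW.smooth.hasDerivAt_dX ht y).const_mul p).add_const r).deriv
      rw [iteratedDeriv_succ', hd, iteratedDeriv_const_mul_field, ← dX_iterate, abs_mul]
      have h1 := hW.abs_dX_iterate_le hq hB hδ hτ hT ht (by omega : j ≤ 4) x
      have h2 := hW.dX_le hB hδ hτ hT ht x
      calc |p| * |dX^[j] (dX W) t x| ≤ |p| * (Cq * δ⁻¹ ^ j * (B * δ⁻¹)) := by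
            gcongr
            refine h1.trans ?_
            gcongr
        _ = |p| * (Cq * B) * δ⁻¹ ^ (j + 1) := by ring
        _ ≤ _ := by
            gcongr
            linarith
  obtain ⟨G₁, A₁⟩ := affine (2 * κ) (2 * c₀)
  obtain ⟨G₂, A₂⟩ := affine (1 - 2 * κ) (-2 * c₀)
  obtain ⟨C₁, hC₁, H₁⟩ := ScaledBound.exists_div (C := 4 * C₀) (c := 2 * cm)
    (by positivity) G₁ (by positivity)
  set C₂ := max C₀ (16 * (8 * G₂) ^ 2 * C₁) with hC₂
  have mono : ∀ {C C' η D : ℝ} {f : ℝ → ℝ}, C ≤ C' → ScaledBound C η D f → ScaledBound C' η D f :=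
    fun h hf => ⟨hf.smooth, fun k hk n hn => (hf.bound k hk n hn).trans
      (mul_le_mul_of_nonneg_right h (sq_nonneg _))⟩
  refine ⟨max C₁ (4 * C₂), hC₁.trans (le_max_left _ _), fun {δ F W d₁ d₂} hδ hW hd t ht => ?_⟩
  have hV := hd.isTransportPair hW
  have s₁ : ScaledBound C₀ |F| δ⁻¹ (fun x => W t x * d₁ t x - d₂ t x) :=
    ⟨hV.smooth₁.slice ht, fun k hk n hn => by
      have := (H hδ hW hV k hk t ht n hn).1
      rwa [dX_iterate] at this⟩
  have s₂ : ScaledBound C₀ |F| δ⁻¹ (fun x => d₂ t x - eig1 κ c₀ W t x * d₁ t x) :=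
    ⟨hV.smooth₂.slice ht, fun k hk n hn => by
      have := (H hδ hW hV k hk t ht n hn).2
      rwa [dX_iterate] at this⟩
  have hWs := hW.smooth.slice ht
  have r₁ : ScaledBound C₁ |F| δ⁻¹ (d₁ t) := by
    refine H₁ (g := fun x => 2 * κ * W t x + 2 * c₀)
      ((contDiff_const.mul hWs).add contDiff_const) (A₁ hδ hW t ht) (fun x => ?_)
      (hd.smooth₁.slice ht) ?_
    · have := hc _ (hW.mem_Icc hB.le ht x)
      linarith
    · have := s₁.add s₂
      convert this using 2 with x
      rw [eig1]
      ring
  have m₁ := r₁.mul hC₁ (g := fun x => (1 - 2 * κ) * W t x + -2 * c₀)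
    ((contDiff_const.mul hWs).add contDiff_const) (A₂ hδ hW t ht)
  have r₂ : ScaledBound (4 * C₂) |F| δ⁻¹ (d₂ t) := by
    have := (mono (le_max_left _ _) s₂ : ScaledBound C₂ _ _ _).add
      (mono (le_max_right _ _) m₁ : ScaledBound C₂ _ _ _)
    convert this using 2 with x
    rw [eig1]
    ring
  exact ⟨mono (le_max_left _ _) r₁, mono (le_max_right _ _) r₂⟩

/-! ### Smooth primitives and inverses -/

theorem hasFDerivAt_integral_param {E G : Type} [NormedAddCommGroup E] [NormedSpace ℝ E]
    [ProperSpace E] [NormedAddCommGroup G] [NormedSpace ℝ G] {F : E × ℝ → G}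
    (hF : ContDiff ℝ ∞ F) (p : E) :
    HasFDerivAt (fun p => ∫ s in (0 : ℝ)..1, F (p, s))
      (∫ s in (0 : ℝ)..1, (fderiv ℝ F (p, s)).comp (ContinuousLinearMap.inl ℝ E ℝ)) p := by
  have hc' : Continuous fun z : E × ℝ => (fderiv ℝ F z).comp (ContinuousLinearMap.inl ℝ E ℝ) :=
    (hF.continuous_fderiv (by simp)).clm_comp continuous_const
  obtain ⟨C, hC⟩ := ((isCompact_closedBall p 1).prod
    (isCompact_Icc (a := (0 : ℝ)) (b := 1))).exists_bound_of_continuousOn hc'.continuousOn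
  refine intervalIntegral.hasFDerivAt_integral_of_dominated_of_fderiv_le
    (F := fun p s => F (p, s))
    (F' := fun p s => (fderiv ℝ F (p, s)).comp (ContinuousLinearMap.inl ℝ E ℝ))
    (bound := fun _ => C) (Metric.closedBall_mem_nhds p one_pos) ?_ ?_ ?_ ?_ ?_ ?_
  · exact Filter.Eventually.of_forall fun q =>
      (hF.continuous.comp (Continuous.prodMk_right q)).aestronglyMeasurable
  · exact (hF.continuous.comp (Continuous.prodMk_right p)).intervalIntegrable _ _
  · exact (hc'.comp (Continuous.prodMk_right p)).aestronglyMeasurable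
  · refine Filter.Eventually.of_forall fun s hs q hq => hC (q, s) ⟨hq, ?_⟩
    rw [uIoc_of_le zero_le_one] at hs
    exact ⟨hs.1.le, hs.2⟩
  · simp
  · refine Filter.Eventually.of_forall fun s _ q _ => ?_
    have h1 := (hF.differentiable (by simp) (q, s)).hasFDerivAt
    exact h1.comp q (hasFDerivAt_prodMk_left q s)

/-- Induction on `n` with the target space generalised, since the derivative of the integrand takes
values in linear maps. -/
theorem contDiff_integral_param_nat {E : Type} [NormedAddCommGroup E] [NormedSpace ℝ E]
    [ProperSpace E] (n : ℕ) : ∀ {G : Type} [NormedAddCommGroup G] [NormedSpace ℝ G]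
      {F : E × ℝ → G}, ContDiff ℝ ∞ F → ContDiff ℝ n fun p => ∫ s in (0 : ℝ)..1, F (p, s) := by
  induction n with
  | zero =>
    intro G _ _ F hF
    rw [Nat.cast_zero, contDiff_zero]
    exact intervalIntegral.continuous_parametric_intervalIntegral_of_continuous'
      (f := fun p s => F (p, s)) hF.continuous 0 1
  | succ n ih =>
    intro G _ _ F hF
    push_cast
    rw [contDiff_succ_iff_hasFDerivAt]
    refine ⟨_, ih (F := fun z => (fderiv ℝ F z).comp (ContinuousLinearMap.inl ℝ E ℝ)) ?_,
      hasFDerivAt_integral_param hF⟩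
    exact (hF.fderiv_right (m := ∞) (by simp)).clm_comp contDiff_const

/-- The primitive `∫₀ʸ Q (s, z) ds` in the first variable. -/
def primitive (Q : ℝ × ℝ → ℝ) (z : ℝ × ℝ) : ℝ := ∫ s in (0 : ℝ)..z.1, Q (s, z.2)

theorem contDiff_primitive {Q : ℝ × ℝ → ℝ} (hQ : ContDiff ℝ ∞ Q) : ContDiff ℝ ∞ (primitive Q) := by
  -- Rescaling to a fixed interval turns the variable endpoint into a parameter of the integrand.
  have e : primitive Q = fun z => z.1 * ∫ s in (0 : ℝ)..1, Q (z.1 * s, z.2) := by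
    ext z
    have := intervalIntegral.smul_integral_comp_mul_left (a := 0) (b := 1)
      (fun s => Q (s, z.2)) z.1
    rw [smul_eq_mul, mul_zero, mul_one] at this
    exact this.symm
  rw [e]
  refine contDiff_fst.mul (contDiff_infty.2 fun n => ?_)
  exact contDiff_integral_param_nat n (F := fun p : (ℝ × ℝ) × ℝ => Q (p.1.1 * p.2, p.1.2))
    (hQ.comp (by fun_prop))

theorem hasDerivAt_primitive {Q : ℝ × ℝ → ℝ} (hQ : Continuous Q) (y z : ℝ) :
    HasDerivAt (fun y => primitive Q (y, z)) (Q (y, z)) y :=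
  ((show Continuous fun s => Q (s, z) by fun_prop).integral_hasStrictDerivAt 0 y).hasDerivAt

theorem exists_primitive {f : ℝ → ℝ} (hf : ContDiff ℝ ∞ f) :
    ∃ g : ℝ → ℝ, ContDiff ℝ ∞ g ∧ ∀ y, HasDerivAt g (f y) y := by
  have hQ : ContDiff ℝ ∞ fun z : ℝ × ℝ => f z.1 := hf.comp contDiff_fst
  exact ⟨fun y => primitive (fun z => f z.1) (y, 0), (contDiff_primitive hQ).comp (by fun_prop),
    fun y => hasDerivAt_primitive hQ.continuous y 0⟩

/-- The lower bound on the derivative, not mere positivity, makes `f` onto, so the inverse is smooth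
on the whole line. -/
theorem exists_smooth_leftInverse {f f' : ℝ → ℝ} {m : ℝ} (hm : 0 < m) (hf : ContDiff ℝ ∞ f)
    (hd : ∀ y, HasDerivAt f (f' y) y) (hlow : ∀ y, m ≤ f' y) :
    ∃ g : ℝ → ℝ, ContDiff ℝ ∞ g ∧ ∀ y, g (f y) = y := by
  have hpos : ∀ y, 0 < f' y := fun y => hm.trans_le (hlow y)
  have hmono : StrictMono f := strictMono_of_deriv_pos fun y => by
    rw [(hd y).deriv]
    exact hpos y
  have hmono2 : Monotone fun y => f y - m * y := by
    have hd2 : ∀ y, HasDerivAt (fun y => f y - m * y) (f' y - m) y := fun y => by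
      simpa using (hd y).fun_sub ((hasDerivAt_id y).const_mul m)
    refine monotone_of_deriv_nonneg (fun y => (hd2 y).differentiableAt) fun y => ?_
    rw [(hd2 y).deriv]
    exact sub_nonneg.2 (hlow y)
  have hsurj : Function.Surjective f := by
    refine hf.continuous.surjective ?_ ?_
    · refine Filter.tendsto_atTop_mono' _ (f₁ := fun y => m * y + f 0) ?_
        (Filter.tendsto_atTop_add_const_right _ _ (Filter.tendsto_id.const_mul_atTop hm))
      filter_upwards [Filter.eventually_ge_atTop 0] with y hy
      have := hmono2 hy
      simp only [mul_zero, sub_zero] at this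
      linarith
    · refine Filter.tendsto_atBot_mono' _ (f₁ := fun y => m * y + f 0) ?_
        (Filter.tendsto_atBot_add_const_right _ _ (Filter.tendsto_id.const_mul_atBot hm))
      filter_upwards [Filter.eventually_le_atBot 0] with y hy
      have := hmono2 hy
      simp only [mul_zero, sub_zero] at this
      linarith
  set e := (StrictMono.orderIsoOfSurjective f hmono hsurj).toHomeomorph with he
  exact ⟨e.symm, e.contDiff_symm_deriv (fun y => (hpos y).ne') hd hf,
    fun y => e.symm_apply_apply y⟩

theorem hasDerivAt_comp_curve {H : ℝ × ℝ → ℝ} (hH : ContDiff ℝ ∞ H) {a b : ℝ → ℝ} {a' b' s : ℝ}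
    (ha : HasDerivAt a a' s) (hb : HasDerivAt b b' s) :
    HasDerivAt (fun s => H (a s, b s))
      (a' * fderiv ℝ H (a s, b s) (1, 0) + b' * fderiv ℝ H (a s, b s) (0, 1)) s := by
  have h := (hH.differentiable (by simp) (a s, b s)).hasFDerivAt.comp_hasDerivAt s (ha.prodMk hb)
  refine h.congr_deriv ?_
  have e : (a', b') = a' • ((1 : ℝ), (0 : ℝ)) + b' • ((0 : ℝ), (1 : ℝ)) := by simp
  rw [e, map_add, map_smul, map_smul]
  rfl

/-- A smooth function on the line equal to `1 / (1 + s)` for `s ≥ -1 / 2`. -/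
def recip (s : ℝ) : ℝ := Real.smoothTransition (4 * s + 3) / (1 + s)

theorem recip_eq {s : ℝ} (hs : -(1 / 2) ≤ s) : recip s = 1 / (1 + s) := by
  rw [recip, Real.smoothTransition.one_of_one_le (by linarith)]

theorem contDiff_recip : ContDiff ℝ ∞ recip := by
  rw [contDiff_iff_contDiffAt]
  intro s
  -- The numerator vanishes for `s ≤ -3 / 4`, hence near every point where the denominator could be
  -- zero.
  by_cases hs : -1 < s
  · refine ContDiffAt.div ?_ (by fun_prop) (by linarith)
    exact (contDiff_smoothTransition.comp (by fun_prop)).contDiffAt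
  · have h0 : recip =ᶠ[nhds s] fun _ => 0 := by
      filter_upwards [Iio_mem_nhds (by linarith : s < -3 / 4)] with r hr
      have hr' : r < -3 / 4 := hr
      rw [recip, Real.smoothTransition.zero_of_nonpos (by linarith), zero_div]
    exact contDiffAt_const.congr_of_eventuallyEq h0

theorem hasDerivAt_recip {s : ℝ} (hs : 0 ≤ s) : HasDerivAt recip (-recip s ^ 2) s := by
  have h : HasDerivAt (fun s : ℝ => 1 / (1 + s)) (-(1 / (1 + s)) ^ 2) s := by
    have h1 := ((hasDerivAt_id s).const_add 1).inv (by simp; linarith)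
    simp only [one_div]
    refine h1.congr_deriv ?_
    simp [neg_div]
  rw [recip_eq (by linarith)]
  refine h.congr_of_eventuallyEq ?_
  filter_upwards [Ioi_mem_nhds (by linarith : -(1 / 2) < s)] with r hr
  exact recip_eq (le_of_lt hr)

/-! ### Existence of solutions of the diagonal system -/

section Modes

variable {κ c₀ F τ₀ A B δ cm : ℝ}

/-- The solution of the first transport equation in the characteristic coordinates `(τ, y)`. -/
theorem exists_first_mode (F : ℝ) (hτ : 0 ≤ τ₀) (hB : 0 < B) (hδ : 0 < δ) (hcm : 0 < cm)
    (hc : ∀ w ∈ Icc (A - B) (A + B), cm ≤ κ * w + c₀) :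
    ∃ D : ℝ × ℝ → ℝ, ContDiff ℝ ∞ D ∧ (∀ y, D (τ₀, y) = 0) ∧ ∀ τ y,
      (1 + τ * slope B δ y) * fderiv ℝ D (τ, y) (1, 0)
        - 2 * (κ * profile A B δ y + c₀) * fderiv ℝ D (τ, y) (0, 1)
        + 2 * (1 - κ) * slope B δ y * D (τ, y)
      = -F * (-(2 / δ) * Real.tanh (y / δ) * slope B δ y) * recip (τ * slope B δ y) ^ 2 := by
  set c : ℝ → ℝ := fun y => κ * profile A B δ y + c₀ with hcdef
  have hcy : ∀ y, cm ≤ c y := fun y => hc _ (profile_mem_Icc hB.le δ y)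
  have hc0 : ∀ y, 0 < c y := fun y => hcm.trans_le (hcy y)
  have h2c : ∀ y, 2 * c y ≠ 0 := fun y => (mul_pos two_pos (hc0 y)).ne'
  have sc : ContDiff ℝ ∞ c := (contDiff_const.mul (contDiff_profile A B δ)).add contDiff_const
  have s2c : ContDiff ℝ ∞ fun y => 2 * c y := contDiff_const.mul sc
  have ss := contDiff_slope B δ
  have hs0 : ∀ y, 0 ≤ slope B δ y := slope_nonneg hB.le hδ
  -- The 1-characteristics satisfy `dτ/dy = -(1 + τ s) / (2 c)`, with `s` the slope at `y`. With the
  -- integrating factor `exp L` and `N' = exp L / (2 c)`, the quantity `Z = τ exp L + N` is constant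
  -- along them.
  obtain ⟨L, sL, dL⟩ := exists_primitive (f := fun y => slope B δ y / (2 * c y)) (ss.div s2c h2c)
  have sM : ContDiff ℝ ∞ fun y => Real.exp (L y) := Real.contDiff_exp.comp sL
  obtain ⟨N, sN, dN⟩ := exists_primitive (f := fun y => Real.exp (L y) / (2 * c y))
    (sM.div s2c h2c)
  have dM : ∀ y, HasDerivAt (fun y => Real.exp (L y))
      (Real.exp (L y) * (slope B δ y / (2 * c y))) y := fun y => (dL y).exp
  -- `L` is bounded below because `L' ≤ s / (2 cm)` and `s` is the derivative of a profile of
  -- oscillation at most `2 B`. This keeps `N'` away from zero.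
  have hLlow : ∀ y, L 0 - B / cm ≤ L y := by
    intro y
    have hBc : 0 < B / cm := by positivity
    rcases le_total 0 y with hy | hy
    · have hmono : Monotone L := by
        refine monotone_of_deriv_nonneg (fun y => (dL y).differentiableAt) fun y => ?_
        rw [(dL y).deriv]
        exact div_nonneg (hs0 y) (mul_pos two_pos (hc0 y)).le
      linarith [hmono hy]
    · have hd : ∀ y, HasDerivAt (fun y => profile A B δ y / (2 * cm) - L y)
          (slope B δ y / (2 * cm) - slope B δ y / (2 * c y)) y := fun y =>
        ((hasDerivAt_profile A B δ y).div_const (2 * cm)).fun_sub (dL y)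
      have hmono : Monotone fun y => profile A B δ y / (2 * cm) - L y := by
        refine monotone_of_deriv_nonneg (fun y => (hd y).differentiableAt) fun y => ?_
        rw [(hd y).deriv, sub_nonneg]
        exact div_le_div_of_nonneg_left (hs0 y) (by positivity) (by linarith [hcy y])
      have h1 := hmono hy
      have h2 : profile A B δ 0 / (2 * cm) - profile A B δ y / (2 * cm) ≤ B / cm := by
        rw [← sub_div, div_le_div_iff₀ (by positivity) hcm]
        have h3 := (profile_mem_Icc (A := A) hB.le δ 0).2
        have h4 := (profile_mem_Icc (A := A) hB.le δ y).1
        nlinarith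
      simp only at h1
      linarith
  -- `g Z` is the point where the 1-characteristic labelled `Z` meets the initial line `τ = τ₀`.
  obtain ⟨g, sg, hg⟩ : ∃ g : ℝ → ℝ, ContDiff ℝ ∞ g ∧
      ∀ y, g (τ₀ * Real.exp (L y) + N y) = y := by
    set cM := |κ| * (|A| + B) + |c₀| with hcM
    have hccM : ∀ y, c y ≤ cM := by
      intro y
      have hp := profile_mem_Icc (A := A) hB.le δ y
      have h1 : |profile A B δ y| ≤ |A| + B := by
        rw [abs_le]
        constructor <;> linarith [hp.1, hp.2, neg_abs_le A, le_abs_self A]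
      calc c y ≤ |κ * profile A B δ y| + |c₀| := add_le_add (le_abs_self _) (le_abs_self _)
        _ = |κ| * |profile A B δ y| + |c₀| := by rw [abs_mul]
        _ ≤ cM := by rw [hcM]; gcongr
    have hcM0 : 0 < cM := (hc0 0).trans_le (hccM 0)
    refine exists_smooth_leftInverse (f := fun y => τ₀ * Real.exp (L y) + N y)
      (m := Real.exp (L 0 - B / cm) / (2 * cM)) (by positivity)
      ((contDiff_const.mul sM).add sN) (fun y => ((dM y).const_mul τ₀).fun_add (dN y)) fun y => ?_
    have h1 : Real.exp (L 0 - B / cm) / (2 * cM) ≤ Real.exp (L y) / (2 * c y) :=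
      div_le_div₀ (Real.exp_pos _).le (Real.exp_le_exp.2 (hLlow y))
        (mul_pos two_pos (hc0 y)) (by linarith [hccM y])
    have h2 : 0 ≤ τ₀ * (Real.exp (L y) * (slope B δ y / (2 * c y))) :=
      mul_nonneg hτ (mul_nonneg (Real.exp_pos _).le
        (div_nonneg (hs0 y) (mul_pos two_pos (hc0 y)).le))
    linarith
  set s1 : ℝ → ℝ := fun y => -(2 / δ) * Real.tanh (y / δ) * slope B δ y with hs1
  have ss1 : ContDiff ℝ ∞ s1 := (contDiff_const.mul (contDiff_tanh_div δ)).mul ss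
  -- In the coordinates `(y, Z)` the equation is an ODE in `y`; writing `D = exp (2 (1 - κ) L) H`
  -- removes the term of order zero and leaves `H_y = Q`. The quotient inside `recip` is `τ`
  -- expressed through `(y, Z)`.
  set Q : ℝ × ℝ → ℝ := fun z => F * s1 z.1 * Real.exp (-(2 * (1 - κ)) * L z.1)
    * recip ((z.2 - N z.1) / Real.exp (L z.1) * slope B δ z.1) ^ 2 / (2 * c z.1) with hQ
  have sQ : ContDiff ℝ ∞ Q := by
    have f1 : ∀ {φ : ℝ → ℝ}, ContDiff ℝ ∞ φ → ContDiff ℝ ∞ fun z : ℝ × ℝ => φ z.1 := fun hφ =>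
      hφ.comp contDiff_fst
    refine ContDiff.div (((contDiff_const.mul (f1 ss1)).mul
      (Real.contDiff_exp.comp (contDiff_const.mul (f1 sL)))).mul
      ((contDiff_recip.comp ?_).pow 2)) (f1 s2c) fun z => h2c z.1
    exact ((contDiff_snd.sub (f1 sN)).div (f1 sM) fun z => (Real.exp_pos _).ne').mul (f1 ss)
  have sP := contDiff_primitive sQ
  set H : ℝ × ℝ → ℝ := fun z => primitive Q z - primitive Q (g z.2, z.2) with hH
  have sH : ContDiff ℝ ∞ H :=
    sP.sub (sP.comp ((sg.comp contDiff_snd).prodMk contDiff_snd))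
  have dH : ∀ y z, fderiv ℝ H (y, z) (1, 0) = Q (y, z) := by
    intro y z
    have h1 := hasDerivAt_comp_curve sH (hasDerivAt_id y) (hasDerivAt_const y z)
    have h2 : HasDerivAt (fun y => H (y, z)) (Q (y, z)) y :=
      (hasDerivAt_primitive sQ.continuous y z).sub_const (primitive Q (g z, z))
    have := h1.unique h2
    simpa using this
  set D : ℝ × ℝ → ℝ := fun z => Real.exp (2 * (1 - κ) * L z.2)
    * H (z.2, z.1 * Real.exp (L z.2) + N z.2) with hD
  have f2 : ∀ {φ : ℝ → ℝ}, ContDiff ℝ ∞ φ → ContDiff ℝ ∞ fun z : ℝ × ℝ => φ z.2 := fun hφ =>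
    hφ.comp contDiff_snd
  have sD : ContDiff ℝ ∞ D := (Real.contDiff_exp.comp (contDiff_const.mul (f2 sL))).mul
    (sH.comp (contDiff_snd.prodMk ((contDiff_fst.mul (f2 sM)).add (f2 sN))))
  refine ⟨D, sD, fun y => by simp [hD, hH, hg], fun τ y => ?_⟩
  set Z := τ * Real.exp (L y) + N y with hZ
  have hτd : fderiv ℝ D (τ, y) (1, 0) = Real.exp (2 * (1 - κ) * L y)
      * (Real.exp (L y) * fderiv ℝ H (y, Z) (0, 1)) := by
    have h1 := hasDerivAt_comp_curve sD (hasDerivAt_id τ) (hasDerivAt_const τ y)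
    have hz : HasDerivAt (fun τ => τ * Real.exp (L y) + N y) (Real.exp (L y)) τ := by
      simpa using ((hasDerivAt_id τ).mul_const (Real.exp (L y))).add_const (N y)
    have h2 := (hasDerivAt_comp_curve sH (hasDerivAt_const τ y) hz).const_mul
      (Real.exp (2 * (1 - κ) * L y))
    have := h1.unique h2
    simpa using this
  have hyd : fderiv ℝ D (τ, y) (0, 1)
      = Real.exp (2 * (1 - κ) * L y) * (2 * (1 - κ) * (slope B δ y / (2 * c y))) * H (y, Z)
        + Real.exp (2 * (1 - κ) * L y) * (Q (y, Z)
          + (τ * (Real.exp (L y) * (slope B δ y / (2 * c y))) + Real.exp (L y) / (2 * c y))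
            * fderiv ℝ H (y, Z) (0, 1)) := by
    have h1 := hasDerivAt_comp_curve sD (hasDerivAt_const y τ) (hasDerivAt_id y)
    have hz := ((dM y).const_mul τ).fun_add (dN y)
    have h2 := (((dL y).const_mul (2 * (1 - κ))).exp).fun_mul
      (hasDerivAt_comp_curve sH (hasDerivAt_id y) hz)
    have := h1.unique h2
    simp only [id, zero_mul, zero_add, one_mul, dH] at this
    exact this
  have hQZ : 2 * c y * (Real.exp (2 * (1 - κ) * L y) * Q (y, Z))
      = F * s1 y * recip (τ * slope B δ y) ^ 2 := by
    have e1 : (Z - N y) / Real.exp (L y) = τ := by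
      rw [hZ, add_sub_cancel_right, mul_div_cancel_right₀ _ (Real.exp_pos _).ne']
    have e2 : Real.exp (2 * (1 - κ) * L y) * Real.exp (-(2 * (1 - κ)) * L y) = 1 := by
      rw [← Real.exp_add, ← Real.exp_zero]
      congr 1
      ring
    simp only [hQ, e1]
    calc _ = (Real.exp (2 * (1 - κ) * L y) * Real.exp (-(2 * (1 - κ)) * L y))
          * (F * s1 y * recip (τ * slope B δ y) ^ 2) * (2 * c y / (2 * c y)) := by ring
      _ = _ := by rw [e2, div_self (h2c y), one_mul, mul_one]
  have hDv : D (τ, y) = Real.exp (2 * (1 - κ) * L y) * H (y, Z) := rfl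
  rw [hτd, hyd, hDv]
  have hk : 2 * c y * (slope B δ y / (2 * c y)) = slope B δ y := mul_div_cancel₀ _ (h2c y)
  have hk2 : 2 * c y * (Real.exp (L y) / (2 * c y)) = Real.exp (L y) := mul_div_cancel₀ _ (h2c y)
  generalize slope B δ y / (2 * c y) = σ at *
  generalize Real.exp (L y) / (2 * c y) = ν at *
  generalize fderiv ℝ H (y, Z) (0, 1) = HZ at *
  generalize Real.exp (2 * (1 - κ) * L y) = E at *
  change (1 + τ * slope B δ y) * (E * (Real.exp (L y) * HZ)) - 2 * c y * _ + _ = -F * s1 y * _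
  linear_combination -hQZ - (E * (2 * (1 - κ)) * H (y, Z) + E * τ * Real.exp (L y) * HZ) * hk
    - E * HZ * hk2

/-- The solution of the second transport equation in the characteristic coordinates `(τ, y)`. -/
theorem exists_second_mode (F τ₀ a : ℝ) (hB : 0 < B) (hδ : 0 < δ) {D₁ : ℝ × ℝ → ℝ}
    (hD₁ : ContDiff ℝ ∞ D₁) :
    ∃ D : ℝ × ℝ → ℝ, ContDiff ℝ ∞ D ∧ (∀ y, D (τ₀, y) = 0) ∧ ∀ τ, 0 ≤ τ → ∀ y,
      fderiv ℝ D (τ, y) (1, 0) + slope B δ y * recip (τ * slope B δ y) * D (τ, y)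
      = recip (τ * slope B δ y) * (F * (-(2 / δ) * Real.tanh (y / δ) * slope B δ y)
        * recip (τ * slope B δ y) ^ 2 + a * slope B δ y * D₁ (τ, y)) := by
  set s1 : ℝ → ℝ := fun y => -(2 / δ) * Real.tanh (y / δ) * slope B δ y with hs1
  have ss := contDiff_slope B δ
  have ss1 : ContDiff ℝ ∞ s1 := (contDiff_const.mul (contDiff_tanh_div δ)).mul ss
  have f2 : ∀ {φ : ℝ → ℝ}, ContDiff ℝ ∞ φ → ContDiff ℝ ∞ fun z : ℝ × ℝ => φ z.2 := fun hφ =>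
    hφ.comp contDiff_snd
  have sr : ContDiff ℝ ∞ fun z : ℝ × ℝ => recip (z.1 * slope B δ z.2) :=
    contDiff_recip.comp (contDiff_fst.mul (f2 ss))
  set Q : ℝ × ℝ → ℝ := fun z => F * s1 z.2 * recip (z.1 * slope B δ z.2) ^ 2
    + a * slope B δ z.2 * D₁ z with hQ
  have sQ : ContDiff ℝ ∞ Q := ((contDiff_const.mul (f2 ss1)).mul (sr.pow 2)).add
    ((contDiff_const.mul (f2 ss)).mul hD₁)
  have sP := contDiff_primitive sQ
  -- Variation of constants at fixed `y`: for `τ ≥ 0` the factor `recip (τ s) = 1 / (1 + τ s)`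
  -- solves the homogeneous equation.
  set D : ℝ × ℝ → ℝ := fun z => recip (z.1 * slope B δ z.2)
    * (primitive Q z - primitive Q (τ₀, z.2)) with hD
  have sD : ContDiff ℝ ∞ D := sr.mul (sP.sub (sP.comp (contDiff_const.prodMk contDiff_snd)))
  refine ⟨D, sD, fun y => by simp [hD], fun τ hτ y => ?_⟩
  have h1 := hasDerivAt_comp_curve sD (hasDerivAt_id τ) (hasDerivAt_const τ y)
  have hr : HasDerivAt (fun τ => recip (τ * slope B δ y))
      (-recip (τ * slope B δ y) ^ 2 * slope B δ y) τ := by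
    have h3 : HasDerivAt (fun τ : ℝ => τ * slope B δ y) (slope B δ y) τ := by
      simpa using (hasDerivAt_id τ).mul_const (slope B δ y)
    exact (hasDerivAt_recip (mul_nonneg hτ (slope_nonneg hB.le hδ y))).comp τ h3
  have h2 := hr.fun_mul ((hasDerivAt_primitive sQ.continuous τ y).sub_const (primitive Q (τ₀, y)))
  have h4 := h1.unique h2
  simp only [id, one_mul, zero_mul, add_zero] at h4
  rw [h4]
  simp only [hD, hQ]
  ring

end Modes

/-- Pull back by `y = x - τ W`. Since `y_x = 1 - τ W_x = r` and `y_t = -W r`, the operator `∂ₜ + W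
∂ₓ` becomes `∂_τ`, and `∂ₜ + (W - 2 c) ∂ₓ` becomes `∂_τ - 2 c r ∂_y`; moreover `W_x = r s` and `W_xx
= r³ s'`, with `s` the slope at `y`. -/
theorem IsWave.exists_transportPair {κ c₀ T τ₀ A B δ cm : ℝ} {W : ℝ → ℝ → ℝ}
    (hW : IsWave T τ₀ A B δ W) (F : ℝ) (hT : 0 < T) (hτ : 0 ≤ τ₀) (hB : 0 < B) (hδ : 0 < δ)
    (hcm : 0 < cm) (hc : ∀ w ∈ Icc (A - B) (A + B), cm ≤ κ * w + c₀) :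
    ∃ V₁ V₂, IsTransportPair κ c₀ F T W V₁ V₂ := by
  obtain ⟨D₁, sD₁, z₁, e₁⟩ := exists_first_mode F hτ hB hδ hcm hc
  obtain ⟨D₂, sD₂, z₂, e₂⟩ := exists_second_mode F τ₀ (1 - 2 * κ) hB hδ sD₁
  have sτ : SmoothStrip T (fun t _ => τ₀ + t) := (SmoothStrip.const τ₀).add SmoothStrip.time
  have sY : SmoothStrip T (fun t x => x - (τ₀ + t) * W t x) :=
    SmoothStrip.space.sub (sτ.mul hW.smooth)
  have dt : ∀ {D : ℝ × ℝ → ℝ}, ContDiff ℝ ∞ D → ∀ t ∈ Ioo 0 T, ∀ x,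
      dT (fun t x => D (τ₀ + t, x - (τ₀ + t) * W t x)) t x
        = fderiv ℝ D (τ₀ + t, x - (τ₀ + t) * W t x) (1, 0)
          + (-(W t x) + (τ₀ + t) * (W t x * dX W t x))
            * fderiv ℝ D (τ₀ + t, x - (τ₀ + t) * W t x) (0, 1) := by
    intro D sD t ht x
    have h1 : HasDerivAt (fun t => τ₀ + t) 1 t := (hasDerivAt_id t).const_add τ₀
    have h2 := (h1.fun_mul (hW.smooth.hasDerivAt_dT ht x)).const_sub x
    have h3 := (hasDerivAt_comp_curve sD h1 h2).deriv
    have h4 : dT W t x = -(W t x * dX W t x) := by linarith [hW.equation t ht x]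
    rw [h4] at h3
    refine h3.trans ?_
    ring
  have dx : ∀ {D : ℝ × ℝ → ℝ}, ContDiff ℝ ∞ D → ∀ t ∈ Ioo 0 T, ∀ x,
      dX (fun t x => D (τ₀ + t, x - (τ₀ + t) * W t x)) t x
        = (1 - (τ₀ + t) * dX W t x)
          * fderiv ℝ D (τ₀ + t, x - (τ₀ + t) * W t x) (0, 1) := by
    intro D sD t ht x
    have h2 := (hasDerivAt_id x).fun_sub
      ((hW.smooth.hasDerivAt_dX (Ioo_subset_Icc_self ht) x).const_mul (τ₀ + t))
    have h3 := (hasDerivAt_comp_curve sD (hasDerivAt_const x (τ₀ + t)) h2).deriv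
    refine h3.trans ?_
    simp
  have facts : ∀ t ∈ Ioo 0 T, ∀ x,
      recip ((τ₀ + t) * slope B δ (x - (τ₀ + t) * W t x)) = 1 - (τ₀ + t) * dX W t x ∧
      (1 - (τ₀ + t) * dX W t x) * (1 + (τ₀ + t) * slope B δ (x - (τ₀ + t) * W t x)) = 1 ∧
      dX W t x = (1 - (τ₀ + t) * dX W t x) * slope B δ (x - (τ₀ + t) * W t x) ∧
      dX (dX W) t x = (1 - (τ₀ + t) * dX W t x) ^ 3 * (-(2 / δ)
        * Real.tanh ((x - (τ₀ + t) * W t x) / δ) * slope B δ (x - (τ₀ + t) * W t x)) := by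
    intro t ht x
    have ht' := Ioo_subset_Icc_self ht
    have hq := hW.slope_eq t ht' x
    have hs := slope_nonneg hB.le hδ (x - (τ₀ + t) * W t x)
    have hp := mul_nonneg (add_nonneg hτ ht'.1) hs
    have hr : (1 - (τ₀ + t) * dX W t x) * (1 + (τ₀ + t) * slope B δ (x - (τ₀ + t) * W t x)) = 1 := by
      linear_combination -(τ₀ + t) * hq
    have hq' : dX W t x = (1 - (τ₀ + t) * dX W t x) * slope B δ (x - (τ₀ + t) * W t x) := by
      linear_combination hq
    refine ⟨?_, hr, hq', ?_⟩
    · rw [recip_eq (by linarith), eq_comm]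
      exact eq_div_of_mul_eq (by linarith) hr
    · have h1 := ((hW.profileRel hB hδ hτ hT ht').1.q_deriv x).deriv
      have hθ : (W t x - A) / B = Real.tanh ((x - (τ₀ + t) * W t x) / δ) := by
        have := hW.trace t ht' x
        rw [profile] at this
        rw [div_eq_iff hB.ne']
        linarith
      rw [hθ] at h1
      refine h1.trans ?_
      generalize hrr : 1 - (τ₀ + t) * dX W t x = r at *
      rw [hq']
      ring
  refine ⟨fun t x => D₁ (τ₀ + t, x - (τ₀ + t) * W t x), fun t x => D₂ (τ₀ + t, x - (τ₀ + t) * W t x),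
    SmoothStrip.comp₂ sD₁ sτ sY, SmoothStrip.comp₂ sD₂ sτ sY, fun t ht x => ?_, fun t ht x => ?_,
    fun x => by simp [z₁], fun x => by simp [z₂]⟩
  · obtain ⟨k1, k2, k3, k4⟩ := facts t ht x
    have he := e₁ (τ₀ + t) (x - (τ₀ + t) * W t x)
    rw [k1, hW.trace t (Ioo_subset_Icc_self ht) x] at he
    rw [dt sD₁ t ht x, dx sD₁ t ht x, k4, eig1]
    generalize fderiv ℝ D₁ (τ₀ + t, x - (τ₀ + t) * W t x) (1, 0) = Dt at *
    generalize fderiv ℝ D₁ (τ₀ + t, x - (τ₀ + t) * W t x) (0, 1) = Dy at *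
    generalize D₁ (τ₀ + t, x - (τ₀ + t) * W t x) = Dv at *
    generalize slope B δ (x - (τ₀ + t) * W t x) = s at *
    generalize hrr : 1 - (τ₀ + t) * dX W t x = r at *
    linear_combination r * he - Dt * k2 + 2 * (1 - κ) * Dv * k3 - W t x * Dy * hrr
  · obtain ⟨k1, k2, k3, k4⟩ := facts t ht x
    have he := e₂ (τ₀ + t) (add_nonneg hτ ht.1.le) (x - (τ₀ + t) * W t x)
    rw [k1] at he
    rw [dt sD₂ t ht x, dx sD₂ t ht x, k4]
    generalize fderiv ℝ D₂ (τ₀ + t, x - (τ₀ + t) * W t x) (1, 0) = Dt at *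
    generalize fderiv ℝ D₂ (τ₀ + t, x - (τ₀ + t) * W t x) (0, 1) = Dy at *
    generalize D₂ (τ₀ + t, x - (τ₀ + t) * W t x) = Dv at *
    generalize D₁ (τ₀ + t, x - (τ₀ + t) * W t x) = Dw at *
    generalize slope B δ (x - (τ₀ + t) * W t x) = s at *
    generalize hrr : 1 - (τ₀ + t) * dX W t x = r at *
    linear_combination he + (Dv - (1 - 2 * κ) * Dw) * k3 - W t x * Dy * hrr

end HypWave

end

/-! ### Assembly of the estimates and existence -/

theorem lemma2p3 (γ ρm um ρp up μ lam T t₀ : ℝ) (hγ : 1 ≤ γ)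
    (hpair : HypWave.IsRarefactionPair γ ρm um ρp up)
    (hμ : 0 < μ) (hlam : 0 ≤ μ + lam) (hT : 0 < T) (ht₀ : 0 ≤ t₀) :
    ∃ C : ℝ, 0 < C ∧ ∀ ε δ : ℝ, 0 < ε → 0 < δ → ∀ ρ u : ℝ → ℝ → ℝ,
      HypWave.IsApproxRarefaction γ ρm um ρp up t₀ δ ρ u →
      (∃ d₁ d₂ : ℝ → ℝ → ℝ, HypWave.IsHyperbolicWave γ μ lam ε T ρ u d₁ d₂) ∧
      ∀ d₁ d₂ : ℝ → ℝ → ℝ, HypWave.IsHyperbolicWave γ μ lam ε T ρ u d₁ d₂ →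
        (∀ k : ℕ, k ≤ 3 → ∀ t ∈ Icc 0 T,
          eLpNorm (HypWave.pairFun (iteratedDeriv k (d₁ t)) (iteratedDeriv k (d₂ t))) 2 volume ^ 2
            ≤ ENNReal.ofReal (C * (ε / δ ^ (k + 1)) ^ 2)) ∧
        (⨆ t ∈ Icc 0 T, eLpNorm (HypWave.pairFun (d₁ t) (d₂ t)) ⊤ volume)
            ≤ ENNReal.ofReal (C * (ε / δ ^ (3 / 2 : ℝ))) := by
  set κ := (γ - 1) / (γ + 1) with hκ
  set c₀ := 2 / (γ + 1) - κ * HypWave.riemann2 γ ρm um with hc₀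
  set wm := HypWave.eig2 γ ρm um with hwm
  set wp := HypWave.eig2 γ ρp up with hwp
  have hlt : wm < wp := hpair.expanding
  have hκ0 : 0 ≤ κ := div_nonneg (by linarith) (by linarith)
  have hκ1 : κ < 1 := by rw [hκ, div_lt_one (by linarith)]; linarith
  have hB : 0 < (wp - wm) / 2 := by linarith
  have hcm := HypWave.soundSpeed_pos hγ hpair.left_pos
  -- Since `κ ≥ 0`, the sound speed on the wave is smallest at the left state; this bound does not
  -- depend on `δ`.
  have hc : ∀ w ∈ Icc ((wp + wm) / 2 - (wp - wm) / 2) ((wp + wm) / 2 + (wp - wm) / 2),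
      HypWave.soundSpeed γ ρm ≤ κ * w + c₀ := by
    intro w hw
    rw [HypWave.soundSpeed_affine (u := um) hγ hpair.left_pos]
    have h1 : wm ≤ w := by linarith [hw.1]
    have := mul_le_mul_of_nonneg_left h1 hκ0
    linarith
  obtain ⟨C, hC, H⟩ := HypWave.IsReducedWave.exists_bound hT ht₀ hB hcm hc
  set K := (2 * μ + lam) * (1 - κ) with hK
  have hK0 : 0 < K := mul_pos (by linarith) (by linarith)
  -- The first term serves the `L²` bound of the pair, the second the sup bound, and the `1` ensures
  -- positivity.
  refine ⟨2 * C * K ^ 2 + 2 * √C * K + 1, by positivity, fun ε δ hε hδ ρ u hρu => ?_⟩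
  obtain ⟨W, hW, hfac⟩ := hρu.exists_wave hγ hpair ht₀ T
  have hiff := HypWave.isHyperbolicWave_iff (μ := μ) (lam := lam) (ε := ε) hγ hW.smooth hT hρu.pos
    (fun t ht x => (hfac t ht x).1) (fun t ht x => (hfac t ht x).2)
  rw [← hκ, ← hc₀, ← hK] at hiff
  have hF : |K * ε| = K * ε := abs_of_pos (by positivity)
  refine ⟨?_, fun d₁ d₂ hd => ?_⟩
  · obtain ⟨V₁, V₂, hV⟩ := hW.exists_transportPair (K * ε) hT ht₀ hB hδ hcm hc
    exact ⟨_, _, (hiff _ _).2 (hV.isReducedWave hW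
      fun t ht x => hcm.trans_le (hc _ (hW.mem_Icc hB.le ht x)))⟩
  · have hbound := H hδ hW ((hiff d₁ d₂).1 hd)
    rw [hF] at hbound
    have hsq : 0 ≤ 2 * √C * K + 1 := by positivity
    refine ⟨fun k hk t ht => ?_, iSup₂_le fun t ht => ?_⟩
    · obtain ⟨b₁, b₂⟩ := hbound t ht
      refine (HypWave.eLpNorm_pairFun_sq_le (HypWave.continuous_iteratedDeriv' b₁.smooth k)
        (HypWave.continuous_iteratedDeriv' b₂.smooth k) (b₁.bound k hk) (b₂.bound k hk)).trans ?_
      refine ENNReal.ofReal_le_ofReal ?_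
      have e : K * ε * δ⁻¹ ^ (k + 1) = K * (ε / δ ^ (k + 1)) := by
        rw [inv_pow, div_eq_mul_inv]; ring
      rw [e]
      have := mul_nonneg hsq (sq_nonneg (ε / δ ^ (k + 1)))
      linarith
    · obtain ⟨b₁, b₂⟩ := hbound t ht
      have hX : 0 ≤ ε / δ ^ (3 / 2 : ℝ) := by positivity
      refine HypWave.eLpNorm_top_pairFun_le (by positivity) fun x => ?_
      have hδ3 : (δ ^ (3 / 2 : ℝ)) ^ 2 = δ ^ 3 := by
        rw [← Real.rpow_natCast (δ ^ (3 / 2 : ℝ)), ← Real.rpow_mul hδ.le, ← Real.rpow_natCast δ 3]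
        norm_num
      have h1 := b₁.sq_le (inv_pos.2 hδ) x
      have h2 := b₂.sq_le (inv_pos.2 hδ) x
      have e : (2 * √C * K * (ε / δ ^ (3 / 2 : ℝ))) ^ 2 = 4 * C * (K * ε) ^ 2 * δ⁻¹ ^ 3 := by
        rw [mul_pow, div_pow, hδ3, mul_pow, mul_pow, Real.sq_sqrt hC, inv_pow, div_eq_mul_inv]
        ring
      have h3 : 2 * √C * K * (ε / δ ^ (3 / 2 : ℝ))
          ≤ (2 * C * K ^ 2 + 2 * √C * K + 1) * (ε / δ ^ (3 / 2 : ℝ)) := by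
        refine mul_le_mul_of_nonneg_right ?_ hX
        linarith [mul_nonneg (mul_nonneg two_pos.le hC) (sq_nonneg K)]
      have h4 := pow_le_pow_left₀ (by positivity) h3 2
      rw [e] at h4
      linarith
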